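/- Let $\mathbb F$ be an algebraically closed field of characteristic zero. For a Lie superalgebra $\mathfrak g=\mathfrak g_{\bar 0}\oplus\mathfrak g_{\bar 1}$, a $\mathbb Z$-grading is a decomposition $\mathfrak g=\bigoplus_{j\in\mathbb Z}\mathfrak g(j)$ into subspaces, each the direct sum of its even and odd part, with $[\mathfrak g(i),\mathfrak g(j)]\subseteq\mathfrak g(i+j)$. It is a \emph{good grading for} $e\in\mathfrak g_{\bar 0}$ if $e\in\mathfrak g(2)$ and $\operatorname{ad}e:\mathfrak g(j)\to\mathfrak g(j+2)$ is injective for $j\le -1$ and surjective for $j\ge -1$. Let $p$ be a partition of $m$ and $q$ a partition of $n$ ($m,n\ge 0$). Merge the parts of $p$ and $q$ into one non-increasing sequence $r_1\ge\dots\ge r_N$ in which a part of $p$ precedes an equal part of $q$. A pyramid $P\in \mathrm{Pyr}(p,q)$ consists of $N$ rows of $2\times 2$ boxes; the $j$-th row has $r_j$ boxes, centered at $(f_j,2j-1),(f_j+2,2j-1),\dots,(l_j,2j-1)$ with integers $f_j$ and $l_j=f_j+2(r_j-1)$, such that $f_1=-l_1$ and $f_j\le f_{j+1}\le l_{j+1}\le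 l_j$ for all $j$. The boxes of the $j$-th row are even if $r_j$ comes from $p$ and odd if it comes from $q$. Fix a labelling of the boxes (indexed by row and position, hence the same for all $P\in\mathrm{Pyr}(p,q)$) which matches the even boxes with a basis $v_1,\dots,v_m$ of $V_0=\mathbb F^m$ and the odd boxes with a basis $v_{m+1},\dots,v_{m+n}$ of $V_1=\mathbb F^n$. Let $e_{p,q}\in\mathfrak{gl}(m|n)_{\bar 0}$ send each basis vector to the one labelling the box to the right of its box, or to $0$ if there is none, and let $h(P)$ be the diagonal matrix whose $i$-th diagonal entry is the first coordinate of the box labelled by $v_i$. For $H\in \mathfrak{gl}(m|n)_{\bar 0}$, the grading given by $\operatorname{ad}H$ is the one whose degree $j$ component is the $j$-eigenspace of $\operatorname{ad}H$. \begin{enumerate} \item For every $P\in\mathrm{Pyr}(p,q)$, the grading given by $\operatorname{ad}h(P)$ is a good $\mathbb Z$-grading of $\mathfrak{gl}(m|n)$ for $e_{p,q}$. \item Conversely, every good $\mathbb Z$-grading of $\mathfrak{gl}(m|n)$ for $e_{p,q}$ is of this form up to conjugation: it is given by $\operatorname{ad}(g\,h(P)\,g^{-1})$ for some $P\in\mathrm{Pyr}(p,q)$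 and some $g\in GL(V_0)\times GL(V_1)$ with $g\,e_{p,q}\,g^{-1}=e_{p,q}$. If all diagonal matrices have degree $0$, then the grading is given by $\operatorname{ad}h(P)$ itself for some $P\in\mathrm{Pyr}(p,q)$. \item If $m\ne n$, then $\mathfrak{gl}(m|n)(j)\mapsto\mathfrak{gl}(m|n)(j)\cap\mathfrak{sl}(m|n)$ defines a bijection from the good gradings of $\mathfrak{gl}(m|n)$ for $e_{p,q}$ onto the good gradings of $\mathfrak{sl}(m|n)$ for $e_{p,q}$. \item If $m=n\ne 2$, then sending $\mathfrak{gl}(n|n)(j)$ to the image of $\mathfrak{gl}(n|n)(j)\cap\mathfrak{sl}(n|n)$ in $\mathfrak{psl}(n|n)=\mathfrak{sl}(n|n)/\mathbb F I_{2n}$ defines a bijection from the good gradings of $\mathfrak{gl}(n|n)$ for $e_{p,q}$ onto the good gradings of $\mathfrak{psl}(n|n)$ for the image of $e_{p,q}$. \end{enumerate} -/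

import Mathlib

/-! ### Lie superalgebras -/

/-- The sign `(-1)^{ab}` for parities `a, b`. -/
def superSign (F : Type*) [Field F] (a b : ZMod 2) : F := (-1) ^ (a.val * b.val)

/-- A Lie superalgebra structure on the vector space `L`. -/
structure LieSuperalgebra (F : Type*) (L : Type*) [Field F] [AddCommGroup L] [Module F L] where
  /-- the even part (index `0`) and the odd part (index `1`) -/
  parity : ZMod 2 → Submodule F L
  isCompl : IsCompl (parity 0) (parity 1)
  /-- the superbracket -/
  bracket : L →ₗ[F] L →ₗ[F] L
  bracket_mem : ∀ {a b : ZMod 2} {x y : L}, x ∈ parity a → y ∈ parity b →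
    bracket x y ∈ parity (a + b)
  skew : ∀ {a b : ZMod 2} {x y : L}, x ∈ parity a → y ∈ parity b →
    bracket x y = -(superSign F a b • bracket y x)
  jacobi : ∀ {a b c : ZMod 2} {x y z : L}, x ∈ parity a → y ∈ parity b → z ∈ parity c →
    bracket x (bracket y z) =
      bracket (bracket x y) z + superSign F a b • bracket y (bracket x z)

namespace LieSuperalgebra

section General

variable {F L : Type*} [Field F] [AddCommGroup L] [Module F L]

/-- A subspace which is the sum of its even and its odd part. -/
def IsHomogeneous (G : LieSuperalgebra F L) (S : Submodule F L) : Prop :=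
  S ≤ (S ⊓ G.parity 0) ⊔ (S ⊓ G.parity 1)

/-- The Lie superalgebra structure on a homogeneous subspace closed under the bracket. -/
def sub (G : LieSuperalgebra F L) (S : Submodule F L)
    (hS : G.IsHomogeneous S) (hb : ∀ x ∈ S, ∀ y ∈ S, G.bracket x y ∈ S) :
    LieSuperalgebra F S where
  parity a := (G.parity a).comap S.subtype
  isCompl := by
    constructor
    · rw [Submodule.disjoint_def]
      intro x h0 h1
      exact Subtype.ext ((Submodule.disjoint_def.1 G.isCompl.disjoint) x h0 h1)
    · rw [codisjoint_iff, eq_top_iff]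
      rintro ⟨x, hx⟩ -
      obtain ⟨y, hy, z, hz, rfl⟩ := Submodule.mem_sup.1 (hS hx)
      exact Submodule.mem_sup.2 ⟨⟨y, hy.1⟩, hy.2, ⟨z, hz.1⟩, hz.2, rfl⟩
  bracket := LinearMap.mk₂ F (fun x y : S => (⟨G.bracket x y, hb x x.2 y y.2⟩ : S))
    (fun _ _ _ => by ext; simp) (fun _ _ _ => by ext; simp)
    (fun _ _ _ => by ext; simp) (fun _ _ _ => by ext; simp)
  bracket_mem := fun hx hy => G.bracket_mem hx hy
  skew := fun hx hy => Subtype.ext (G.skew hx hy)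
  jacobi := fun hx hy hz => Subtype.ext (G.jacobi hx hy hz)

/-- The Lie superalgebra structure on the quotient by a homogeneous ideal. -/
def quotient (G : LieSuperalgebra F L) (I : Submodule F L) (hI : G.IsHomogeneous I)
    (hl : ∀ x, ∀ y ∈ I, G.bracket x y ∈ I) (hr : ∀ x ∈ I, ∀ y, G.bracket x y ∈ I) :
    LieSuperalgebra F (L ⧸ I) where
  parity a := (G.parity a).map I.mkQ
  isCompl := by
    constructor
    · rw [Submodule.disjoint_def]
      rintro x ⟨y, hy, rfl⟩ ⟨z, hz, hzy⟩
      have h : y - z ∈ I := (Submodule.Quotient.eq I).1 hzy.symm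
      obtain ⟨u, hu, v, hv, huv⟩ := Submodule.mem_sup.1 (hI h)
      have h1 : y - u = z + v := by
        rw [sub_eq_iff_eq_add] at *
        rw [show z + v + u = (u + v) + z by abel, huv]; abel
      have h2 : y - u = 0 := Submodule.disjoint_def.1 G.isCompl.disjoint _
        (Submodule.sub_mem _ hy hu.2) (h1 ▸ Submodule.add_mem _ hz hv.2)
      rw [sub_eq_zero.1 h2]
      exact (Submodule.Quotient.mk_eq_zero I).2 hu.1
    · rw [codisjoint_iff, ← Submodule.map_sup, G.isCompl.sup_eq_top, Submodule.map_top,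
        Submodule.range_mkQ]
  bracket := I.liftQ
    (I.mapQLinear I ∘ₗ G.bracket.codRestrict (I.compatibleMaps I) (fun x y hy => hl x y hy))
    (by
      intro x hx
      ext y
      exact (Submodule.Quotient.mk_eq_zero I).2 (hr x hx y))
  bracket_mem := by
    rintro a b _ _ ⟨x, hx, rfl⟩ ⟨y, hy, rfl⟩
    exact ⟨_, G.bracket_mem hx hy, rfl⟩
  skew := by
    rintro a b _ _ ⟨x, hx, rfl⟩ ⟨y, hy, rfl⟩
    exact congrArg I.mkQ (G.skew hx hy)
  jacobi := by
    rintro a b c _ _ _ ⟨x, hx, rfl⟩ ⟨y, hy, rfl⟩ ⟨z, hz, rfl⟩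
    exact congrArg I.mkQ (G.jacobi hx hy hz)

/-- `𝒜` is a `ℤ`-grading of the Lie superalgebra `G`. -/
structure IsGrading (G : LieSuperalgebra F L) (𝒜 : ℤ → Submodule F L) : Prop where
  isInternal : DirectSum.IsInternal 𝒜
  homogeneous : ∀ j, G.IsHomogeneous (𝒜 j)
  bracket_mem : ∀ {i j : ℤ} {x y : L}, x ∈ 𝒜 i → y ∈ 𝒜 j → G.bracket x y ∈ 𝒜 (i + j)

/-- `𝒜` is a `ℤ`-grading of `G` and `e` is a good element for it. -/
structure IsGoodGrading (G : LieSuperalgebra F L) (e : L) (𝒜 : ℤ → Submodule F L) : Prop where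
  isGrading : G.IsGrading 𝒜
  even : e ∈ G.parity 0
  mem_two : e ∈ 𝒜 2
  injOn : ∀ j : ℤ, j ≤ -1 → Set.InjOn (G.bracket e) (𝒜 j)
  surjOn : ∀ j : ℤ, -1 ≤ j → Set.SurjOn (G.bracket e) (𝒜 j) (𝒜 (j + 2))

/-- The family of eigenspaces of `ad H` with integer eigenvalues. -/
def adGrading (G : LieSuperalgebra F L) (H : L) (j : ℤ) : Submodule F L :=
  Module.End.eigenspace (G.bracket H) (j : F)

end General

/-! ### `gl(m|n)`, `sl(m|n)`, `psl(n|n)` -/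

/-- Parity of the basis vectors of `V₀ ⊕ V₁`. -/
def idxParity {m n : ℕ} : Fin m ⊕ Fin n → ZMod 2 := Sum.elim (fun _ => 0) (fun _ => 1)

/-- The underlying vector space of `gl(m|n)`: matrices of size `m + n`. -/
abbrev Mat (F : Type*) (m n : ℕ) := Matrix (Fin m ⊕ Fin n) (Fin m ⊕ Fin n) F

section Linear

variable (F : Type*) [Field F] (m n : ℕ)

/-- Block-diagonal matrices (`a = 0`) and block-off-diagonal matrices (`a = 1`). -/
def matParity (a : ZMod 2) : Submodule F (Mat F m n) where
  carrier := {X | ∀ i j, idxParity i + idxParity j ≠ a → X i j = 0}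
  zero_mem' := fun _ _ _ => rfl
  add_mem' := fun hX hY i j h => by simp [hX i j h, hY i j h]
  smul_mem' := fun c X hX i j h => by simp [hX i j h]

/-- The component of parity `a` of a matrix. -/
def matComp (a : ZMod 2) : Mat F m n →ₗ[F] Mat F m n where
  toFun X := Matrix.of fun i j => if idxParity i + idxParity j = a then X i j else 0
  map_add' X Y := by ext i j; by_cases h : idxParity i + idxParity j = a <;> simp [h]
  map_smul' c X := by ext i j; by_cases h : idxParity i + idxParity j = a <;> simp [h]

/-- The supercommutator: `[X, Y] = X Y - (-1)^{ab} Y X` for `X, Y` of parities `a, b`,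
extended bilinearly. -/
def matBracket : Mat F m n →ₗ[F] Mat F m n →ₗ[F] Mat F m n :=
  ∑ a : ZMod 2, ∑ b : ZMod 2,
    (LinearMap.mul F (Mat F m n) - superSign F a b • (LinearMap.mul F (Mat F m n)).flip).compl₁₂
      (matComp F m n a) (matComp F m n b)

variable {F m n}

theorem matComp_of_mem {a : ZMod 2} {X : Mat F m n} (hX : X ∈ matParity F m n a) (b : ZMod 2) :
    matComp F m n b X = if b = a then X else 0 := by
  ext i j
  by_cases h : idxParity i + idxParity j = a
  · by_cases hb : b = a
    · simp [matComp, h, hb]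
    · simp [matComp, h, hb, Ne.symm hb]
  · have := hX i j h
    by_cases hb : b = a <;> simp [matComp, this, hb]

theorem matBracket_of_mem {a b : ZMod 2} {X Y : Mat F m n}
    (hX : X ∈ matParity F m n a) (hY : Y ∈ matParity F m n b) :
    matBracket F m n X Y = X * Y - superSign F a b • (Y * X) := by
  simp only [matBracket, LinearMap.sum_apply, LinearMap.compl₁₂_apply, matComp_of_mem hX,
    matComp_of_mem hY]
  rw [Finset.sum_eq_single a, Finset.sum_eq_single b]
  · simp
  · intro c _ hc; simp [hc]
  · simp
  · intro c _ hc; simp [hc]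
  · simp

theorem mul_mem_matParity {a b : ZMod 2} {X Y : Mat F m n}
    (hX : X ∈ matParity F m n a) (hY : Y ∈ matParity F m n b) :
    X * Y ∈ matParity F m n (a + b) := by
  intro i j h
  rw [Matrix.mul_apply]
  refine Finset.sum_eq_zero fun k _ => ?_
  by_cases h1 : idxParity i + idxParity k = a
  · by_cases h2 : idxParity k + idxParity j = b
    · exfalso; apply h; subst h1 h2
      generalize idxParity i = x; generalize idxParity j = y; generalize idxParity k = z
      revert x y z; decide
    · rw [hY k j h2, mul_zero]
  · rw [hX i k h1, zero_mul]

theorem matComp_mem (a : ZMod 2) (X : Mat F m n) : matComp F m n a X ∈ matParity F m n a := by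
  intro i j h; simp [matComp, h]

theorem matComp_add (X : Mat F m n) : matComp F m n 0 X + matComp F m n 1 X = X := by
  ext i j
  have : ∀ c : ZMod 2, c = 0 ∨ c = 1 := by decide
  rcases this (idxParity i + idxParity j) with h | h <;> simp [matComp, h]

theorem matBracket_mem {a b : ZMod 2} {X Y : Mat F m n}
    (hX : X ∈ matParity F m n a) (hY : Y ∈ matParity F m n b) :
    matBracket F m n X Y ∈ matParity F m n (a + b) := by
  rw [matBracket_of_mem hX hY]
  exact Submodule.sub_mem _ (mul_mem_matParity hX hY)
    (Submodule.smul_mem _ _ (add_comm b a ▸ mul_mem_matParity hY hX))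

variable (F m n)

/-- The Lie superalgebra `gl(m|n)`. -/
def gl : LieSuperalgebra F (Mat F m n) where
  parity := matParity F m n
  isCompl := by
    constructor
    · rw [Submodule.disjoint_def]
      intro X h0 h1
      have := matComp_of_mem h0 0
      rw [matComp_of_mem h1 0] at this
      simpa using this.symm
    · rw [codisjoint_iff, eq_top_iff]
      intro X _
      exact Submodule.mem_sup.2 ⟨_, matComp_mem 0 X, _, matComp_mem 1 X, matComp_add X⟩
  bracket := matBracket F m n
  bracket_mem := matBracket_mem
  skew := by
    intro a b X Y hX hY
    rw [matBracket_of_mem hX hY, matBracket_of_mem hY hX]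
    have h : ∀ c : ZMod 2, c = 0 ∨ c = 1 := by decide
    rcases h a with rfl | rfl <;> rcases h b with rfl | rfl <;>
      simp [superSign, ZMod.val_one'', add_comm]
  jacobi := by
    intro a b c X Y Z hX hY hZ
    rw [matBracket_of_mem hX (matBracket_mem hY hZ), matBracket_of_mem (matBracket_mem hX hY) hZ,
      matBracket_of_mem hY (matBracket_mem hX hZ), matBracket_of_mem hX hY,
      matBracket_of_mem hY hZ, matBracket_of_mem hX hZ]
    have h : ∀ c : ZMod 2, c = 0 ∨ c = 1 := by decide
    have h2 : (1 + 1 : ZMod 2) = 0 := by decide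
    rcases h a with rfl | rfl <;> rcases h b with rfl | rfl <;> rcases h c with rfl | rfl <;>
      simp [superSign, ZMod.val_one'', h2] <;> noncomm_ring

/-- The supertrace `tr A - tr B`. -/
def supertrace : Mat F m n →ₗ[F] F where
  toFun X := X.toBlocks₁₁.trace - X.toBlocks₂₂.trace
  map_add' X Y := by
    simp [Matrix.trace, Matrix.toBlocks₁₁, Matrix.toBlocks₂₂, Finset.sum_add_distrib]; ring
  map_smul' c X := by
    simp [Matrix.trace, Matrix.toBlocks₁₁, Matrix.toBlocks₂₂, ← Finset.mul_sum, mul_sub]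

variable {F m n}

theorem supertrace_eq (X : Mat F m n) :
    supertrace F m n X = ∑ i, superSign F (idxParity i) (idxParity i) * X i i := by
  simp [supertrace, Matrix.trace, Matrix.toBlocks₁₁, Matrix.toBlocks₂₂, idxParity, superSign,
    ZMod.val_one'', sub_eq_add_neg]

theorem supertrace_odd {X : Mat F m n} (hX : X ∈ matParity F m n 1) :
    supertrace F m n X = 0 := by
  rw [supertrace_eq]
  refine Finset.sum_eq_zero fun i _ => ?_
  have h : ∀ c : ZMod 2, c + c ≠ 1 := by decide
  rw [hX i i (h _), mul_zero]

theorem supertrace_mul {a b : ZMod 2} {X Y : Mat F m n}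
    (hX : X ∈ matParity F m n a) (hY : Y ∈ matParity F m n b) :
    supertrace F m n (X * Y) = superSign F a b * supertrace F m n (Y * X) := by
  have h : ∀ c : ZMod 2, c = 0 ∨ c = 1 := by decide
  simp only [supertrace_eq, Matrix.mul_apply, Finset.mul_sum]
  rw [Finset.sum_comm]
  refine Finset.sum_congr rfl fun k _ => Finset.sum_congr rfl fun i _ => ?_
  by_cases h1 : idxParity i + idxParity k = a
  · by_cases h2 : idxParity k + idxParity i = b
    · subst h1 h2
      rcases h (idxParity i) with h3 | h3 <;> rcases h (idxParity k) with h4 | h4 <;>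
        simp [h3, h4, superSign, ZMod.val_one'', mul_comm,
          show (1 + 1 : ZMod 2) = 0 by decide]
    · rw [hY k i h2]; simp
  · rw [hX i k h1]; simp

theorem supertrace_bracket (X Y : Mat F m n) : supertrace F m n (matBracket F m n X Y) = 0 := by
  have key : ∀ {a b : ZMod 2} {X Y : Mat F m n}, X ∈ matParity F m n a →
      Y ∈ matParity F m n b → supertrace F m n (matBracket F m n X Y) = 0 := by
    intro a b X Y hX hY
    rw [matBracket_of_mem hX hY, map_sub, map_smul, supertrace_mul hX hY, smul_eq_mul, sub_self]
  rw [← matComp_add X, ← matComp_add Y]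
  simp only [map_add, LinearMap.add_apply]
  simp [key (matComp_mem _ X) (matComp_mem _ Y)]

variable (F m n)

/-- The underlying vector space of `sl(m|n)`. -/
abbrev slSub : Submodule F (Mat F m n) := LinearMap.ker (supertrace F m n)

/-- The Lie superalgebra `sl(m|n)`. -/
def sl : LieSuperalgebra F (slSub F m n) :=
  (gl F m n).sub (slSub F m n)
    (by
      intro X hX
      have h1 : matComp F m n 1 X ∈ slSub F m n := supertrace_odd (matComp_mem 1 X)
      have h0 : matComp F m n 0 X ∈ slSub F m n := by
        rw [← matComp_add X] at hX
        exact (Submodule.add_mem_iff_left _ h1).1 hX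
      exact Submodule.mem_sup.2 ⟨_, ⟨h0, matComp_mem 0 X⟩, _, ⟨h1, matComp_mem 1 X⟩,
        matComp_add X⟩)
    (fun X _ Y _ => supertrace_bracket X Y)

/-- The scalar matrices contained in `sl(m|n)`; for `m = n` these are all scalar matrices. -/
abbrev slScalars : Submodule F (slSub F m n) :=
  (Submodule.span F {(1 : Mat F m n)}).comap (slSub F m n).subtype

variable {F m n}

theorem scalar_mem_even {X : Mat F m n} (hX : X ∈ Submodule.span F {(1 : Mat F m n)}) :
    X ∈ matParity F m n 0 := by
  obtain ⟨c, rfl⟩ := Submodule.mem_span_singleton.1 hX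
  refine Submodule.smul_mem _ c ?_
  intro i j h
  have h' : ∀ c : ZMod 2, c + c = 0 := by decide
  exact Matrix.one_apply_ne (fun hij => h (hij ▸ h' _))

theorem matBracket_scalar {X : Mat F m n} (hX : X ∈ Submodule.span F {(1 : Mat F m n)})
    (Y : Mat F m n) : matBracket F m n X Y = 0 ∧ matBracket F m n Y X = 0 := by
  have h0 := scalar_mem_even hX
  obtain ⟨c, rfl⟩ := Submodule.mem_span_singleton.1 hX
  rw [← matComp_add Y]
  simp only [map_add, LinearMap.add_apply, matBracket_of_mem h0 (matComp_mem _ Y),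
    matBracket_of_mem (matComp_mem _ Y) h0]
  simp [superSign]

variable (F m n)

/-- The Lie superalgebra `psl(m|n)`, that is `sl(m|n)` modulo its scalar matrices; it is
used for `m = n` only. -/
def psl : LieSuperalgebra F (slSub F m n ⧸ slScalars F m n) :=
  (sl F m n).quotient (slScalars F m n)
    (fun X hX => Submodule.mem_sup_left ⟨hX, scalar_mem_even hX⟩)
    (fun X Y hY => by
      have : (sl F m n).bracket X Y = 0 := Subtype.ext (matBracket_scalar hY X.1).2
      rw [this]; exact Submodule.zero_mem _)
    (fun X hX Y => by
      have : (sl F m n).bracket X Y = 0 := Subtype.ext (matBracket_scalar hX Y.1).1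
      rw [this]; exact Submodule.zero_mem _)

variable {F m n}

/-- The subspaces of `sl(m|n)` induced by a family of subspaces of `gl(m|n)`. -/
def inducedSl (𝒜 : ℤ → Submodule F (Mat F m n)) (j : ℤ) : Submodule F (slSub F m n) :=
  (𝒜 j).comap (slSub F m n).subtype

/-- The subspaces of `psl(m|n)` induced by a family of subspaces of `gl(m|n)`. -/
def inducedPsl (𝒜 : ℤ → Submodule F (Mat F m n)) (j : ℤ) :
    Submodule F (slSub F m n ⧸ slScalars F m n) :=
  (inducedSl 𝒜 j).map (slScalars F m n).mkQ

end Linear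

end LieSuperalgebra

/-! ### Pyramids -/

/-- A pyramid with `N` rows. Row `j` (with `j = 0, …, N - 1`, counted from below) consists of
`len j` boxes; box `k` of row `j` is the `2 × 2` box centered at `(first j + 2 k, 2 j + 1)`.
Every box has a parity. -/
structure Pyramid (N : ℕ) where
  /-- first coordinate of the leftmost box of each row -/
  first : Fin N → ℤ
  /-- number of boxes of each row -/
  len : Fin N → ℕ
  len_pos : ∀ j, 0 < len j
  /-- parities of the boxes -/
  parity : (Σ j : Fin N, Fin (len j)) → ZMod 2
  /-- the bottom row is centered -/
  centered : ∀ j : Fin N, (j : ℕ) = 0 → first j = -(first j + 2 * ((len j : ℤ) - 1))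
  /-- the first coordinates `f j` and `l j` of the leftmost and rightmost box of row `j` satisfy
  `f j ≤ f (j + 1) ≤ l (j + 1) ≤ l j` -/
  nested : ∀ i j : Fin N, (j : ℕ) = i + 1 →
    first i ≤ first j ∧ first j ≤ first j + 2 * ((len j : ℤ) - 1) ∧
      first j + 2 * ((len j : ℤ) - 1) ≤ first i + 2 * ((len i : ℤ) - 1)

namespace Pyramid

/-- Order of the rows: longer rows come first; among rows of equal length even rows precede
odd ones. A row is a pair (length, parity). -/
def RowLE (a b : ℕ × ZMod 2) : Prop := b.1 < a.1 ∨ (a.1 = b.1 ∧ a.2.val ≤ b.2.val)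

instance : DecidableRel RowLE := fun a b => by unfold RowLE; infer_instance

instance : IsTrans (ℕ × ZMod 2) RowLE :=
  ⟨fun a b c h1 h2 => by unfold RowLE at *; omega⟩

instance : Std.Antisymm RowLE :=
  ⟨fun a b h1 h2 => Prod.ext (by unfold RowLE at *; omega)
    (ZMod.val_injective 2 (by unfold RowLE at *; omega))⟩

instance : Std.Total RowLE :=
  ⟨fun a b => by unfold RowLE; omega⟩

/-- The parts of `p` (even) and of `q` (odd), merged into one non-increasing list in which a
part of `p` precedes an equal part of `q`. -/
def rows {m n : ℕ} (p : Nat.Partition m) (q : Nat.Partition n) : List (ℕ × ZMod 2) :=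
  (p.parts.map (fun a => (a, (0 : ZMod 2))) + q.parts.map (fun a => (a, (1 : ZMod 2)))).sort RowLE

/-- The pyramids whose rows have the lengths and the parities prescribed by `(p, q)`. -/
def Pyr {m n : ℕ} (p : Nat.Partition m) (q : Nat.Partition n) :
    Set (Pyramid (rows p q).length) :=
  {P | (∀ j, P.len j = ((rows p q).get j).1) ∧ ∀ b, P.parity b = ((rows p q).get b.1).2}

/-- The boxes of a pyramid in `Pyr p q`: pairs of a row and a position in that row. -/
abbrev Box {m n : ℕ} (p : Nat.Partition m) (q : Nat.Partition n) :=
  Σ j : Fin (rows p q).length, Fin ((rows p q).get j).1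

/-- A labelling of the even boxes by the basis vectors of `V₀` and of the odd boxes by the basis
vectors of `V₁`; it is used simultaneously for all pyramids in `Pyr p q`. -/
structure Labelling {m n : ℕ} (p : Nat.Partition m) (q : Nat.Partition n) where
  /-- the label of each box -/
  toEquiv : Box p q ≃ Fin m ⊕ Fin n
  parity_eq : ∀ b, LieSuperalgebra.idxParity (toEquiv b) = ((rows p q).get b.1).2

/-- Labellings exist for every `(p, q)`. -/
theorem nonempty_labelling {m n : ℕ} (p : Nat.Partition m) (q : Nat.Partition n) :
    Nonempty (Labelling p q) := by
  have key : ∀ a : ZMod 2, Fintype.card {b : Box p q // ((rows p q).get b.1).2 = a} =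
      ((p.parts.map (fun a => (a, (0 : ZMod 2))) +
        q.parts.map (fun a => (a, (1 : ZMod 2)))).map
          (fun r => if r.2 = a then r.1 else 0)).sum := by
    intro a
    rw [← Multiset.sort_eq (p.parts.map (fun a => (a, (0 : ZMod 2))) +
        q.parts.map (fun a => (a, (1 : ZMod 2)))) RowLE, Multiset.map_coe, Multiset.sum_coe,
      Fintype.card_subtype, Finset.card_filter, Fintype.sum_sigma]
    change _ = ((rows p q).map _).sum
    rw [← Fin.sum_univ_fun_getElem]
    refine Finset.sum_congr rfl fun j _ => ?_
    by_cases h : ((rows p q)[(j : ℕ)]).2 = a <;> simp [h]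
  have h0 : Fintype.card {b : Box p q // ((rows p q).get b.1).2 = 0} = Fintype.card (Fin m) := by
    rw [key]; simp [p.parts_sum]
  have h1 : Fintype.card {b : Box p q // ¬ ((rows p q).get b.1).2 = 0} =
      Fintype.card (Fin n) := by
    have h : ∀ c : ZMod 2, ¬ c = 0 ↔ c = 1 := by decide
    rw [Fintype.card_congr (Equiv.subtypeEquivRight fun b => h _), key]
    simp [q.parts_sum]
  refine ⟨⟨(Equiv.sumCompl (fun b : Box p q => ((rows p q).get b.1).2 = 0)).symm.trans
    (Equiv.sumCongr (Fintype.equivOfCardEq h0) (Fintype.equivOfCardEq h1)), fun b => ?_⟩⟩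
  have h : ∀ c : ZMod 2, c ≠ 0 → c = 1 := by decide
  by_cases hb : ((rows p q).get b.1).2 = 0
  · rw [hb, Equiv.trans_apply,
      Equiv.sumCompl_symm_apply_of_pos (p := fun b : Box p q => ((rows p q).get b.1).2 = 0) hb]
    rfl
  · rw [h _ hb, Equiv.trans_apply,
      Equiv.sumCompl_symm_apply_of_neg (p := fun b : Box p q => ((rows p q).get b.1).2 = 0) hb]
    rfl

section Elements

variable (F : Type*) [Field F] {m n : ℕ} {p : Nat.Partition m} {q : Nat.Partition n}

/-- The nilpotent matrix `e_{p,q}`: it sends the basis vector of a box to that of the box to its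
right, or to zero if there is none. -/
def ePQ (σ : Labelling p q) : LieSuperalgebra.Mat F m n :=
  Matrix.of fun s t =>
    if (σ.toEquiv.symm s).1 = (σ.toEquiv.symm t).1 ∧
      ((σ.toEquiv.symm s).2 : ℕ) = (σ.toEquiv.symm t).2 + 1 then 1 else 0

/-- The diagonal matrix `h(P)`: its entry at a basis vector is the first coordinate of the box
labelled by that vector. -/
def hP (σ : Labelling p q) (P : Pyramid (rows p q).length) : LieSuperalgebra.Mat F m n :=
  Matrix.diagonal fun s =>
    ((P.first (σ.toEquiv.symm s).1 + 2 * ((σ.toEquiv.symm s).2 : ℕ) : ℤ) : F)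

theorem supertrace_ePQ (σ : Labelling p q) :
    ePQ F σ ∈ LieSuperalgebra.slSub F m n := by
  simp [LinearMap.mem_ker, LieSuperalgebra.supertrace_eq, ePQ]

/-- `e_{p,q}` as an element of `sl(m|n)`. -/
def ePQsl (σ : Labelling p q) : LieSuperalgebra.slSub F m n := ⟨ePQ F σ, supertrace_ePQ F σ⟩

end Elements

end Pyramid

open LieSuperalgebra Pyramid

/-! In characteristic zero a `ℤ`-grading is the eigenspace decomposition of an even derivation `D`
which is diagonalizable with integer eigenvalues. So the question is which such derivations exist,
and which of them make `e` a good element.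

For `gl(m|n)` goodness forces `D 1 = 0`: `D 1` is central, so the identity is homogeneous; it
commutes with `e`, so its degree is not negative, and having nonzero trace it is no commutator `[e,
x]`, so its degree is not positive. A Casimir-type average shows that `D` is inner on the even part
up to block scalars, matrix units then determine it on the odd part, and diagonalizability removes
the last scalar error. Hence the grading is given by `ad H` with `H` even
(`IsGoodGrading.exists_eq_adGrading`).

Since the trace form pairs degree `i` with degree `-i`, surjectivity is dual to injectivity: once
`[H, e] = 2 e`, the grading is good exactly when the centralizer of `e` has no component of negative
degree (`isGoodGrading_adGrading`). If `H` increases in steps of two along rows that start at `f j`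
and have length `r j`, the lowest degree of a map from row `a` to row `b` commuting with `e` is the
larger of `f b - f a` and `(f b + 2 r b) - (f a + 2 r a)`. That this is nonnegative for all ordered
pairs means, for non-increasing lengths, that the rows are nested. This is the pyramid condition up
to a translation, and a translation changes `H` only by a scalar (`eq_zero_of_commute_shiftMatrix`,
`le_or_le_of_centralizer`, `exists_pyramid`).

For a general good grading, `H` minus a scalar is diagonalizable with integer eigenvalues, and `e`
has a Jordan basis consisting of eigenvectors of `H` of pure parity. The corresponding base change
commutes with `e` and brings `H` to the row form (`exists_conj_rowDiag`).

For `m ≠ n`, `gl = sl ⊕ F · 1`, so a derivation of `sl` extends by zero. For `psl(n|n)` with `n ≥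
3`, a derivation lifts to a linear map of `gl(n|n)` which is a derivation modulo scalars, and the
same averaging makes it inner modulo scalars (`exists_inner_of_derivation_mod_scalars`). For `n ≤ 1`
one has `e = 0` and everything sits in degree `0`. The case `n = 2` is different because `psl(2|2)`
has even derivations that do not come from `gl(2|2)`. -/

/-! ### Families of eigenspaces with integer eigenvalues -/

section Eigenspaces

variable {F W : Type*} [Field F] [AddCommGroup W] [Module F W]

/-- If the eigenspaces with integer eigenvalues span, then every eigenvalue is an integer. -/
theorem exists_int_of_apply_eq_smul {f : Module.End F W}
    (ht : ⨆ j : ℤ, f.eigenspace (j : F) = ⊤) {c : F} {x : W} (hx : x ≠ 0) (hc : f x = c • x) :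
    ∃ j : ℤ, c = j := by
  by_contra! hne
  refine hx (Submodule.disjoint_def.1 (Module.End.eigenspaces_iSupIndep f c) x
    (Module.End.mem_eigenspace_iff.2 hc) ?_)
  have : ⨆ j : ℤ, f.eigenspace (j : F) ≤ ⨆ (μ) (_ : μ ≠ c), f.eigenspace μ :=
    iSup_le fun j => le_iSup₂_of_le (j : F) (hne j).symm le_rfl
  exact this (ht ▸ Submodule.mem_top)

/-- A subspace invariant under `f` is spanned by the eigenvectors it contains. -/
theorem le_iSup_inf_intEigenspace [FiniteDimensional F W] {f : Module.End F W}
    (ht : ⨆ j : ℤ, f.eigenspace (j : F) = ⊤) {S : Submodule F W} (hS : ∀ x ∈ S, f x ∈ S) :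
    S ≤ ⨆ j : ℤ, S ⊓ f.eigenspace (j : F) := by
  have h1 : ⨆ μ : F, f.eigenspace μ = ⊤ := by
    rw [eq_top_iff, ← ht]
    exact iSup_le fun j => le_iSup (fun μ : F => f.eigenspace μ) (j : F)
  have h2 := Submodule.inf_iSup_genEigenspace hS 1
  change S ⊓ ⨆ μ : F, f.eigenspace μ = ⨆ μ : F, S ⊓ f.eigenspace μ at h2
  rw [h1, inf_top_eq] at h2
  intro x hx
  rw [h2] at hx
  refine (iSup_le fun μ => ?_ : ⨆ μ : F, S ⊓ f.eigenspace μ ≤ _) hx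
  intro y hy
  by_cases hy0 : y = 0
  · rw [hy0]; exact Submodule.zero_mem _
  · obtain ⟨j, rfl⟩ := exists_int_of_apply_eq_smul ht hy0 (Module.End.mem_eigenspace_iff.1 hy.2)
    exact Submodule.mem_iSup_of_mem j hy

variable [CharZero F]

theorem iSupIndep_intEigenspace (f : Module.End F W) :
    iSupIndep fun j : ℤ => f.eigenspace (j : F) :=
  (Module.End.eigenspaces_iSupIndep f).comp Int.cast_injective

/-- Subtracting from an eigenvector its `ℬ j`-component leaves a vector lying both in the
`j`-eigenspace and in the sum of the others, hence zero. A spanning family is thus identified by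
inclusions in one direction only. -/
theorem eq_intEigenspace_of_le {f : Module.End F W} {ℬ : ℤ → Submodule F W}
    (h : ∀ j, ℬ j ≤ f.eigenspace (j : F)) (ht : ⨆ j, ℬ j = ⊤) (j : ℤ) :
    ℬ j = f.eigenspace (j : F) := by
  refine le_antisymm (h j) fun x hx => ?_
  have hsup : ℬ j ⊔ ⨆ (i) (_ : i ≠ j), ℬ i = ⊤ := by
    rw [eq_top_iff, ← ht]
    refine iSup_le fun i => ?_
    by_cases hi : i = j
    · subst hi; exact le_sup_left
    · exact le_sup_of_le_right (le_iSup₂_of_le i hi le_rfl)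
  obtain ⟨y, hy, z, hz, hyz⟩ := Submodule.mem_sup.1 (hsup ▸ Submodule.mem_top : x ∈ _)
  have hz' : z ∈ f.eigenspace (j : F) := by
    rw [show z = x - y by rw [← hyz]; abel]
    exact Submodule.sub_mem _ hx (h j hy)
  have hz0 : z = 0 := by
    refine Submodule.disjoint_def.1 (iSupIndep_intEigenspace f j) z hz' ?_
    exact (iSup₂_mono fun i _ => h i) hz
  rw [← hyz, hz0, add_zero]
  exact hy

theorem isInternal_intEigenspace {f : Module.End F W}
    (ht : ⨆ j : ℤ, f.eigenspace (j : F) = ⊤) :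
    DirectSum.IsInternal fun j : ℤ => f.eigenspace (j : F) :=
  DirectSum.isInternal_submodule_of_iSupIndep_of_iSup_eq_top (iSupIndep_intEigenspace f) ht

/-- A grading of a vector space is the family of eigenspaces of an operator. -/
theorem exists_gradingOperator {ℬ : ℤ → Submodule F W} (h : DirectSum.IsInternal ℬ) :
    ∃ D : Module.End F W, ∀ j, ℬ j = D.eigenspace (j : F) := by
  let T : (DirectSum ℤ fun j => ℬ j) →ₗ[F] W :=
    DirectSum.toModule F ℤ W fun j => (j : F) • (ℬ j).subtype
  let φ := LinearEquiv.ofBijective (DirectSum.coeLinearMap ℬ) h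
  refine ⟨T ∘ₗ φ.symm.toLinearMap, eq_intEigenspace_of_le (fun j x hx => ?_)
    h.submodule_iSup_eq_top⟩
  rw [Module.End.mem_eigenspace_iff]
  have hφ : φ.symm x = DirectSum.lof F ℤ (fun j => ℬ j) j ⟨x, hx⟩ := by
    rw [LinearEquiv.symm_apply_eq]
    exact (DirectSum.coeLinearMap_lof ℬ j ⟨x, hx⟩).symm
  simp [T, hφ]

end Eigenspaces

/-! ### Gradings and diagonalizable even derivations -/

namespace LieSuperalgebra

section Gradings

variable {F L : Type*} [Field F] [AddCommGroup L] [Module F L]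

theorem eq_of_add_eq_add {G : LieSuperalgebra F L} {x x' y y' : L}
    (hx : x ∈ G.parity 0) (hx' : x' ∈ G.parity 0) (hy : y ∈ G.parity 1) (hy' : y' ∈ G.parity 1)
    (h : x + y = x' + y') : x = x' ∧ y = y' := by
  have h1 : x - x' = y' - y := by
    rw [sub_eq_sub_iff_add_eq_add, h, add_comm]
  have h2 : x - x' = 0 := Submodule.disjoint_def.1 G.isCompl.disjoint _
    (Submodule.sub_mem _ hx hx') (h1 ▸ Submodule.sub_mem _ hy' hy)
  rw [h2] at h1
  exact ⟨sub_eq_zero.1 h2, (sub_eq_zero.1 h1.symm).symm⟩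

theorem zmod_two_cases (a : ZMod 2) : a = 0 ∨ a = 1 := by
  revert a; decide

/-- The operator whose eigenspaces are the components of a grading is an even derivation. -/
theorem IsGrading.exists_derivation [CharZero F] {G : LieSuperalgebra F L}
    {𝒜 : ℤ → Submodule F L} (h : G.IsGrading 𝒜) :
    ∃ D : Module.End F L, (∀ j, 𝒜 j = D.eigenspace (j : F)) ∧
      ⨆ j : ℤ, D.eigenspace (j : F) = ⊤ ∧
      (∀ x y, D (G.bracket x y) = G.bracket (D x) y + G.bracket x (D y)) ∧
      ∀ a, ∀ x ∈ G.parity a, D x ∈ G.parity a := by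
  obtain ⟨D, hD⟩ := exists_gradingOperator h.isInternal
  have htop := h.isInternal.submodule_iSup_eq_top
  have hD' : ∀ {j x}, x ∈ 𝒜 j → D x = (j : F) • x := fun {j x} hx =>
    Module.End.mem_eigenspace_iff.1 (hD j ▸ hx)
  refine ⟨D, hD, by simpa only [← hD] using htop, fun x y => ?_, fun a x hx => ?_⟩
  · have hx : x ∈ ⨆ j, 𝒜 j := htop ▸ Submodule.mem_top
    have hy : y ∈ ⨆ j, 𝒜 j := htop ▸ Submodule.mem_top
    refine Submodule.iSup_induction 𝒜 (motive := fun x =>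
      D (G.bracket x y) = G.bracket (D x) y + G.bracket x (D y)) hx (fun i x hx => ?_) (by simp)
      (fun x x' h1 h2 => by simp only [map_add, LinearMap.add_apply, h1, h2]; abel)
    refine Submodule.iSup_induction 𝒜 (motive := fun y =>
      D (G.bracket x y) = G.bracket (D x) y + G.bracket x (D y)) hy (fun j y hy => ?_) (by simp)
      (fun x x' h1 h2 => by simp only [map_add, h1, h2]; abel)
    rw [hD' (h.bracket_mem hx hy), hD' hx, hD' hy]
    simp [add_smul]
  -- Each graded piece is homogeneous, so every `x` is a sum of an even and an odd vector whose
  -- images under `D` keep their parity. Uniqueness of the splitting then applies this to `x` of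
  -- pure parity.
  · have key : ∃ y ∈ G.parity 0, ∃ z ∈ G.parity 1, y + z = x ∧ D y ∈ G.parity 0 ∧
        D z ∈ G.parity 1 := by
      have hx' : x ∈ ⨆ j, 𝒜 j := htop ▸ Submodule.mem_top
      refine Submodule.iSup_induction 𝒜 (motive := fun x => ∃ y ∈ G.parity 0, ∃ z ∈ G.parity 1,
        y + z = x ∧ D y ∈ G.parity 0 ∧ D z ∈ G.parity 1) hx' (fun i x hx => ?_)
        ⟨0, Submodule.zero_mem _, 0, Submodule.zero_mem _, by simp⟩ ?_
      · obtain ⟨y, hy, z, hz, hyz⟩ := Submodule.mem_sup.1 (h.homogeneous i hx)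
        refine ⟨y, hy.2, z, hz.2, hyz, ?_, ?_⟩
        · rw [hD' hy.1]; exact Submodule.smul_mem _ _ hy.2
        · rw [hD' hz.1]; exact Submodule.smul_mem _ _ hz.2
      · rintro _ _ ⟨y, hy, z, hz, rfl, h1, h2⟩ ⟨y', hy', z', hz', rfl, h3, h4⟩
        refine ⟨y + y', Submodule.add_mem _ hy hy', z + z', Submodule.add_mem _ hz hz', by abel,
          ?_, ?_⟩
        · rw [map_add]; exact Submodule.add_mem _ h1 h3
        · rw [map_add]; exact Submodule.add_mem _ h2 h4
    obtain ⟨y, hy, z, hz, hyz, h1, h2⟩ := key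
    rcases zmod_two_cases a with rfl | rfl
    · rw [← (eq_of_add_eq_add hy hx hz (Submodule.zero_mem _) (by simpa using hyz)).1]; exact h1
    · rw [← (eq_of_add_eq_add hy (Submodule.zero_mem _) hz hx (by simpa using hyz)).2]; exact h2

/-- An even derivation whose eigenspaces with integer eigenvalues span defines a grading. -/
theorem isGrading_of_derivation [CharZero F] {G : LieSuperalgebra F L} {D : Module.End F L}
    (htop : ⨆ j : ℤ, D.eigenspace (j : F) = ⊤)
    (hder : ∀ x y, D (G.bracket x y) = G.bracket (D x) y + G.bracket x (D y))
    (hpar : ∀ a, ∀ x ∈ G.parity a, D x ∈ G.parity a) :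
    G.IsGrading fun j : ℤ => D.eigenspace (j : F) where
  isInternal := isInternal_intEigenspace htop
  homogeneous := by
    intro j x hx
    obtain ⟨y, hy, z, hz, rfl⟩ := Submodule.mem_sup.1
      (G.isCompl.sup_eq_top ▸ Submodule.mem_top : x ∈ G.parity 0 ⊔ G.parity 1)
    rw [Module.End.mem_eigenspace_iff, map_add, smul_add] at hx
    obtain ⟨h1, h2⟩ := eq_of_add_eq_add (hpar 0 y hy) (Submodule.smul_mem _ _ hy)
      (hpar 1 z hz) (Submodule.smul_mem _ _ hz) hx
    exact Submodule.mem_sup.2 ⟨y, ⟨Module.End.mem_eigenspace_iff.2 h1, hy⟩, z,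
      ⟨Module.End.mem_eigenspace_iff.2 h2, hz⟩, rfl⟩
  bracket_mem := by
    intro i j x y hx hy
    rw [Module.End.mem_eigenspace_iff] at *
    rw [hder, hx, hy]
    simp [add_smul]

/-- A good grading for `0` is concentrated in degree `0`. -/
theorem IsGoodGrading.eq_bot_of_zero {G : LieSuperalgebra F L} {𝒜 : ℤ → Submodule F L}
    (h : G.IsGoodGrading 0 𝒜) {j : ℤ} (hj : j ≠ 0) : 𝒜 j = ⊥ := by
  rw [eq_bot_iff]
  intro x hx
  rcases lt_or_gt_of_ne hj with hj | hj
  · exact h.injOn j (by omega) hx (Submodule.zero_mem _) (by simp)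
  -- Surjectivity is available from degree `-1` on, so it reaches every target degree `j ≥ 1`.
  · obtain ⟨y, -, hy⟩ := h.surjOn (j - 2) (by omega) (by simpa using hx)
    simpa using hy.symm

end Gradings

end LieSuperalgebra

/-! ### Derivations of a matrix algebra modulo scalars -/

section Casimir

open Matrix

variable {F ι : Type*} [Field F] [Fintype ι] [DecidableEq ι]

/-- The tensor `∑ E_ij ⊗ E_ji` is invariant under the adjoint action; here it is seen through an
arbitrary bilinear map. -/
theorem sum_commutator_single_invariant (B : Matrix ι ι F →ₗ[F] Matrix ι ι F →ₗ[F] Matrix ι ι F)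
    (y : Matrix ι ι F) :
    ∑ i, ∑ j, (B (y * single i j 1 - single i j 1 * y) (single j i 1) +
      B (single i j 1) (y * single j i 1 - single j i 1 * y)) = 0 := by
  have hl : ∀ i j, y * single i j 1 = ∑ k, y k i • single k j (1 : F) := by
    intro i j
    ext a b
    by_cases h : b = j
    · subst h; simp [Matrix.sum_apply, single_apply]
    · simp [Matrix.sum_apply, h, Ne.symm h]
  have hr : ∀ i j, single i j 1 * y = ∑ k, y j k • single i k (1 : F) := by
    intro i j
    ext a b
    by_cases h : a = i
    · subst h; simp [Matrix.sum_apply, single_apply]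
    · simp [Matrix.sum_apply, h, Ne.symm h]
  have e1 : ∑ i, ∑ j, B (y * single i j 1) (single j i 1) =
      ∑ i, ∑ j, B (single i j 1) (single j i 1 * y) := by
    simp only [hl, hr, map_sum, map_smul, LinearMap.sum_apply, LinearMap.smul_apply]
    calc _ = ∑ j, ∑ i, ∑ k, y k i • B (single k j 1) (single j i 1) := Finset.sum_comm
      _ = ∑ j, ∑ k, ∑ i, y k i • B (single k j 1) (single j i 1) :=
        Finset.sum_congr rfl fun j _ => Finset.sum_comm
      _ = _ := Finset.sum_comm
  have e2 : ∑ i, ∑ j, B (single i j 1 * y) (single j i 1) =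
      ∑ i, ∑ j, B (single i j 1) (y * single j i 1) := by
    simp only [hl, hr, map_sum, map_smul, LinearMap.sum_apply, LinearMap.smul_apply]
    exact Finset.sum_congr rfl fun i _ => Finset.sum_comm
  simp only [map_sub, LinearMap.sub_apply, Finset.sum_add_distrib, Finset.sum_sub_distrib, e1, e2]
  abel

/-- The Casimir operator of the adjoint representation kills scalars and is multiplication by twice
the size on traceless matrices. This invertibility is what recovers a derivation modulo scalars. -/
theorem sum_single_mul_single_mul (w : Matrix ι ι F) :
    ∑ i, ∑ j, (single i j 1 * (single j i 1 * w - w * single j i 1) -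
      (single j i 1 * w - w * single j i 1) * single i j 1) =
      (2 * Fintype.card ι : F) • w - (2 * w.trace) • 1 := by
  have h1 : ∑ i : ι, ∑ j : ι, single i j 1 * (single j i 1 * w) = (Fintype.card ι : F) • w := by
    simp_rw [← Matrix.mul_assoc, single_mul_single_same, ← Finset.sum_mul]
    rw [Finset.sum_comm]
    simp only [sum_single_one, Finset.sum_const, Finset.card_univ, smul_mul_assoc, one_mul,
      Nat.cast_smul_eq_nsmul]
  have h2 : ∑ i : ι, ∑ j : ι, w * single j i 1 * single i j 1 = (Fintype.card ι : F) • w := by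
    simp_rw [Matrix.mul_assoc, single_mul_single_same, ← Finset.mul_sum]
    simp only [mul_one, sum_single_one, Finset.sum_const, Finset.card_univ, mul_smul_comm,
      Nat.cast_smul_eq_nsmul]
  have h3 : ∑ i : ι, ∑ j : ι, single i j 1 * (w * single j i 1) = w.trace • 1 := by
    simp_rw [← Matrix.mul_assoc, single_mul_mul_single]
    ext a b
    by_cases hab : a = b
    · subst hab
      simp [Matrix.sum_apply, single_apply, Matrix.trace]
    · simp [Matrix.sum_apply, single_apply, hab]
      exact Finset.sum_eq_zero fun x _ => if_neg (by rintro ⟨rfl, rfl⟩; exact hab rfl)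
  have h4 : ∑ i : ι, ∑ j : ι, single j i 1 * w * single i j 1 = w.trace • 1 := by
    rw [Finset.sum_comm, ← h3]
    simp_rw [Matrix.mul_assoc]
  simp only [mul_sub, sub_mul, Finset.sum_sub_distrib, h1, h2, h3, h4]
  module

/-- A matrix whose commutators are scalar is scalar. -/
theorem exists_smul_one_of_commutator [CharZero F] {M : Matrix ι ι F}
    (h : ∀ y, ∃ c : F, M * y - y * M = c • 1) : ∃ a : F, M = a • 1 := by
  have hcomm : ∀ y, M * y = y * M := by
    intro y
    obtain ⟨c, hc⟩ := h y
    rcases isEmpty_or_nonempty ι with hι | hι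
    · exact Subsingleton.elim _ _
    -- A commutator has trace zero, so in characteristic zero a scalar commutator vanishes and `M`
    -- is central.
    have ht := congrArg Matrix.trace hc
    rw [trace_sub, trace_mul_comm, sub_self, trace_smul, trace_one, smul_eq_mul, eq_comm,
      mul_eq_zero, or_iff_left (by simp)] at ht
    rwa [ht, zero_smul, sub_eq_zero] at hc
  obtain ⟨a, ha⟩ := mem_range_scalar_of_commute_single (M := M)
    (fun i j _ => (hcomm (single i j 1)).symm)
  exact ⟨a, by rw [← ha, smul_one_eq_diagonal]; rfl⟩

/-- A derivation modulo scalars of a full matrix algebra is inner modulo scalars. -/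
theorem exists_inner_of_derivation_mod_scalar [CharZero F]
    (d : Matrix ι ι F →ₗ[F] Matrix ι ι F)
    (hd : ∀ x y, ∃ c : F, d (x * y - y * x) = (d x * y - y * d x) + (x * d y - d y * x) + c • 1) :
    ∃ A : Matrix ι ι F, ∀ x, ∃ a : F, d x = A * x - x * A + a • 1 := by
  rcases isEmpty_or_nonempty ι with hι | hι
  · exact ⟨0, fun x => ⟨0, Subsingleton.elim _ _⟩⟩
  -- Let `A` be the sum of the `[E_ij, d E_ji]`. In `[y, A]` the derivation rule and the invariance
  -- of `∑ E_ij ⊗ E_ji` cancel everything except `∑ [E_ij, [E_ji, d y]]`, the Casimir operator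
  -- applied to `d y`; scalar errors disappear inside the outer bracket.
  let B : Matrix ι ι F →ₗ[F] Matrix ι ι F →ₗ[F] Matrix ι ι F :=
    (LinearMap.mul F (Matrix ι ι F) - (LinearMap.mul F (Matrix ι ι F)).flip).compl₂ d
  have hB : ∀ u v, B u v = u * d v - d v * u := fun u v => rfl
  have hcard : (2 * Fintype.card ι : F) ≠ 0 := by simp
  set A : Matrix ι ι F := ∑ i, ∑ j, B (single i j 1) (single j i 1) with hA
  have key : ∀ y, y * A - A * y = (2 * Fintype.card ι : F) • d y - (2 * (d y).trace) • 1 := by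
    intro y
    rw [← sum_single_mul_single_mul, ← sub_zero (y * A - A * y),
      ← sum_commutator_single_invariant B y, hA, Finset.mul_sum, Finset.sum_mul,
      ← Finset.sum_sub_distrib, ← Finset.sum_sub_distrib]
    refine Finset.sum_congr rfl fun i _ => ?_
    rw [Finset.mul_sum, Finset.sum_mul, ← Finset.sum_sub_distrib, ← Finset.sum_sub_distrib]
    refine Finset.sum_congr rfl fun j _ => ?_
    obtain ⟨c, hc⟩ := hd y (single j i 1)
    simp only [hB, hc, mul_add, add_mul, mul_smul_comm, smul_mul_assoc, mul_one, one_mul]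
    noncomm_ring
  refine ⟨-(2 * Fintype.card ι : F)⁻¹ • A, fun x =>
    ⟨(2 * Fintype.card ι : F)⁻¹ * (2 * (d x).trace), ?_⟩⟩
  have := congrArg (fun z => (2 * Fintype.card ι : F)⁻¹ • z) (key x)
  simp only [smul_sub, smul_smul, inv_mul_cancel₀ hcard, one_smul] at this
  rw [eq_comm, sub_eq_iff_eq_add] at this
  simp only [neg_smul, neg_mul, mul_neg, smul_mul_assoc, mul_smul_comm]
  refine this.trans ?_
  abel

/-- The factor `R` commutes with the matrix factor, so its image under `d` has scalar commutators
with every matrix and is therefore scalar. Only the restriction to the matrix factor remains. -/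
theorem exists_inner_of_derivation_prod [CharZero F] {R : Type*} [Ring R] [Algebra F R]
    (d : Matrix ι ι F × R →ₗ[F] Matrix ι ι F)
    (hd : ∀ x y, ∃ c : F, d (x * y - y * x) =
      (d x * y.1 - y.1 * d x) + (x.1 * d y - d y * x.1) + c • 1) :
    ∃ A : Matrix ι ι F, ∀ x, ∃ a : F, d x = A * x.1 - x.1 * A + a • 1 := by
  obtain ⟨A, hA⟩ := exists_inner_of_derivation_mod_scalar (d ∘ₗ LinearMap.inl F _ R)
    (fun x y => by simpa using hd (x, 0) (y, 0))
  have hR : ∀ r : R, ∃ a : F, d (0, r) = a • 1 := by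
    intro r
    refine exists_smul_one_of_commutator fun y => ?_
    obtain ⟨c, hc⟩ := hd (0, r) (y, 0)
    simp only [Prod.mk_mul_mk, zero_mul, mul_zero, sub_self, Prod.mk_zero_zero, map_zero,
      add_zero] at hc
    exact ⟨-c, by rw [neg_smul, eq_neg_iff_add_eq_zero, ← hc]⟩
  refine ⟨A, fun x => ?_⟩
  obtain ⟨a, ha⟩ := hA x.1
  obtain ⟨b, hb⟩ := hR x.2
  refine ⟨a + b, ?_⟩
  rw [show x = (x.1, 0) + (0, x.2) by simp, map_add, hb]
  simp only [LinearMap.comp_apply, LinearMap.inl_apply] at ha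
  rw [ha, Prod.fst_add, add_zero, add_smul, add_assoc]

end Casimir

/-! ### Brackets in `gl(m|n)` -/

namespace LieSuperalgebra

section Brackets

variable {F : Type*} [Field F] {m n : ℕ}

theorem gl_bracket_even_left {X : Mat F m n} (hX : X ∈ matParity F m n 0) (Y : Mat F m n) :
    (gl F m n).bracket X Y = X * Y - Y * X := by
  change matBracket F m n X Y = _
  rw [← matComp_add Y, map_add, matBracket_of_mem hX (matComp_mem _ _),
    matBracket_of_mem hX (matComp_mem _ _)]
  simp [superSign]
  noncomm_ring

theorem gl_bracket_even_right {Y : Mat F m n} (hY : Y ∈ matParity F m n 0) (X : Mat F m n) :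
    (gl F m n).bracket X Y = X * Y - Y * X := by
  change matBracket F m n X Y = _
  rw [← matComp_add X, map_add, LinearMap.add_apply, matBracket_of_mem (matComp_mem _ _) hY,
    matBracket_of_mem (matComp_mem _ _) hY]
  simp [superSign]
  noncomm_ring

theorem gl_bracket_odd {X Y : Mat F m n} (hX : X ∈ matParity F m n 1)
    (hY : Y ∈ matParity F m n 1) : (gl F m n).bracket X Y = X * Y + Y * X := by
  change matBracket F m n X Y = _
  rw [matBracket_of_mem hX hY]
  simp [superSign, ZMod.val_one'']

theorem single_mem_matParity (i j : Fin m ⊕ Fin n) (c : F) :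
    Matrix.single i j c ∈ matParity F m n (idxParity i + idxParity j) := by
  intro k l h
  refine Matrix.single_apply_of_ne _ _ _ _ _ ?_
  rintro ⟨rfl, rfl⟩
  exact h rfl

theorem diagonal_mem_matParity (d : Fin m ⊕ Fin n → F) :
    Matrix.diagonal d ∈ matParity F m n 0 := by
  intro i j h
  refine Matrix.diagonal_apply_ne _ fun hij => h ?_
  subst hij
  exact CharTwo.add_self_eq_zero _

theorem one_mem_matParity : (1 : Mat F m n) ∈ matParity F m n 0 := by
  rw [← Matrix.diagonal_one]
  exact diagonal_mem_matParity _

theorem mem_matParity_zero_iff {X : Mat F m n} :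
    X ∈ matParity F m n 0 ↔ ∃ A B, X = Matrix.fromBlocks A 0 0 B := by
  constructor
  · intro h
    refine ⟨X.toBlocks₁₁, X.toBlocks₂₂, ?_⟩
    conv_lhs => rw [← Matrix.fromBlocks_toBlocks X]
    congr
    · ext i j; exact h (Sum.inl i) (Sum.inr j) (by simp [idxParity])
    · ext i j; exact h (Sum.inr i) (Sum.inl j) (by simp [idxParity])
  · rintro ⟨A, B, rfl⟩ i j h
    rcases i with i | i <;> rcases j with j | j <;> simp_all [idxParity, CharTwo.add_self_eq_zero]

/-- The diagonal matrix with entries `a` on `V₀` and `b` on `V₁`. -/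
def blockScalar (F : Type*) [Field F] (m n : ℕ) (a b : F) : Mat F m n :=
  Matrix.diagonal (Sum.elim (fun _ => a) (fun _ => b))

theorem blockScalar_eq (a b : F) :
    blockScalar F m n a b = Matrix.fromBlocks (a • 1) 0 0 (b • 1) := by
  rw [blockScalar, Matrix.smul_one_eq_diagonal, Matrix.smul_one_eq_diagonal,
    Matrix.fromBlocks_diagonal]

theorem blockScalar_mem (a b : F) : blockScalar F m n a b ∈ matParity F m n 0 :=
  diagonal_mem_matParity _

theorem blockScalar_comm {X : Mat F m n} (hX : X ∈ matParity F m n 0) (a b : F) :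
    blockScalar F m n a b * X = X * blockScalar F m n a b := by
  obtain ⟨A, B, rfl⟩ := mem_matParity_zero_iff.1 hX
  simp [blockScalar_eq, Matrix.fromBlocks_multiply]

theorem fromBlocks_sub {l o p q : Type*} (A A' : Matrix l p F) (B B' : Matrix l q F)
    (C C' : Matrix o p F) (D D' : Matrix o q F) :
    Matrix.fromBlocks A B C D - Matrix.fromBlocks A' B' C' D' =
      Matrix.fromBlocks (A - A') (B - B') (C - C') (D - D') := by
  simp [sub_eq_add_neg, Matrix.fromBlocks_neg, Matrix.fromBlocks_add]

/-- A linear map of `gl(m|n)` which is a derivation of the even part modulo scalar matrices is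
inner there up to matrices which are scalar on `V₀` and on `V₁`. -/
theorem exists_inner_even [CharZero F] (d : Mat F m n →ₗ[F] Mat F m n)
    (hpar : ∀ x ∈ matParity F m n 0, d x ∈ matParity F m n 0)
    (hd : ∀ x ∈ matParity F m n 0, ∀ y ∈ matParity F m n 0, ∃ c : F,
      d (x * y - y * x) = (d x * y - y * d x) + (x * d y - d y * x) + c • 1) :
    ∃ H ∈ matParity F m n 0, ∀ x ∈ matParity F m n 0, ∃ a b : F,
      d x = H * x - x * H + blockScalar F m n a b := by
  let j₁ : Matrix (Fin m) (Fin m) F × Matrix (Fin n) (Fin n) F →ₗ[F] Mat F m n :=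
    { toFun := fun x => Matrix.fromBlocks x.1 0 0 x.2
      map_add' := fun x y => by simp [Matrix.fromBlocks_add]
      map_smul' := fun c x => by simp [Matrix.fromBlocks_smul] }
  let j₂ : Matrix (Fin n) (Fin n) F × Matrix (Fin m) (Fin m) F →ₗ[F] Mat F m n :=
    { toFun := fun x => Matrix.fromBlocks x.2 0 0 x.1
      map_add' := fun x y => by simp [Matrix.fromBlocks_add]
      map_smul' := fun c x => by simp [Matrix.fromBlocks_smul] }
  let t₁ : Mat F m n →ₗ[F] Matrix (Fin m) (Fin m) F :=
    { toFun := fun x => x.toBlocks₁₁, map_add' := fun x y => rfl, map_smul' := fun c x => rfl }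
  let t₂ : Mat F m n →ₗ[F] Matrix (Fin n) (Fin n) F :=
    { toFun := fun x => x.toBlocks₂₂, map_add' := fun x y => rfl, map_smul' := fun c x => rfl }
  have ht₁ : ∀ A B C D, t₁ (Matrix.fromBlocks A B C D) = A := fun _ _ _ _ => rfl
  have ht₂ : ∀ A B C D, t₂ (Matrix.fromBlocks A B C D) = D := fun _ _ _ _ => rfl
  have hj₁ : ∀ x, j₁ x = Matrix.fromBlocks x.1 0 0 x.2 := fun _ => rfl
  have hj₂ : ∀ x, j₂ x = Matrix.fromBlocks x.2 0 0 x.1 := fun _ => rfl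
  have hj : ∀ A B, Matrix.fromBlocks A 0 0 B ∈ matParity F m n 0 := fun A B =>
    mem_matParity_zero_iff.2 ⟨A, B, rfl⟩
  -- The even part is a product of two matrix algebras. Each diagonal block of `d` is handled
  -- separately, and the two scalar errors are unrelated, which is why block scalars appear.
  obtain ⟨A, hA⟩ := exists_inner_of_derivation_prod (t₁ ∘ₗ d ∘ₗ j₁) (by
    rintro ⟨x, x'⟩ ⟨y, y'⟩
    obtain ⟨c, hc⟩ := hd _ (hj x x') _ (hj y y')
    refine ⟨c, ?_⟩
    obtain ⟨u, u', hu⟩ := mem_matParity_zero_iff.1 (hpar _ (hj x x'))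
    obtain ⟨v, v', hv⟩ := mem_matParity_zero_iff.1 (hpar _ (hj y y'))
    rw [hu, hv] at hc
    simp only [Matrix.fromBlocks_multiply, fromBlocks_sub, Matrix.mul_zero, Matrix.zero_mul, add_zero,
      zero_add, sub_self, smul_zero, Matrix.fromBlocks_add, ← Matrix.fromBlocks_one,
      Matrix.fromBlocks_smul] at hc
    simp [ht₁, hj₁, hu, hv, hc])
  obtain ⟨B, hB⟩ := exists_inner_of_derivation_prod (t₂ ∘ₗ d ∘ₗ j₂) (by
    rintro ⟨x', x⟩ ⟨y', y⟩
    obtain ⟨c, hc⟩ := hd _ (hj x x') _ (hj y y')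
    refine ⟨c, ?_⟩
    obtain ⟨u, u', hu⟩ := mem_matParity_zero_iff.1 (hpar _ (hj x x'))
    obtain ⟨v, v', hv⟩ := mem_matParity_zero_iff.1 (hpar _ (hj y y'))
    rw [hu, hv] at hc
    simp only [Matrix.fromBlocks_multiply, fromBlocks_sub, Matrix.mul_zero, Matrix.zero_mul, add_zero,
      zero_add, sub_self, smul_zero, Matrix.fromBlocks_add, ← Matrix.fromBlocks_one,
      Matrix.fromBlocks_smul] at hc
    simp [ht₂, hj₂, hu, hv, hc])
  refine ⟨Matrix.fromBlocks A 0 0 B, hj A B, fun x hx => ?_⟩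
  obtain ⟨y, z, rfl⟩ := mem_matParity_zero_iff.1 hx
  obtain ⟨a, ha⟩ := hA (y, z)
  obtain ⟨b, hb⟩ := hB (z, y)
  refine ⟨a, b, ?_⟩
  obtain ⟨u, v, huv⟩ := mem_matParity_zero_iff.1 (hpar _ hx)
  simp only [LinearMap.comp_apply, ht₁, ht₂, hj₁, hj₂, huv] at ha hb
  rw [huv, ha, hb, blockScalar_eq]
  simp [Matrix.fromBlocks_multiply, fromBlocks_sub, Matrix.fromBlocks_add]

end Brackets

end LieSuperalgebra

/-! ### Derivations of `gl(m|n)` -/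

namespace LieSuperalgebra

/-- An even `H` makes every sign in the Jacobi identity trivial, so `ad H` is an ordinary derivation
on all elements, homogeneous or not. -/
theorem bracket_bracket_of_even {F L : Type*} [Field F] [AddCommGroup L] [Module F L]
    (G : LieSuperalgebra F L) {H : L} (hH : H ∈ G.parity 0) (x y : L) :
    G.bracket H (G.bracket x y) =
      G.bracket (G.bracket H x) y + G.bracket x (G.bracket H y) := by
  have key : ∀ a b, ∀ x ∈ G.parity a, ∀ y ∈ G.parity b, G.bracket H (G.bracket x y) =
      G.bracket (G.bracket H x) y + G.bracket x (G.bracket H y) := by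
    intro a b x hx y hy
    rw [G.jacobi hH hx hy]
    simp [superSign]
  have htop : ∀ x, x ∈ G.parity 0 ⊔ G.parity 1 := fun x =>
    G.isCompl.sup_eq_top ▸ Submodule.mem_top
  obtain ⟨x, hx, x', hx', rfl⟩ := Submodule.mem_sup.1 (htop x)
  obtain ⟨y, hy, y', hy', rfl⟩ := Submodule.mem_sup.1 (htop y)
  simp only [map_add, LinearMap.add_apply, key _ _ x hx y hy, key _ _ x hx y' hy',
    key _ _ x' hx' y hy, key _ _ x' hx' y' hy']
  abel

theorem bracket_mem_of_even {F L : Type*} [Field F] [AddCommGroup L] [Module F L]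
    (G : LieSuperalgebra F L) {H : L} (hH : H ∈ G.parity 0) (a : ZMod 2) (x : L)
    (hx : x ∈ G.parity a) : G.bracket H x ∈ G.parity a := by
  simpa using G.bracket_mem hH hx

theorem bracket_mem_of_even_right {F L : Type*} [Field F] [AddCommGroup L] [Module F L]
    (G : LieSuperalgebra F L) {H : L} (hH : H ∈ G.parity 0) (a : ZMod 2) (x : L)
    (hx : x ∈ G.parity a) : G.bracket x H ∈ G.parity a := by
  simpa using G.bracket_mem hx hH

section Derivations

open Matrix

variable {F : Type*} [Field F] {m n : ℕ}

theorem single_one_mul_apply {ι : Type*} [Fintype ι] [DecidableEq ι] (p k : ι) (M : Matrix ι ι F)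
    (i j : ι) : ((single p k (1 : F) : Matrix ι ι F) * M) i j = if i = p then M k j else 0 := by
  by_cases h : i = p
  · subst h; simp
  · simp [h]

theorem mul_single_one_apply {ι : Type*} [Fintype ι] [DecidableEq ι] (p k : ι) (M : Matrix ι ι F)
    (i j : ι) : (M * (single p k (1 : F) : Matrix ι ι F)) i j = if j = k then M i p else 0 := by
  by_cases h : j = k
  · subst h; simp
  · simp [h]

theorem single_mem_even {i j : Fin m ⊕ Fin n} (h : idxParity i = idxParity j) (c : F) :
    single i j c ∈ matParity F m n 0 := by
  have := single_mem_matParity (m := m) (n := n) i j c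
  rwa [h, CharTwo.add_self_eq_zero] at this

theorem idxParity_add_of_ne {i j : Fin m ⊕ Fin n} (h : idxParity i ≠ idxParity j) :
    idxParity i + idxParity j = 1 := by
  revert h
  generalize idxParity i = a
  generalize idxParity j = b
  revert a b
  decide

theorem single_mem_odd {i j : Fin m ⊕ Fin n} (h : idxParity i ≠ idxParity j) (c : F) :
    single i j c ∈ matParity F m n 1 :=
  idxParity_add_of_ne h ▸ single_mem_matParity (m := m) (n := n) i j c

theorem smul_one_mem_matParity (c : F) : c • (1 : Mat F m n) ∈ matParity F m n 0 :=
  Submodule.smul_mem _ _ one_mem_matParity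

theorem gl_bracket_smul_one_left (c : F) (x : Mat F m n) :
    (gl F m n).bracket (c • 1) x = 0 := by
  rw [gl_bracket_even_left (smul_one_mem_matParity c)]; simp

theorem gl_bracket_smul_one_right (c : F) (x : Mat F m n) :
    (gl F m n).bracket x (c • 1) = 0 := by
  rw [gl_bracket_even_right (smul_one_mem_matParity c)]; simp

theorem matrix_mem_of_single {S : Submodule F (Mat F m n)} {a : ZMod 2}
    (f : Mat F m n →ₗ[F] Mat F m n)
    (h : ∀ i j, idxParity i + idxParity j = a → f (single i j 1) ∈ S) {x : Mat F m n}
    (hx : x ∈ matParity F m n a) : f x ∈ S := by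
  rw [matrix_eq_sum_single x]
  simp only [map_sum]
  refine Submodule.sum_mem _ fun i _ => Submodule.sum_mem _ fun j _ => ?_
  by_cases hij : idxParity i + idxParity j = a
  · rw [show single i j (x i j) = x i j • single i j (1 : F) by simp, map_smul]
    exact Submodule.smul_mem _ _ (h i j hij)
  · rw [hx i j hij]; simp

/-- A linear map which is scalar on the even part and acts on the odd matrix units by weights is,
modulo scalars, a bracket with a matrix which is scalar on `V₀` and on `V₁`. -/
theorem exists_blockScalar_of_weights (d : Mat F m n →ₗ[F] Mat F m n)
    (h_even : ∀ x ∈ matParity F m n 0, d x ∈ Submodule.span F {(1 : Mat F m n)})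
    (h_weight : ∀ k l, idxParity k ≠ idxParity l → ∃ c : F, d (single k l 1) = c • single k l 1)
    (h_left : ∀ p k l, p ≠ k → idxParity p = idxParity k → idxParity k ≠ idxParity l →
      d (single p l 1) = single p k 1 * d (single k l 1) - d (single k l 1) * single p k 1)
    (h_right : ∀ p k l, p ≠ k → idxParity p = idxParity k → idxParity l ≠ idxParity k →
      d (single l p 1) = d (single l k 1) * single k p 1 - single k p 1 * d (single l k 1))
    (h_neg : ∀ k l, idxParity k ≠ idxParity l → ∀ c c' : F, d (single k l 1) = c • single k l 1 →
      d (single l k 1) = c' • single l k 1 → c + c' = 0) :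
    ∃ c : F, ∀ x, d x - (gl F m n).bracket (blockScalar F m n c 0) x ∈
      Submodule.span F {(1 : Mat F m n)} := by
  -- Brackets with even matrix units move first the row index and then the column index of an odd
  -- unit, so all odd units mapping `V₁` to `V₀` share one weight. Those in the other direction get
  -- the negative weight by `h_neg`.
  have hup : ∃ c : F, ∀ i j, d (single (Sum.inl i) (Sum.inr j) 1) =
      c • single (Sum.inl i) (Sum.inr j) 1 := by
    rcases isEmpty_or_nonempty (Fin m) with hm | ⟨⟨i₀⟩⟩
    · exact ⟨0, fun i => hm.elim i⟩
    rcases isEmpty_or_nonempty (Fin n) with hn | ⟨⟨j₀⟩⟩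
    · exact ⟨0, fun _ j => hn.elim j⟩
    obtain ⟨c, hc⟩ := h_weight (Sum.inl i₀) (Sum.inr j₀) (by simp [idxParity])
    refine ⟨c, fun i j => ?_⟩
    have h1 : d (single (Sum.inl i) (Sum.inr j₀) 1) = c • single (Sum.inl i) (Sum.inr j₀) 1 := by
      by_cases hi : i = i₀
      · rw [hi, hc]
      · rw [h_left (Sum.inl i) (Sum.inl i₀) (Sum.inr j₀) (by simpa using hi) rfl
          (by simp [idxParity]), hc]
        simp
    by_cases hj : j = j₀
    · rw [hj, h1]
    · rw [h_right (Sum.inr j) (Sum.inr j₀) (Sum.inl i) (by simpa using hj) rfl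
          (by simp [idxParity]), h1]
      simp
  obtain ⟨c, hc⟩ := hup
  refine ⟨c, fun x => ?_⟩
  have hz := blockScalar_mem (m := m) (n := n) c (0 : F)
  let f : Mat F m n →ₗ[F] Mat F m n := d - (gl F m n).bracket (blockScalar F m n c 0)
  have hf0 : f (matComp F m n 0 x) ∈ Submodule.span F {(1 : Mat F m n)} := by
    have hx := matComp_mem 0 x
    simp only [f, LinearMap.sub_apply, gl_bracket_even_left hz, blockScalar_comm hx, sub_self,
      sub_zero]
    exact h_even _ hx
  have hf1 : f (matComp F m n 1 x) ∈ Submodule.span F {(1 : Mat F m n)} := by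
    refine matrix_mem_of_single f (fun i j hij => ?_) (matComp_mem 1 x)
    suffices f (single i j 1) = 0 by rw [this]; exact Submodule.zero_mem _
    simp only [f, LinearMap.sub_apply, gl_bracket_even_left hz]
    rw [blockScalar]
    rcases i with i | i <;> rcases j with j | j
    · simp [idxParity] at hij
    · rw [hc]
      ext a b
      rcases a with a | a <;> rcases b with b | b <;> simp [single_apply]
    · obtain ⟨c', hc'⟩ := h_weight (Sum.inr i) (Sum.inl j) (by simp [idxParity])
      have := h_neg (Sum.inl j) (Sum.inr i) (by simp [idxParity]) c c' (hc j i) hc'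
      rw [hc', eq_neg_of_add_eq_zero_right this]
      ext a b
      rcases a with a | a <;> rcases b with b | b <;> simp [single_apply]
    · simp [idxParity, CharTwo.add_self_eq_zero] at hij
  have := Submodule.add_mem _ hf0 hf1
  rwa [← map_add, matComp_add] at this

variable [CharZero F]

/-- An even derivation of `gl(m|n)` which kills the identity is inner modulo scalars. -/
theorem exists_inner_of_derivation (D : Mat F m n →ₗ[F] Mat F m n)
    (hpar : ∀ a, ∀ x ∈ (gl F m n).parity a, D x ∈ (gl F m n).parity a)
    (hder : ∀ x y, D ((gl F m n).bracket x y) =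
      (gl F m n).bracket (D x) y + (gl F m n).bracket x (D y))
    (h_one : D 1 = 0) :
    ∃ H ∈ matParity F m n 0, ∀ x, D x - (gl F m n).bracket H x ∈
      Submodule.span F {(1 : Mat F m n)} := by
  obtain ⟨H, hH, hHx⟩ := exists_inner_even D (hpar 0) (by
    intro x hx y hy
    refine ⟨0, ?_⟩
    have := hder x y
    rw [gl_bracket_even_left hx, gl_bracket_even_right hy, gl_bracket_even_left hx] at this
    simpa using this)
  let d : Mat F m n →ₗ[F] Mat F m n := D - (gl F m n).bracket H
  have hd : ∀ x y, d ((gl F m n).bracket x y) =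
      (gl F m n).bracket (d x) y + (gl F m n).bracket x (d y) := by
    intro x y
    simp only [d, LinearMap.sub_apply, hder, map_sub, (gl F m n).bracket_bracket_of_even hH x y]
    abel
  have hd_one : d 1 = 0 := by
    simp [d, h_one, gl_bracket_even_left hH]
  have hd_even : ∀ x ∈ matParity F m n 0, ∃ a b : F, d x = blockScalar F m n a b := by
    intro x hx
    obtain ⟨a, b, hab⟩ := hHx x hx
    exact ⟨a, b, by simp [d, hab, gl_bracket_even_left hH]⟩
  have hEl : ∀ {k l : Fin m ⊕ Fin n}, k ≠ l →
      (gl F m n).bracket (single k k 1) (single k l 1) = single k l (1 : F) := by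
    intro k l hkl
    rw [gl_bracket_even_left (single_mem_even rfl 1)]
    simp [hkl.symm]
  -- If an index `l` of the other parity exists, the `(k, l)` entry of the derivation rule for
  -- `[E_kk, E_kl] = E_kl` forces the two block constants to agree. Otherwise one of the blocks is
  -- empty and a block scalar is already scalar.
  have hd_diag : ∀ k, ∃ a : F, d (single k k 1) = a • 1 := by
    intro k
    obtain ⟨a, b, hab⟩ := hd_even (single k k 1) (single_mem_even rfl 1)
    by_cases hl : ∃ l, idxParity k ≠ idxParity (m := m) (n := n) l
    · obtain ⟨l, hl⟩ := hl
      have hkl : k ≠ l := fun h => hl (by rw [h])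
      have h1 := congrFun (congrFun (hd (single k k 1) (single k l 1)) k) l
      rw [hEl hkl, hab, gl_bracket_even_left (blockScalar_mem a b),
        gl_bracket_even_left (single_mem_even rfl 1)] at h1
      simp only [blockScalar, Matrix.add_apply, Matrix.sub_apply, mul_diagonal,
        single_one_mul_apply, mul_single_one_apply, if_true, hkl.symm, if_false, sub_zero,
        single_apply_same, one_mul] at h1
      have hab' : a = b := by
        rcases k with k | k <;> rcases l with l | l
        · exact absurd rfl hl
        · simp at h1; linear_combination h1
        · simp at h1; linear_combination -h1
        · exact absurd rfl hl
      refine ⟨a, ?_⟩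
      rw [hab, ← hab', blockScalar, smul_one_eq_diagonal]
      congr 1
      ext i
      rcases i with i | i <;> rfl
    · push Not at hl
      rcases k with k | k
      · refine ⟨a, ?_⟩
        rw [hab, blockScalar, smul_one_eq_diagonal]
        congr 1
        ext i
        rcases i with i | i
        · rfl
        · exact absurd (hl (Sum.inr i)) (by simp [idxParity])
      · refine ⟨b, ?_⟩
        rw [hab, blockScalar, smul_one_eq_diagonal]
        congr 1
        ext i
        rcases i with i | i
        · exact absurd (hl (Sum.inl i)) (by simp [idxParity])
        · rfl
  have hd_off : ∀ k l, k ≠ l → idxParity k = idxParity l → d (single k l 1) = 0 := by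
    intro k l hkl h
    obtain ⟨a, ha⟩ := hd_diag k
    obtain ⟨b, c, hbc⟩ := hd_even (single k l 1) (single_mem_even h 1)
    have h1 := hd (single k k 1) (single k l 1)
    rw [hEl hkl, ha, gl_bracket_smul_one_left, hbc,
      gl_bracket_even_left (single_mem_even rfl 1),
      blockScalar_comm (single_mem_even rfl 1), sub_self, add_zero] at h1
    rw [hbc, h1]
  have h_even : ∀ x ∈ matParity F m n 0, d x ∈ Submodule.span F {(1 : Mat F m n)} := by
    intro x hx
    refine matrix_mem_of_single d (fun i j hij => ?_) hx
    by_cases h : i = j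
    · subst h
      obtain ⟨a, ha⟩ := hd_diag i
      exact Submodule.mem_span_singleton.2 ⟨a, ha.symm⟩
    · have hij' : idxParity i = idxParity j := by
        by_contra hne
        rw [idxParity_add_of_ne hne] at hij
        exact absurd hij (by decide)
      rw [hd_off i j h hij']
      exact Submodule.zero_mem _
  -- As `d E_kk` and `d E_ll` are scalar, `X = d E_kl` satisfies `[E_kk, X] = X` and `[X, E_ll] =
  -- X`. These leave only the `(k, l)` entry; for column `k` one divides by `2`.
  obtain ⟨c, hc⟩ := exists_blockScalar_of_weights d h_even
    (by
      intro k l hkl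
      have hne : k ≠ l := fun h => hkl (by rw [h])
      obtain ⟨a, ha⟩ := hd_diag k
      obtain ⟨b, hb⟩ := hd_diag l
      have h1 := hd (single k k 1) (single k l 1)
      rw [hEl hne, ha, gl_bracket_smul_one_left, zero_add,
        gl_bracket_even_left (single_mem_even rfl 1)] at h1
      have h2 := hd (single k l 1) (single l l 1)
      have h3 : (gl F m n).bracket (single k l 1) (single l l 1) = single k l (1 : F) := by
        rw [gl_bracket_even_right (single_mem_even rfl 1)]
        simp [hne.symm]
      rw [h3, hb, gl_bracket_smul_one_right, add_zero,
        gl_bracket_even_right (single_mem_even rfl 1)] at h2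
      refine ⟨d (single k l 1) k l, ?_⟩
      ext i j
      have h1' := congrFun (congrFun h1 i) j
      have h2' := congrFun (congrFun h2 i) j
      simp only [Matrix.sub_apply, single_one_mul_apply, mul_single_one_apply] at h1' h2'
      by_cases hi : i = k
      · by_cases hj : j = l
        · subst hi hj; simp
        · rw [if_neg hj] at h2'
          rw [if_neg (by rw [hi]; exact hne), sub_zero] at h2'
          simp [h2', Ne.symm hj]
      · rw [if_neg hi] at h1'
        by_cases hj : j = k
        · subst hj
          rw [if_pos rfl] at h1'
          have : d (single j l 1) i j = 0 := by
            have h4 : (2 : F) * d (single j l 1) i j = 0 := by linear_combination h1'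
            simpa using h4
          simp [this, Ne.symm hi]
        · rw [if_neg hj] at h1'
          simp [h1', Ne.symm hi])
    (by
      intro p k l hpk h1 h2
      have h3 := hd (single p k 1) (single k l 1)
      have hne : l ≠ p := by rintro rfl; exact h2 h1.symm
      rw [gl_bracket_even_left (single_mem_even h1 1), hd_off p k hpk h1,
        gl_bracket_even_left (single_mem_even h1 1)] at h3
      simpa [hne] using h3)
    (by
      intro p k l hpk h1 h2
      have h3 := hd (single l k 1) (single k p 1)
      have hne : p ≠ l := by rintro rfl; exact h2 h1
      rw [gl_bracket_even_right (single_mem_even h1.symm 1), hd_off k p hpk.symm h1.symm,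
        gl_bracket_even_right (single_mem_even h1.symm 1)] at h3
      simpa [hne] using h3)
    (by
      intro k l hkl c c' hc hc'
      have h1 := hd (single k l 1) (single l k 1)
      have h2 : (gl F m n).bracket (single k l 1) (single l k 1) =
          single k k (1 : F) + single l l 1 := by
        rw [gl_bracket_odd (single_mem_odd hkl 1) (single_mem_odd hkl.symm 1)]
        simp
      rw [hc, hc', map_smul, LinearMap.smul_apply, map_smul, h2, ← add_smul] at h1
      obtain ⟨a, ha⟩ := hd_diag k
      obtain ⟨b, hb⟩ := hd_diag l
      -- The element `(c + c') • (E_kk + E_ll)` is scalar. Applying `d` once more and using `d 1 =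
      -- 0` yields `(c + c')² = 0`. The second application is needed for `gl(1|1)`, where `E_kk +
      -- E_ll` is itself the identity.
      have h3 : (c + c') • (single k k (1 : F) + single l l 1) = a • 1 + b • 1 := by
        rw [← h1, map_add, ha, hb]
      replace h3 := congrArg d h3
      rw [map_smul, h1, map_add, map_smul, map_smul, hd_one, smul_zero, smul_zero,
        add_zero, smul_smul] at h3
      have h4 := congrFun (congrFun h3 k) k
      have hne : l ≠ k := fun h => hkl (by rw [h])
      simp [hne] at h4
      exact h4)
  refine ⟨H + blockScalar F m n c 0, Submodule.add_mem _ hH (blockScalar_mem c 0), fun x => ?_⟩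
  have := hc x
  simp only [d, LinearMap.sub_apply] at this
  rwa [map_add, LinearMap.add_apply, ← sub_sub]

end Derivations

end LieSuperalgebra

/-! ### Maps of `gl(m|n)` that are derivations only modulo scalars -/

namespace LieSuperalgebra

section ModScalars

open Matrix

variable {F : Type*} [Field F] {m n : ℕ}

theorem eq_zero_of_odd_of_mem_span {x : Mat F m n} (hx : x ∈ matParity F m n 1)
    (h : x ∈ Submodule.span F {(1 : Mat F m n)}) : x = 0 :=
  Submodule.disjoint_def.1 (gl F m n).isCompl.disjoint x (scalar_mem_even h) hx

theorem single_mem_slSub {i j : Fin m ⊕ Fin n} (h : i ≠ j) : single i j (1 : F) ∈ slSub F m n := by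
  rw [LinearMap.mem_ker, supertrace_eq]
  refine Finset.sum_eq_zero fun k _ => ?_
  rw [single_apply_of_ne _ _ _ _ _ (by rintro ⟨rfl, rfl⟩; exact h rfl), mul_zero]

/-- The diagonal units are not in `sl(m|n)`, so supports must be controlled with off-diagonal even
units instead. This uses up to two spare indices of the same parity, whence the bound `3`. -/
theorem exists_pair_idxParity_eq (hm : 3 ≤ m) (hn : 3 ≤ n) (k : Fin m ⊕ Fin n) :
    ∃ p p' : Fin m ⊕ Fin n, p ≠ k ∧ p' ≠ k ∧ p ≠ p' ∧ idxParity p = idxParity k ∧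
      idxParity p' = idxParity k := by
  have key : ∀ N, 3 ≤ N → ∀ i : Fin N, ∃ a b : Fin N, a ≠ i ∧ b ≠ i ∧ a ≠ b := by
    intro N hN i
    have h : 1 < (Finset.univ.erase i).card := by
      rw [Finset.card_erase_of_mem (Finset.mem_univ i), Finset.card_univ, Fintype.card_fin]
      omega
    obtain ⟨a, ha, b, hb, hab⟩ := Finset.one_lt_card.1 h
    exact ⟨a, b, (Finset.mem_erase.1 ha).1, (Finset.mem_erase.1 hb).1, hab⟩
  rcases k with i | i
  · obtain ⟨a, b, h1, h2, h3⟩ := key m hm i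
    exact ⟨Sum.inl a, Sum.inl b, by simpa, by simpa, by simpa, rfl, rfl⟩
  · obtain ⟨a, b, h1, h2, h3⟩ := key n hn i
    exact ⟨Sum.inr a, Sum.inr b, by simpa, by simpa, by simpa, rfl, rfl⟩

theorem sum_single_inl : ∑ i : Fin m, single (Sum.inl i) (Sum.inl i) (1 : F) =
    blockScalar F m n 1 0 := by
  rw [blockScalar, ← sum_single_eq_diagonal, Fintype.sum_sum_type]
  simp

theorem sum_single_inr : ∑ i : Fin n, single (Sum.inr i) (Sum.inr i) (1 : F) =
    blockScalar F m n 0 1 := by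
  rw [blockScalar, ← sum_single_eq_diagonal, Fintype.sum_sum_type]
  simp

/-- An even linear map of `gl(m|n)`, `m, n ≥ 3`, which is a derivation modulo scalars on `sl(m|n)`
and on the even part is inner modulo scalars. -/
theorem exists_inner_of_derivation_mod_scalars [CharZero F] (hm : 3 ≤ m) (hn : 3 ≤ n)
    (D : Mat F m n →ₗ[F] Mat F m n)
    (hpar : ∀ a, ∀ x ∈ (gl F m n).parity a, D x ∈ (gl F m n).parity a)
    (h_even : ∀ x ∈ matParity F m n 0, ∀ y ∈ matParity F m n 0,
      D ((gl F m n).bracket x y) - ((gl F m n).bracket (D x) y + (gl F m n).bracket x (D y)) ∈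
        Submodule.span F {(1 : Mat F m n)})
    (h_sl : ∀ x ∈ slSub F m n, ∀ y ∈ slSub F m n,
      D ((gl F m n).bracket x y) - ((gl F m n).bracket (D x) y + (gl F m n).bracket x (D y)) ∈
        Submodule.span F {(1 : Mat F m n)})
    (h_zero : D (blockScalar F m n 1 0) = 0) (h_one : D (blockScalar F m n 0 1) = 0) :
    ∃ H ∈ matParity F m n 0, ∀ x, D x - (gl F m n).bracket H x ∈
      Submodule.span F {(1 : Mat F m n)} := by
  obtain ⟨H, hH, hHx⟩ := exists_inner_even D (hpar 0) (by
    intro x hx y hy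
    obtain ⟨c, hc⟩ := Submodule.mem_span_singleton.1 (h_even x hx y hy)
    refine ⟨c, ?_⟩
    rw [gl_bracket_even_left hx, gl_bracket_even_right hy, gl_bracket_even_left hx] at hc
    rw [hc]; abel)
  let d : Mat F m n →ₗ[F] Mat F m n := D - (gl F m n).bracket H
  have hdd : ∀ x y, d ((gl F m n).bracket x y) -
        ((gl F m n).bracket (d x) y + (gl F m n).bracket x (d y)) =
      D ((gl F m n).bracket x y) -
        ((gl F m n).bracket (D x) y + (gl F m n).bracket x (D y)) := by
    intro x y
    simp only [d, LinearMap.sub_apply, map_sub, (gl F m n).bracket_bracket_of_even hH x y]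
    abel
  have hd_par : ∀ a, ∀ x ∈ matParity F m n a, d x ∈ matParity F m n a := fun a x hx =>
    Submodule.sub_mem _ (hpar a x hx) ((gl F m n).bracket_mem_of_even hH a x hx)
  have hd_block : ∀ x ∈ matParity F m n 0, ∃ a b : F, d x = blockScalar F m n a b := by
    intro x hx
    obtain ⟨a, b, hab⟩ := hHx x hx
    exact ⟨a, b, by simp [d, hab, gl_bracket_even_left hH]⟩
  have hd_bracket : ∀ x ∈ matParity F m n 0, ∀ y ∈ matParity F m n 0,
      d (x * y - y * x) ∈ Submodule.span F {(1 : Mat F m n)} := by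
    intro x hx y hy
    have h1 := h_even x hx y hy
    obtain ⟨a, b, hab⟩ := hd_block x hx
    obtain ⟨a', b', hab'⟩ := hd_block y hy
    rw [← hdd, gl_bracket_even_left hx, gl_bracket_even_right hy, gl_bracket_even_left hx, hab,
      hab', blockScalar_comm hx, blockScalar_comm hy] at h1
    simpa using h1
  have hd_diff : ∀ i j, idxParity i = idxParity j → d (single i i 1) - d (single j j 1) ∈
      Submodule.span F {(1 : Mat F m n)} := by
    intro i j hij
    by_cases h : i = j
    · rw [h, sub_self]; exact Submodule.zero_mem _
    · have := hd_bracket _ (single_mem_even hij 1) _ (single_mem_even hij.symm 1)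
      simpa using this
  have hd_zero : d (blockScalar F m n 1 0) = 0 := by
    simp [d, h_zero, gl_bracket_even_left hH, blockScalar_comm hH]
  have hd_one : d (blockScalar F m n 0 1) = 0 := by
    simp [d, h_one, gl_bracket_even_left hH, blockScalar_comm hH]
  have hd_even : ∀ x ∈ matParity F m n 0, d x ∈ Submodule.span F {(1 : Mat F m n)} := by
    intro x hx
    refine matrix_mem_of_single d (fun i j hij => ?_) hx
    have hij' : idxParity i = idxParity j := by
      by_contra hne
      rw [idxParity_add_of_ne hne] at hij
      exact absurd hij (by decide)
    by_cases h : i = j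
    · subst h
      rcases i with i | i
      -- The units `E_jj` of one block add up to a matrix killed by `d`, and the differences `E_ii -
      -- E_jj` go to scalars, being commutators of even matrices. Averaging over the block gives `d
      -- E_ii` itself.
      · have h1 : (m : F) • d (single (Sum.inl i) (Sum.inl i) 1) =
            ∑ j : Fin m, (d (single (Sum.inl i) (Sum.inl i) 1) -
              d (single (Sum.inl j) (Sum.inl j) 1)) := by
          rw [Finset.sum_sub_distrib,
            ← map_sum d (fun j => single (Sum.inl j) (Sum.inl j) (1 : F)), sum_single_inl, hd_zero, sub_zero]
          simp [Nat.cast_smul_eq_nsmul]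
        refine (Submodule.smul_mem_iff _ (Nat.cast_ne_zero.2 (by omega : m ≠ 0) : (m : F) ≠ 0)).1 ?_
        rw [h1]
        exact Submodule.sum_mem _ fun j _ => hd_diff _ _ rfl
      · have h1 : (n : F) • d (single (Sum.inr i) (Sum.inr i) 1) =
            ∑ j : Fin n, (d (single (Sum.inr i) (Sum.inr i) 1) -
              d (single (Sum.inr j) (Sum.inr j) 1)) := by
          rw [Finset.sum_sub_distrib,
            ← map_sum d (fun j => single (Sum.inr j) (Sum.inr j) (1 : F)), sum_single_inr, hd_one, sub_zero]
          simp [Nat.cast_smul_eq_nsmul]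
        refine (Submodule.smul_mem_iff _ (Nat.cast_ne_zero.2 (by omega : n ≠ 0) : (n : F) ≠ 0)).1 ?_
        rw [h1]
        exact Submodule.sum_mem _ fun j _ => hd_diff _ _ rfl
    · have := hd_bracket _ (single_mem_even (i := i) rfl 1) _ (single_mem_even hij' 1)
      simpa [Ne.symm h] using this
  have h_left : ∀ p k l, p ≠ k → idxParity p = idxParity k → idxParity k ≠ idxParity l →
      d (single p l 1) = single p k 1 * d (single k l 1) - d (single k l 1) * single p k 1 := by
    intro p k l hpk h1 h2
    have hkl : k ≠ l := fun h => h2 (by rw [h])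
    have hlp : l ≠ p := fun h => h2 (by rw [h, h1])
    have h3 := h_sl _ (single_mem_slSub hpk) _ (single_mem_slSub hkl)
    obtain ⟨a, ha⟩ := Submodule.mem_span_singleton.1 (hd_even _ (single_mem_even h1 1))
    have he : single p k (1 : F) ∈ matParity F m n 0 := single_mem_even h1 1
    have ho : single k l (1 : F) ∈ matParity F m n 1 := single_mem_odd h2 1
    rw [← hdd, ← ha, gl_bracket_smul_one_left, zero_add] at h3
    -- The identity is between odd matrices while the error is scalar, hence even; so the identity
    -- is exact.
    have h4 := sub_eq_zero.1 (eq_zero_of_odd_of_mem_span (Submodule.sub_mem _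
      (hd_par 1 _ ((gl F m n).bracket_mem_of_even he 1 _ ho))
      ((gl F m n).bracket_mem_of_even he 1 _ (hd_par 1 _ ho))) h3)
    rw [gl_bracket_even_left he, gl_bracket_even_left he] at h4
    simpa [hlp] using h4
  have h_right : ∀ p k l, p ≠ k → idxParity p = idxParity k → idxParity l ≠ idxParity k →
      d (single l p 1) = d (single l k 1) * single k p 1 - single k p 1 * d (single l k 1) := by
    intro p k l hpk h1 h2
    have hlk : l ≠ k := fun h => h2 (by rw [h])
    have hpl : p ≠ l := fun h => h2 (by rw [← h, h1])
    have h3 := h_sl _ (single_mem_slSub hlk) _ (single_mem_slSub hpk.symm)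
    obtain ⟨a, ha⟩ := Submodule.mem_span_singleton.1 (hd_even _ (single_mem_even h1.symm 1))
    have he : single k p (1 : F) ∈ matParity F m n 0 := single_mem_even h1.symm 1
    have ho : single l k (1 : F) ∈ matParity F m n 1 := single_mem_odd h2 1
    rw [← hdd, ← ha, gl_bracket_smul_one_right, add_zero] at h3
    have h4 := sub_eq_zero.1 (eq_zero_of_odd_of_mem_span (Submodule.sub_mem _
      (hd_par 1 _ ((gl F m n).bracket_mem_of_even_right he 1 _ ho))
      ((gl F m n).bracket_mem_of_even_right he 1 _ (hd_par 1 _ ho))) h3)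
    rw [gl_bracket_even_right he, gl_bracket_even_right he] at h4
    simpa [hpl] using h4
  -- Writing `E_kl = [E_kp, E_pl]` confines the support of `d E_kl` to row `k` and column `p`; two
  -- choices of `p` leave row `k`. Writing `E_kl = [E_kq, E_ql]` confines it to column `l` and row
  -- `q`, and `q ≠ k` by parity.
  obtain ⟨c, hc⟩ := exists_blockScalar_of_weights d hd_even
    (by
      intro k l hkl
      refine ⟨d (single k l 1) k l, ?_⟩
      ext i j
      by_cases hi : i = k
      · by_cases hj : j = l
        · subst hi hj; simp
        · obtain ⟨q, q', h1, h2, h3, h4, h5⟩ := exists_pair_idxParity_eq hm hn l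
          have key : ∀ q, q ≠ l → idxParity q = idxParity l → i ≠ q →
              d (single k l 1) i j = 0 := by
            intro q hq hql hiq
            rw [h_right l q k hq.symm hql.symm (by rwa [hql]), Matrix.sub_apply,
              single_one_mul_apply, mul_single_one_apply, if_neg hj, if_neg hiq, sub_zero]
          have : d (single k l 1) i j = 0 := key q h1 h4 (by
            rintro rfl; exact hkl (by rw [← hi, h4]))
          simp [this, Ne.symm hj]
      · obtain ⟨p, p', h1, h2, h3, h4, h5⟩ := exists_pair_idxParity_eq hm hn k
        have key : ∀ p, p ≠ k → idxParity p = idxParity k → j ≠ p →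
            d (single k l 1) i j = 0 := by
          intro p hp hpk hjp
          rw [h_left k p l hp.symm hpk.symm (by rwa [hpk]), Matrix.sub_apply,
            single_one_mul_apply, mul_single_one_apply, if_neg hi, if_neg hjp, sub_zero]
        have : d (single k l 1) i j = 0 := by
          by_cases hjp : j = p
          · exact key p' h2 h5 (by rw [hjp]; exact h3)
          · exact key p h1 h4 hjp
        simp [this, Ne.symm hi])
    h_left h_right
    (by
      intro k l hkl c c' hc hc'
      have hne : k ≠ l := fun h => hkl (by rw [h])
      have h1 := h_sl _ (single_mem_slSub hne) _ (single_mem_slSub hne.symm)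
      have h2 : (gl F m n).bracket (single k l 1) (single l k 1) =
          single k k (1 : F) + single l l 1 := by
        rw [gl_bracket_odd (single_mem_odd hkl 1) (single_mem_odd hkl.symm 1)]
        simp
      rw [← hdd, hc, hc', map_smul, LinearMap.smul_apply, map_smul, h2, ← add_smul] at h1
      have h3 := Submodule.sub_mem _ (hd_even (single k k (1 : F) + single l l 1)
        (Submodule.add_mem _ (single_mem_even rfl 1) (single_mem_even rfl 1))) h1
      rw [sub_sub_cancel] at h3
      obtain ⟨a, ha⟩ := Submodule.mem_span_singleton.1 h3
      -- At a third index `p` the diagonal entry of `E_kk + E_ll` is zero and that of the identity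
      -- is one, so the scalar vanishes.
      obtain ⟨p, -, hp, -, -, hpk, -⟩ := exists_pair_idxParity_eq hm hn k
      have hpl : p ≠ l := by rintro rfl; exact hkl hpk.symm
      have ha0 := congrFun (congrFun ha p) p
      simp [hp.symm, hpl.symm] at ha0
      have h4 := congrFun (congrFun ha k) k
      simp [ha0, hne.symm] at h4
      exact h4.symm)
  refine ⟨H + blockScalar F m n c 0, Submodule.add_mem _ hH (blockScalar_mem c 0), fun x => ?_⟩
  have := hc x
  simp only [d, LinearMap.sub_apply] at this
  rwa [map_add, LinearMap.add_apply, ← sub_sub]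

end ModScalars

end LieSuperalgebra

/-! ### Good gradings of `gl(m|n)` -/

namespace LieSuperalgebra

section GoodGradings

open Matrix

variable {F : Type*} [Field F] {m n : ℕ}

theorem smul_one_eq_zero_of_trace [CharZero F] {a : F}
    (h : (a • (1 : Mat F m n)).trace = 0) : a • (1 : Mat F m n) = 0 := by
  rcases isEmpty_or_nonempty (Fin m ⊕ Fin n) with hι | hι
  · exact Subsingleton.elim _ _
  rw [trace_smul, trace_one, smul_eq_mul, mul_eq_zero,
    or_iff_left (Nat.cast_ne_zero.2 Fintype.card_ne_zero)] at h
  rw [h, zero_smul]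

/-- This is the device that turns congruences modulo scalars between commutators into equalities. -/
theorem smul_one_eq_zero_of_commutator [CharZero F] {x y : Mat F m n} {a : F}
    (h : x * y - y * x = a • 1) : a • (1 : Mat F m n) = 0 := by
  refine smul_one_eq_zero_of_trace ?_
  rw [← h, trace_sub, trace_mul_comm, sub_self]

theorem mem_adGrading_iff {H : Mat F m n} (hH : H ∈ matParity F m n 0) {j : ℤ} {x : Mat F m n} :
    x ∈ (gl F m n).adGrading H j ↔ H * x - x * H = (j : F) • x := by
  rw [adGrading, Module.End.mem_eigenspace_iff, gl_bracket_even_left hH]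

variable [CharZero F]

/-- A diagonalizable even derivation of `gl(m|n)` with integer eigenvalues which kills the identity
is inner. -/
theorem exists_eq_bracket_of_derivation {D : Module.End F (Mat F m n)}
    (htop : ⨆ j : ℤ, D.eigenspace (j : F) = ⊤)
    (hpar : ∀ a, ∀ x ∈ (gl F m n).parity a, D x ∈ (gl F m n).parity a)
    (hder : ∀ x y, D ((gl F m n).bracket x y) =
      (gl F m n).bracket (D x) y + (gl F m n).bracket x (D y))
    (h_one : D 1 = 0) :
    ∃ H ∈ matParity F m n 0, D = (gl F m n).bracket H := by
  obtain ⟨H, hH, hHx⟩ := exists_inner_of_derivation D hpar hder h_one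
  refine ⟨H, hH, LinearMap.ext fun x => ?_⟩
  -- Scalars are central, so the scalar errors drop out and `D` agrees with `ad H` on every bracket.
  have hN : ∀ x y, D ((gl F m n).bracket x y) =
      (gl F m n).bracket H ((gl F m n).bracket x y) := by
    intro x y
    rw [hder, (gl F m n).bracket_bracket_of_even hH]
    obtain ⟨a, ha⟩ := Submodule.mem_span_singleton.1 (hHx x)
    obtain ⟨b, hb⟩ := Submodule.mem_span_singleton.1 (hHx y)
    rw [← sub_add_cancel (D x) ((gl F m n).bracket H x), ← ha,
      ← sub_add_cancel (D y) ((gl F m n).bracket H y), ← hb]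
    simp only [map_add, LinearMap.add_apply, gl_bracket_smul_one_left, gl_bracket_smul_one_right,
      zero_add]
  have hx : x ∈ ⨆ j : ℤ, D.eigenspace (j : F) := htop ▸ Submodule.mem_top
  refine Submodule.iSup_induction _ (motive := fun x => D x = (gl F m n).bracket H x) hx
    (fun j x hx => ?_) (by simp) (fun x y h1 h2 => by rw [map_add, map_add, h1, h2])
  rw [Module.End.mem_eigenspace_iff] at hx
  obtain ⟨a, ha⟩ := Submodule.mem_span_singleton.1 (hHx x)
  -- In degree zero the error is a scalar commutator, hence zero. In degree `j ≠ 0` one applies `D`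
  -- to `j x = [H, x] + a · 1`: the last term dies, and on the bracket `D` is `ad H`.
  by_cases hj : (j : F) = 0
  · rw [hx, hj, zero_smul, zero_sub, gl_bracket_even_left hH] at ha
    have h0 := smul_one_eq_zero_of_commutator (x := x) (y := H) (a := a) (by rw [ha]; abel)
    rw [hx, hj, zero_smul, gl_bracket_even_left hH, ← neg_eq_zero.1 (ha.symm.trans h0)]
  · have h1 : (j : F) • x = (gl F m n).bracket H x + a • 1 := by rw [ha, hx]; abel
    have h2 : (j : F) • D x = (j : F) • (gl F m n).bracket H x := by
      rw [← map_smul, ← map_smul, h1, map_add, map_add, hN, map_smul, h_one,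
        gl_bracket_smul_one_right, smul_zero]
    exact smul_right_injective _ hj h2

/-- A good grading of `gl(m|n)` is given by the adjoint action of an even element. -/
theorem IsGoodGrading.exists_eq_adGrading {e : Mat F m n} {𝒜 : ℤ → Submodule F (Mat F m n)}
    (h : (gl F m n).IsGoodGrading e 𝒜) :
    ∃ H ∈ matParity F m n 0, 𝒜 = (gl F m n).adGrading H := by
  obtain ⟨D, hD, htop, hder, hpar⟩ := h.isGrading.exists_derivation
  have he : e ∈ matParity F m n 0 := h.even
  have h_one : D 1 = 0 := by
    have h1 : D 1 ∈ matParity F m n 0 := hpar 0 1 one_mem_matParity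
    obtain ⟨a, ha⟩ := exists_smul_one_of_commutator (M := D 1) (fun y => ⟨0, by
      have h2 := hder 1 y
      have h3 : ∀ y, (gl F m n).bracket 1 y = 0 := fun y => by
        simpa using gl_bracket_smul_one_left (m := m) (n := n) (1 : F) y
      rw [h3, h3, map_zero, gl_bracket_even_left h1, add_zero] at h2
      rw [← h2, zero_smul]⟩)
    by_cases h0 : (1 : Mat F m n) = 0
    · rw [h0, map_zero]
    obtain ⟨j, rfl⟩ := exists_int_of_apply_eq_smul htop h0 ha
    have hj : (1 : Mat F m n) ∈ 𝒜 j := by rw [hD]; exact Module.End.mem_eigenspace_iff.2 ha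
    rcases lt_trichotomy j 0 with hj' | rfl | hj'
    · refine absurd (h.injOn j (by omega) hj (Submodule.zero_mem _) ?_) h0
      rw [gl_bracket_even_left he]; simp
    · rw [ha]; simp
    · obtain ⟨x, -, hx⟩ := h.surjOn (j - 2) (by omega) (by simpa using hj)
      rw [gl_bracket_even_left he, ← one_smul F (1 : Mat F m n)] at hx
      exact absurd (by simpa using smul_one_eq_zero_of_commutator hx) h0
  obtain ⟨H, hH, rfl⟩ := exists_eq_bracket_of_derivation htop hpar hder h_one
  exact ⟨H, hH, funext hD⟩

/-- The trace form is invariant under `ad H`. The ordinary trace suffices in place of the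
supertrace, since brackets with the even elements `H` and `e` are ordinary commutators. -/
theorem trace_mul_eq_zero_of_add_ne_zero {H x y : Mat F m n} (hH : H ∈ matParity F m n 0)
    {i j : ℤ} (hij : i + j ≠ 0) (hx : x ∈ (gl F m n).adGrading H i)
    (hy : y ∈ (gl F m n).adGrading H j) : (x * y).trace = 0 := by
  rw [mem_adGrading_iff hH] at hx hy
  have h1 : ((i + j : ℤ) : F) • (x * y) = H * (x * y) - (x * y) * H := by
    rw [Int.cast_add, add_smul, ← smul_mul_assoc, ← mul_smul_comm, ← hx, ← hy]
    noncomm_ring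
  have h2 := congrArg Matrix.trace h1
  rw [trace_sub, trace_mul_comm H, sub_self, trace_smul, smul_eq_mul, mul_eq_zero] at h2
  exact h2.resolve_left (Int.cast_ne_zero.2 hij)

theorem isGrading_adGrading {H : Mat F m n} (hH : H ∈ matParity F m n 0)
    (htop : ⨆ j : ℤ, (gl F m n).adGrading H j = ⊤) :
    (gl F m n).IsGrading ((gl F m n).adGrading H) :=
  isGrading_of_derivation htop ((gl F m n).bracket_bracket_of_even hH)
    ((gl F m n).bracket_mem_of_even hH)

/-- The grading given by an even diagonalizable element `H` with `[H, e] = 2 e` is good as soon as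
the centralizer of `e` has no components of negative degree. -/
theorem isGoodGrading_adGrading {H e : Mat F m n} (hH : H ∈ matParity F m n 0)
    (he : e ∈ matParity F m n 0) (htop : ⨆ j : ℤ, (gl F m n).adGrading H j = ⊤)
    (h_two : H * e - e * H = (2 : F) • e)
    (hinj : ∀ j : ℤ, j ≤ -1 → ∀ x, H * x - x * H = (j : F) • x → e * x = x * e → x = 0) :
    (gl F m n).IsGoodGrading e ((gl F m n).adGrading H) := by
  have hgr := isGrading_adGrading hH htop
  have hmem : e ∈ (gl F m n).adGrading H 2 := (mem_adGrading_iff hH).2 (by simpa using h_two)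
  refine ⟨hgr, he, hmem, ?_, ?_⟩
  · intro j hj x hx y hy hxy
    rw [gl_bracket_even_left he, gl_bracket_even_left he] at hxy
    refine sub_eq_zero.1 (hinj j hj (x - y)
      ((mem_adGrading_iff hH).1 (Submodule.sub_mem _ hx hy)) ?_)
    rw [← sub_eq_zero, ← sub_eq_zero.2 hxy]
    noncomm_ring
  · intro j hj y hy
    change y ∈ (((gl F m n).adGrading H j).map ((gl F m n).bracket e) : Submodule F _)
    by_contra hyn
    -- If `y` were not in the image, some functional would vanish on the image but not at `y`.
    -- Written as a trace against a matrix whose relevant component is `M'` of degree `-(j + 2)`, it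
    -- forces `M'` to commute with `e`.
    obtain ⟨f, hfy, hf⟩ := Submodule.exists_dual_map_eq_bot_of_notMem hyn inferInstance
    obtain ⟨M, hM⟩ : ∃ M : Mat F m n, ∀ x, f x = (x * M).trace := by
      refine ⟨Matrix.of fun t s => f (single s t 1), fun x => ?_⟩
      conv_lhs => rw [matrix_eq_sum_single x]
      simp only [map_sum, Matrix.trace, Matrix.diag, Matrix.mul_apply, Matrix.of_apply]
      refine Finset.sum_congr rfl fun i _ => Finset.sum_congr rfl fun k _ => ?_
      rw [show single i k (x i k) = x i k • single i k (1 : F) by simp, map_smul, smul_eq_mul]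
    obtain ⟨M', hM', hMM'⟩ : ∃ M' ∈ (gl F m n).adGrading H (-(j + 2)),
        ∀ x ∈ (gl F m n).adGrading H (j + 2), (x * M).trace = (x * M').trace := by
      have hMtop : M ∈ ⨆ j : ℤ, (gl F m n).adGrading H j := htop ▸ Submodule.mem_top
      refine Submodule.iSup_induction _ (motive := fun M =>
        ∃ M' ∈ (gl F m n).adGrading H (-(j + 2)), ∀ x ∈ (gl F m n).adGrading H (j + 2),
          (x * M).trace = (x * M').trace) hMtop (fun i M hM => ?_)
        ⟨0, Submodule.zero_mem _, fun _ _ => rfl⟩ ?_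
      · by_cases hi : i = -(j + 2)
        · subst hi; exact ⟨M, hM, fun _ _ => rfl⟩
        · refine ⟨0, Submodule.zero_mem _, fun x hx => ?_⟩
          rw [trace_mul_eq_zero_of_add_ne_zero hH (by omega) hx hM, mul_zero, trace_zero]
      · rintro M₁ M₂ ⟨M₁', h1, h2⟩ ⟨M₂', h3, h4⟩
        refine ⟨M₁' + M₂', Submodule.add_mem _ h1 h3, fun x hx => ?_⟩
        rw [mul_add, mul_add, trace_add, trace_add, h2 x hx, h4 x hx]
    have hK : M' * e - e * M' ∈ (gl F m n).adGrading H (-j) := by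
      rw [← gl_bracket_even_right he]
      have := hgr.bracket_mem hM' hmem
      rwa [show -(j + 2) + 2 = -j by ring] at this
    have hK0 : ∀ x, (x * (M' * e - e * M')).trace = 0 := by
      intro x
      have hxtop : x ∈ ⨆ j : ℤ, (gl F m n).adGrading H j := htop ▸ Submodule.mem_top
      refine Submodule.iSup_induction _ (motive := fun x => (x * (M' * e - e * M')).trace = 0)
        hxtop (fun i x hx => ?_) (by simp) (fun x y h1 h2 => by rw [add_mul, trace_add, h1, h2,
          add_zero])
      by_cases hi : i = j
      · subst hi
        have h1 : f ((gl F m n).bracket e x) = 0 := by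
          have : f ((gl F m n).bracket e x) ∈ Submodule.map f
            (((gl F m n).adGrading H i).map ((gl F m n).bracket e)) :=
            Submodule.mem_map_of_mem (Submodule.mem_map_of_mem hx)
          rw [hf] at this
          exact this
        have h2 := hgr.bracket_mem hmem hx
        rw [add_comm] at h2
        rw [hM, hMM' _ h2, gl_bracket_even_left he] at h1
        rw [← h1]
        simp only [mul_sub, sub_mul, trace_sub]
        rw [← Matrix.mul_assoc, trace_mul_comm (x * M') e, ← Matrix.mul_assoc, ← Matrix.mul_assoc]
      · exact trace_mul_eq_zero_of_add_ne_zero hH (by omega) hx hK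
    have hK1 : M' * e - e * M' = 0 := by
      ext i k
      simpa [trace_single_mul] using hK0 (single k i 1)
    -- The bound `j ≥ -1` is exactly what puts `-(j + 2)` at or below `-1`.
    have hM0 : M' = 0 := hinj (-(j + 2)) (by omega) M' ((mem_adGrading_iff hH).1 hM')
      (sub_eq_zero.1 hK1).symm
    rw [hM, hMM' y hy, hM0, mul_zero, trace_zero] at hfy
    exact hfy rfl

end GoodGradings

end LieSuperalgebra

/-! ### Nilpotent matrices in Jordan form -/

section Shift

open Matrix

variable {F J : Type*} [Field F] [DecidableEq J] {r : J → ℕ}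

/-- The matrix which sends the basis vector of a box to that of its right neighbour. -/
def shiftMatrix (F : Type*) [Field F] (r : J → ℕ) : Matrix (Σ j, Fin (r j)) (Σ j, Fin (r j)) F :=
  Matrix.of fun s t => if s.1 = t.1 ∧ (s.2 : ℕ) = t.2 + 1 then 1 else 0

/-- The diagonal matrix whose entries increase in steps of two along each row. -/
def rowDiag (F : Type*) [Field F] (r : J → ℕ) (f : J → ℤ) : Matrix (Σ j, Fin (r j)) (Σ j, Fin (r j)) F :=
  Matrix.diagonal fun b => ((f b.1 + 2 * (b.2 : ℕ) : ℤ) : F)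

variable [Fintype J]

theorem shiftMatrix_mulVec_apply (w : (Σ j, Fin (r j)) → F) (j : J) (s : Fin (r j)) :
    (shiftMatrix F r *ᵥ w) ⟨j, s⟩ =
      if h : 0 < (s : ℕ) then w ⟨j, ⟨s - 1, by omega⟩⟩ else 0 := by
  simp only [mulVec, dotProduct, shiftMatrix, of_apply, ite_mul, one_mul, zero_mul]
  split_ifs with h
  · rw [Finset.sum_eq_single ⟨j, ⟨s - 1, by omega⟩⟩]
    · rw [if_pos ⟨rfl, by simp; omega⟩]
    · rintro ⟨j', t⟩ - hne
      rw [if_neg]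
      rintro ⟨h1, h2⟩
      simp only at h1 h2
      subst h1
      refine hne ?_
      congr 1
      ext
      simp; omega
    · simp
  · refine Finset.sum_eq_zero fun t _ => if_neg ?_
    rintro ⟨-, h2⟩
    omega

theorem shiftMatrix_mul_apply {ι : Type*} (X : Matrix (Σ j, Fin (r j)) ι F) (j : J)
    (s : Fin (r j)) (t : ι) :
    (shiftMatrix F r * X) ⟨j, s⟩ t =
      if h : 0 < (s : ℕ) then X ⟨j, ⟨s - 1, by omega⟩⟩ t else 0 :=
  shiftMatrix_mulVec_apply (fun b => X b t) j s

theorem mul_shiftMatrix_apply {ι : Type*} (X : Matrix ι (Σ j, Fin (r j)) F) (j : J)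
    (t : Fin (r j)) (s : ι) :
    (X * shiftMatrix F r) s ⟨j, t⟩ =
      if h : (t : ℕ) + 1 < r j then X s ⟨j, ⟨t + 1, h⟩⟩ else 0 := by
  simp only [mul_apply, shiftMatrix, of_apply, mul_ite, mul_one, mul_zero]
  split_ifs with h
  · rw [Finset.sum_eq_single ⟨j, ⟨t + 1, h⟩⟩]
    · simp
    · rintro ⟨j', u⟩ - hne
      rw [if_neg]
      rintro ⟨h1, h2⟩
      simp only at h1 h2
      subst h1
      refine hne ?_
      congr 1
      ext
      simpa using h2
    · simp
  · refine Finset.sum_eq_zero fun u _ => if_neg ?_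
    rintro ⟨h1, h2⟩
    obtain ⟨j', u⟩ := u
    simp only at h1 h2
    subst h1
    omega

theorem shiftMatrix_pow_mulVec_apply (k : ℕ) (w : (Σ j, Fin (r j)) → F) (j : J) (s : Fin (r j)) :
    (shiftMatrix F r ^ k *ᵥ w) ⟨j, s⟩ =
      if h : k ≤ (s : ℕ) then w ⟨j, ⟨s - k, by omega⟩⟩ else 0 := by
  induction k generalizing w with
  | zero => simp
  | succ k ih =>
    rw [pow_succ, ← mulVec_mulVec, ih]
    by_cases h : k ≤ (s : ℕ)
    · rw [dif_pos h, shiftMatrix_mulVec_apply]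
      by_cases h' : k + 1 ≤ (s : ℕ)
      · rw [dif_pos h', dif_pos (by simp; omega)]
        congr 3
      · rw [dif_neg h', dif_neg (by simp; omega)]
    · rw [dif_neg h, dif_neg (by omega)]

theorem shiftMatrix_pow_mulVec_single (j : J) (i : ℕ) (h : i < r j) :
    shiftMatrix F r ^ i *ᵥ Pi.single ⟨j, ⟨0, by omega⟩⟩ 1 = Pi.single ⟨j, ⟨i, h⟩⟩ 1 := by
  ext ⟨j', s⟩
  rw [shiftMatrix_pow_mulVec_apply]
  simp only [Pi.single_apply]
  by_cases hj : j' = j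
  · subst hj
    split_ifs with h1 h2 h3 h3 h2 <;> simp_all [Fin.ext_iff] <;> omega
  · simp [hj]

theorem shiftMatrix_pow_mulVec_single_eq_zero (j : J) (h : 0 < r j) :
    shiftMatrix F r ^ r j *ᵥ Pi.single ⟨j, ⟨0, h⟩⟩ 1 = 0 := by
  ext ⟨j', s⟩
  rw [shiftMatrix_pow_mulVec_apply]
  split_ifs with h1
  · rw [Pi.single_apply, if_neg]
    · rfl
    · intro h2
      obtain rfl : j' = j := congrArg Sigma.fst h2
      omega
  · rfl

theorem rowDiag_commutator_apply (f : J → ℤ) (X : Matrix (Σ j, Fin (r j)) (Σ j, Fin (r j)) F)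
    (s t : Σ j, Fin (r j)) :
    (rowDiag F r f * X - X * rowDiag F r f) s t =
      (((f s.1 + 2 * (s.2 : ℕ)) - (f t.1 + 2 * (t.2 : ℕ)) : ℤ) : F) * X s t := by
  rw [rowDiag, Matrix.sub_apply, diagonal_mul, mul_diagonal]
  push_cast
  ring

theorem rowDiag_shiftMatrix (f : J → ℤ) :
    rowDiag F r f * shiftMatrix F r - shiftMatrix F r * rowDiag F r f =
      (2 : F) • shiftMatrix F r := by
  ext s t
  rw [rowDiag_commutator_apply]
  simp only [shiftMatrix, of_apply, Matrix.smul_apply, smul_eq_mul]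
  split_ifs with h
  · rw [congrArg f h.1, h.2]
    push_cast
    ring
  · simp

variable [CharZero F]

/-- The centralizer of the shift has no components of negative degree if for any two rows one of
the two ends of the first is not to the right of the corresponding end of the second. -/
theorem eq_zero_of_commute_shiftMatrix {f : J → ℤ}
    (hf : ∀ a b, f a ≤ f b ∨ f a + 2 * r a ≤ f b + 2 * r b) {d : ℤ} (hd : d ≤ -1)
    {X : Matrix (Σ j, Fin (r j)) (Σ j, Fin (r j)) F}
    (hX : rowDiag F r f * X - X * rowDiag F r f = (d : F) • X)
    (hcomm : shiftMatrix F r * X = X * shiftMatrix F r) : X = 0 := by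
  have hpow : ∀ k, shiftMatrix F r ^ k * X = X * shiftMatrix F r ^ k := fun k =>
    (show Commute (shiftMatrix F r) X from hcomm).pow_left k
  -- A matrix commuting with the shift is determined by the images of the leftmost boxes. As `e ^ r
  -- a` kills the leftmost box of row `a`, box `s` of row `b` occurs in its image only if `s + r a ≥
  -- r b`; the degree is then `f b + 2 s - f a`, and `hf` makes it nonnegative.
  have h0 : ∀ a (ha : 0 < r a), X *ᵥ Pi.single ⟨a, ⟨0, ha⟩⟩ 1 = 0 := by
    intro a ha
    ext ⟨b, s⟩
    by_contra hne
    simp only [mulVec_single_one, Pi.zero_apply] at hne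
    change X ⟨b, s⟩ ⟨a, ⟨0, ha⟩⟩ ≠ 0 at hne
    have h1 := congrFun (congrFun hX ⟨b, s⟩) ⟨a, ⟨0, ha⟩⟩
    rw [rowDiag_commutator_apply, Matrix.smul_apply, smul_eq_mul] at h1
    have h2 : (f b + 2 * (s : ℕ)) - (f a + 2 * (0 : ℕ)) = d := by
      exact_mod_cast mul_right_cancel₀ hne h1
    have h3 : ¬ (s : ℕ) + r a < r b := by
      intro h3
      have h4 : (shiftMatrix F r ^ r a *ᵥ (X *ᵥ Pi.single ⟨a, ⟨0, ha⟩⟩ 1)) ⟨b, ⟨s + r a, h3⟩⟩ =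
          0 := by
        rw [mulVec_mulVec, hpow, ← mulVec_mulVec, shiftMatrix_pow_mulVec_single_eq_zero,
          mulVec_zero, Pi.zero_apply]
      rw [shiftMatrix_pow_mulVec_apply, dif_pos (by simp)] at h4
      simp only [mulVec_single_one, Nat.add_sub_cancel] at h4
      exact hne h4
    rcases hf a b with h | h <;> push_cast at h2 <;> omega
  ext s ⟨a, i⟩
  have h1 := congrFun (congrArg (X *ᵥ ·) (shiftMatrix_pow_mulVec_single (F := F) a i i.2)) s
  simp only [mulVec_mulVec, ← hpow] at h1
  rw [← mulVec_mulVec, h0, mulVec_zero] at h1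
  simp only [mulVec_single_one] at h1
  exact h1.symm

/-- If the centralizer of the shift has no components of negative degree then for any two rows one
of the two ends of the first is not to the right of the corresponding end of the second. -/
theorem le_or_le_of_centralizer {f : J → ℤ} (hr : ∀ j, 0 < r j)
    (h : ∀ d : ℤ, d ≤ -1 → ∀ X : Matrix (Σ j, Fin (r j)) (Σ j, Fin (r j)) F,
      rowDiag F r f * X - X * rowDiag F r f = (d : F) • X →
      shiftMatrix F r * X = X * shiftMatrix F r → X = 0) (a b : J) :
    f a ≤ f b ∨ f a + 2 * r a ≤ f b + 2 * r b := by
  by_contra! hcon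
  have ha := hr a
  have hb := hr b
  -- This is the map of lowest degree from row `a` to row `b` that commutes with the shift.
  -- Truncated subtraction matters: the offset is `0` when row `b` is not longer than row `a`.
  let X : Matrix (Σ j, Fin (r j)) (Σ j, Fin (r j)) F := Matrix.of fun s u =>
    if s.1 = b ∧ u.1 = a ∧ (s.2 : ℕ) = u.2 + (r b - r a) then 1 else 0
  have hXe : ∀ s u, X s u =
    if s.1 = b ∧ u.1 = a ∧ (s.2 : ℕ) = u.2 + (r b - r a) then 1 else 0 := fun _ _ => rfl
  have h1 := h (f b - f a + 2 * (r b - r a : ℕ)) (by omega) X (by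
    ext s u
    rw [rowDiag_commutator_apply, Matrix.smul_apply, smul_eq_mul, hXe]
    split_ifs with hc
    · obtain ⟨h1, h2, h3⟩ := hc
      rw [congrArg f h1, congrArg f h2, h3]
      push_cast
      ring
    · simp) (by
    ext ⟨j, s⟩ ⟨i, u⟩
    rw [shiftMatrix_mul_apply, mul_shiftMatrix_apply]
    by_cases hji : j = b ∧ i = a
    · obtain ⟨rfl, rfl⟩ := hji
      have := s.2
      have := u.2
      simp only [hXe, true_and]
      split_ifs <;> first | rfl | (exfalso; omega)
    · have h1 : ∀ s u, X ⟨j, s⟩ ⟨i, u⟩ = 0 := fun s u => by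
        rw [hXe, if_neg]
        rintro ⟨h1, h2, -⟩
        exact hji ⟨h1, h2⟩
      simp only [h1]
      split_ifs <;> rfl)
  have h2 := congrFun (congrFun h1 ⟨b, ⟨r b - r a, by omega⟩⟩) ⟨a, ⟨0, ha⟩⟩
  rw [hXe, if_pos (by simp)] at h2
  exact one_ne_zero h2

end Shift

/-! ### Homogeneous Jordan bases -/

section JordanBasis

open Matrix

/-- A spanning set of `R → F` contains a spanning family indexed by `R`. -/
theorem exists_family_span_eq_top {F R : Type*} [Field F] [Finite R] {S : Set (R → F)}
    (hS : Submodule.span F S = ⊤) :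
    ∃ v : R → R → F, (∀ i, v i ∈ S) ∧ Submodule.span F (Set.range v) = ⊤ := by
  classical
  have := Fintype.ofFinite R
  obtain ⟨b, hbS, hb, hli⟩ := exists_linearIndependent F S
  let B : Module.Basis b F (R → F) := Module.Basis.mk hli (by
    rw [Subtype.range_coe, hb, hS])
  let φ := (Pi.basisFun F R).indexEquiv B
  refine ⟨fun i => (φ i : R → F), fun i => hbS (φ i).2, ?_⟩
  rw [show Set.range (fun i => (φ i : R → F)) = b by
    ext x
    constructor
    · rintro ⟨i, rfl⟩; exact (φ i).2
    · intro hx; exact ⟨φ.symm ⟨x, hx⟩, by simp⟩, hb, hS]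

variable {F J : Type*} [Field F] [DecidableEq J] [Fintype J] {r : J → ℕ}

/-- The vectors of parity `a` killed by the `k`-th power of the shift. -/
def homogeneousKer (F : Type*) [Field F] (r : J → ℕ) (π : J → ZMod 2) (k : ℕ) (a : ZMod 2) :
    Submodule F ((Σ j, Fin (r j)) → F) where
  carrier := {w | shiftMatrix F r ^ k *ᵥ w = 0 ∧ ∀ b, π b.1 ≠ a → w b = 0}
  zero_mem' := ⟨mulVec_zero _, fun _ _ => rfl⟩
  add_mem' := fun h1 h2 => ⟨by rw [mulVec_add, h1.1, h2.1, add_zero], fun b hb => by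
    rw [Pi.add_apply, h1.2 b hb, h2.2 b hb, add_zero]⟩
  smul_mem' := fun c w h => ⟨by rw [mulVec_smul, h.1, smul_zero], fun b hb => by
    rw [Pi.smul_apply, h.2 b hb, smul_zero]⟩

/-- A power `e ^ k` raises eigenvalues of `H` by `2 k`. Hence `H` preserves the kernel of `e ^ k`,
and the whole `e`-string of an eigenvector consists of eigenvectors. -/
theorem mul_shiftMatrix_pow {H : Matrix (Σ j, Fin (r j)) (Σ j, Fin (r j)) F}
    (hH : H * shiftMatrix F r - shiftMatrix F r * H = (2 : F) • shiftMatrix F r) (k : ℕ) :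
    H * shiftMatrix F r ^ k = shiftMatrix F r ^ k * H + (2 * k : F) • shiftMatrix F r ^ k := by
  induction k with
  | zero => simp
  | succ k ih =>
    rw [sub_eq_iff_eq_add] at hH
    rw [pow_succ, ← mul_assoc, ih, add_mul, mul_assoc, hH, mul_add, smul_mul_assoc, mul_smul_comm,
      ← mul_assoc]
    push_cast
    module

variable [CharZero F]

/-- The kernel of `e ^ k` in parity `a` is `H`-stable, hence spanned by eigenvectors, and it
contains the leftmost boxes of the rows of length `k` and parity `a`. Reading off the coordinates at
these boxes is therefore onto, and enough eigenvectors can be selected to serve as new leftmost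
vectors. -/
theorem exists_eigenvectors_homogeneousKer (hr : ∀ j, 0 < r j) (π : J → ZMod 2)
    {H : Matrix (Σ j, Fin (r j)) (Σ j, Fin (r j)) F}
    (hH : H * shiftMatrix F r - shiftMatrix F r * H = (2 : F) • shiftMatrix F r)
    (hpar : ∀ s t, π s.1 ≠ π t.1 → H s t = 0)
    (htop : ⨆ j : ℤ, Module.End.eigenspace (toLin' H) (j : F) = ⊤) (k : ℕ) (a : ZMod 2) :
    ∃ u : {j // r j = k ∧ π j = a} → (Σ j, Fin (r j)) → F,
      (∀ j, u j ∈ homogeneousKer F r π k a ∧ ∃ c : ℤ, H *ᵥ u j = (c : F) • u j) ∧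
      Submodule.span F (Set.range fun j => fun i : {j // r j = k ∧ π j = a} =>
        u j ⟨i.1, ⟨0, hr i.1⟩⟩) = ⊤ := by
  let K := homogeneousKer F r π k a
  let q : ((Σ j, Fin (r j)) → F) →ₗ[F] ({j // r j = k ∧ π j = a} → F) :=
    LinearMap.pi fun i => LinearMap.proj ⟨i.1, ⟨0, hr i.1⟩⟩
  have hinv : ∀ w ∈ K, toLin' H w ∈ K := by
    rintro w ⟨h1, h2⟩
    refine ⟨?_, fun b hb => ?_⟩
    · have h3 := congrArg (· *ᵥ w) (mul_shiftMatrix_pow hH k)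
      simp only [← mulVec_mulVec, add_mulVec, smul_mulVec, h1, mulVec_zero, smul_zero,
        add_zero] at h3
      rw [toLin'_apply, ← h3]
    · rw [toLin'_apply, mulVec, dotProduct]
      refine Finset.sum_eq_zero fun t _ => ?_
      by_cases ht : π t.1 = a
      · rw [hpar b t (by rwa [ht]), zero_mul]
      · rw [h2 t ht, mul_zero]
  have hspan : Submodule.span F (q '' {w | w ∈ K ∧ ∃ c : ℤ, H *ᵥ w = (c : F) • w}) = ⊤ := by
    have h1 : K ≤ Submodule.span F {w | w ∈ K ∧ ∃ c : ℤ, H *ᵥ w = (c : F) • w} := by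
      refine (le_iSup_inf_intEigenspace htop hinv).trans (iSup_le fun c w hw => ?_)
      exact Submodule.subset_span ⟨hw.1, c, by
        simpa using Module.End.mem_eigenspace_iff.1 hw.2⟩
    rw [Submodule.span_image, eq_top_iff]
    refine le_trans ?_ (Submodule.map_mono h1)
    intro y _
    refine ⟨∑ i, y i • Pi.single ⟨i.1, ⟨0, hr i.1⟩⟩ 1, Submodule.sum_mem _ fun i _ =>
      Submodule.smul_mem _ _ ⟨?_, fun b hb => ?_⟩, ?_⟩
    · exact (congrArg (fun k => shiftMatrix F r ^ k *ᵥ _) i.2.1).symm.trans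
        (shiftMatrix_pow_mulVec_single_eq_zero (F := F) i.1 (hr i.1))
    · rw [Pi.single_apply, if_neg]
      rintro rfl
      exact hb i.2.2
    · ext i
      simp only [q, LinearMap.pi_apply, LinearMap.proj_apply, Finset.sum_apply, Pi.smul_apply,
        smul_eq_mul]
      rw [Finset.sum_eq_single i]
      · simp
      · intro i' _ hne
        rw [Pi.single_apply, if_neg, mul_zero]
        intro h
        exact hne (Subtype.ext (congrArg Sigma.fst h).symm)
      · simp
  obtain ⟨v, hv, hvs⟩ := exists_family_span_eq_top hspan
  choose u hu huv using hv
  refine ⟨u, hu, ?_⟩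
  rw [← hvs]
  congr 2
  ext j : 1
  exact huv j

/-- An even diagonalizable matrix `H` with integer eigenvalues such that `[H, e] = 2 e`, where `e`
is in Jordan form, is diagonalized by a change of basis which fixes `e`. -/
theorem exists_conj_rowDiag (hr : ∀ j, 0 < r j) (π : J → ZMod 2)
    {H : Matrix (Σ j, Fin (r j)) (Σ j, Fin (r j)) F}
    (hH : H * shiftMatrix F r - shiftMatrix F r * H = (2 : F) • shiftMatrix F r)
    (hpar : ∀ s t, π s.1 ≠ π t.1 → H s t = 0)
    (htop : ⨆ j : ℤ, Module.End.eigenspace (toLin' H) (j : F) = ⊤) :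
    ∃ (G : Matrix (Σ j, Fin (r j)) (Σ j, Fin (r j)) F) (f : J → ℤ), IsUnit G ∧
      (∀ s t, π s.1 ≠ π t.1 → G s t = 0) ∧ shiftMatrix F r * G = G * shiftMatrix F r ∧
      H * G = G * rowDiag F r f := by
  choose u' hu' hspan' using exists_eigenvectors_homogeneousKer hr π hH hpar htop
  let u : J → (Σ j, Fin (r j)) → F := fun j => u' (r j) (π j) ⟨j, rfl, rfl⟩
  have hu : ∀ j, u j ∈ homogeneousKer F r π (r j) (π j) := fun j => (hu' _ _ _).1
  have hu'' : ∀ k a (j : {j // r j = k ∧ π j = a}), u' k a j = u j.1 := by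
    rintro _ _ ⟨j, rfl, rfl⟩; rfl
  have hf : ∀ j, ∃ c : ℤ, H *ᵥ u j = (c : F) • u j := fun j => (hu' _ _ _).2
  choose f hf using hf
  have hzero : ∀ j k, r j ≤ k → shiftMatrix F r ^ k *ᵥ u j = 0 := by
    intro j k hk
    rw [← Nat.sub_add_cancel hk, pow_add, ← mulVec_mulVec, (hu j).1, mulVec_zero]
  let G : Matrix (Σ j, Fin (r j)) (Σ j, Fin (r j)) F :=
    Matrix.of fun s t => (shiftMatrix F r ^ (t.2 : ℕ) *ᵥ u t.1) s
  have hG : ∀ s t, G s t = (shiftMatrix F r ^ (t.2 : ℕ) *ᵥ u t.1) s := fun _ _ => rfl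
  have hmulG : ∀ (M : Matrix (Σ j, Fin (r j)) (Σ j, Fin (r j)) F) s t,
      (M * G) s t = (M *ᵥ (shiftMatrix F r ^ (t.2 : ℕ) *ᵥ u t.1)) s := fun _ _ _ => rfl
  let U : Submodule F ((Σ j, Fin (r j)) → F) :=
    Submodule.span F (Set.range fun x : J × ℕ => shiftMatrix F r ^ x.2 *ᵥ u x.1)
  have hUmem : ∀ j k, shiftMatrix F r ^ k *ᵥ u j ∈ U := fun j k =>
    Submodule.subset_span ⟨(j, k), rfl⟩
  have hUE : ∀ w ∈ U, ∀ k, shiftMatrix F r ^ k *ᵥ w ∈ U := by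
    intro w hw k
    induction hw using Submodule.span_induction with
    | mem x hx =>
      obtain ⟨x, rfl⟩ := hx
      simp only [mulVec_mulVec, ← pow_add]
      exact hUmem _ _
    | zero => rw [mulVec_zero]; exact Submodule.zero_mem _
    | add x y _ _ h1 h2 => rw [mulVec_add]; exact Submodule.add_mem _ h1 h2
    | smul c x _ h => rw [mulVec_smul]; exact Submodule.smul_mem _ _ h
  -- A Nakayama argument: the span `U` of the strings `e ^ i u j` is stable under the nilpotent `e`,
  -- so it is everything once `U` and the image of `e` together are.
  let V := U ⊔ LinearMap.range (toLin' (shiftMatrix F r))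
  have hsum : ∀ w : (Σ j, Fin (r j)) → F, (∀ b, w b ≠ 0 → (Pi.single b 1 : _ → F) ∈ V) →
      w ∈ V := by
    intro w hw
    have h1 : w = ∑ b, w b • (Pi.single b 1 : (Σ j, Fin (r j)) → F) := by
      ext b
      simp [Finset.sum_apply, Pi.single_apply]
    rw [h1]
    refine Submodule.sum_mem _ fun b _ => ?_
    by_cases hb : w b = 0
    · rw [hb, zero_smul]; exact Submodule.zero_mem _
    · exact Submodule.smul_mem _ _ (hw b hb)
  have hright : ∀ j (i : Fin (r j)), (i : ℕ) ≠ 0 →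
      (Pi.single ⟨j, i⟩ 1 : (Σ j, Fin (r j)) → F) ∈ V := by
    intro j i hi
    refine Submodule.mem_sup_right
      ⟨shiftMatrix F r ^ ((i : ℕ) - 1) *ᵥ Pi.single ⟨j, ⟨0, hr j⟩⟩ 1, ?_⟩
    rw [toLin'_apply, mulVec_mulVec, ← pow_succ', Nat.sub_add_cancel (by omega)]
    exact shiftMatrix_pow_mulVec_single j i i.2
  have hfirst : ∀ k j, r j = k → (Pi.single ⟨j, ⟨0, hr j⟩⟩ 1 : (Σ j, Fin (r j)) → F) ∈ V := by
    intro k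
    induction k using Nat.strong_induction_on with
    | _ k ih =>
      intro j₀ hj₀
      obtain ⟨w, hwU, hwK, hw⟩ : ∃ w ∈ U, w ∈ homogeneousKer F r π k (π j₀) ∧
          ∀ j, r j = k → π j = π j₀ → w ⟨j, ⟨0, hr j⟩⟩ = if j = j₀ then 1 else 0 := by
        have h1 : (Pi.single ⟨j₀, hj₀, rfl⟩ 1 : {j // r j = k ∧ π j = π j₀} → F) ∈
          Submodule.span F (Set.range fun j => fun i : {j // r j = k ∧ π j = π j₀} =>
            u' k (π j₀) j ⟨i.1, ⟨0, hr i.1⟩⟩) := by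
          rw [hspan']; exact Submodule.mem_top
        obtain ⟨c, hc⟩ := (Submodule.mem_span_range_iff_exists_fun F).1 h1
        refine ⟨∑ i, c i • u' k (π j₀) i, Submodule.sum_mem _ fun i _ =>
          Submodule.smul_mem _ _ ?_, Submodule.sum_mem _ fun i _ =>
          Submodule.smul_mem _ _ (hu' _ _ _).1, fun j h2 h3 => ?_⟩
        · rw [hu'']; simpa using hUmem i.1 0
        · have := congrFun hc ⟨j, h2, h3⟩
          simp only [Finset.sum_apply, Pi.smul_apply, Pi.single_apply, Subtype.mk.injEq] at this ⊢
          exact this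
      -- Among leftmost boxes, the difference involves only those of shorter rows, which lie in `V`
      -- by induction. Rows of the same length are excluded by the choice of `w` or by parity. For a
      -- longer row the leftmost coordinate of `w` is the `k`-th coordinate of `e ^ k w = 0`. All
      -- other boxes are in the image of `e`.
      have hy : w - Pi.single ⟨j₀, ⟨0, hr j₀⟩⟩ 1 ∈ V := by
        refine hsum _ ?_
        rintro ⟨j, i⟩ hb
        by_cases hi : (i : ℕ) = 0
        · obtain rfl : i = ⟨0, hr j⟩ := Fin.ext hi
          rcases lt_or_ge (r j) k with hjk | hjk
          · exact ih (r j) hjk j rfl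
          · exfalso
            apply hb
            rw [Pi.sub_apply, Pi.single_apply, sub_eq_zero]
            by_cases hπ : π j = π j₀
            · rcases hjk.eq_or_lt with hjk | hjk
              · rw [hw j hjk.symm hπ]
                by_cases h : j = j₀
                · subst h; simp
                · rw [if_neg h, if_neg (fun h' => h (congrArg Sigma.fst h'))]
              · have h1 := congrFun hwK.1 ⟨j, ⟨k, hjk⟩⟩
                rw [shiftMatrix_pow_mulVec_apply, dif_pos le_rfl] at h1
                simp only [Nat.sub_self, Pi.zero_apply] at h1
                rw [h1, if_neg]
                intro h'
                obtain rfl : j = j₀ := congrArg Sigma.fst h'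
                omega
            · rw [hwK.2 _ hπ, if_neg]
              intro h'
              exact hπ (congrArg (fun b => π b.1) h')
        · exact hright j i hi
      have := Submodule.sub_mem _ (Submodule.mem_sup_left hwU : w ∈ V) hy
      rwa [sub_sub_cancel] at this
  have hV : V = ⊤ := by
    rw [eq_top_iff]
    intro w _
    refine hsum w ?_
    rintro ⟨j, i⟩ -
    by_cases hi : (i : ℕ) = 0
    · obtain rfl : i = ⟨0, hr j⟩ := Fin.ext hi
      exact hfirst _ j rfl
    · exact hright j i hi
  have hU : U = ⊤ := by
    have h1 : ∀ k, ∀ w, ∃ v ∈ U, ∃ w', w = v + shiftMatrix F r ^ k *ᵥ w' := by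
      intro k
      induction k with
      | zero => exact fun w => ⟨0, Submodule.zero_mem _, w, by simp⟩
      | succ k ih =>
        intro w
        obtain ⟨v, hv, w', rfl⟩ := ih w
        obtain ⟨v', hv', _, ⟨w'', rfl⟩, rfl⟩ := Submodule.mem_sup.1
          (hV ▸ Submodule.mem_top : w' ∈ V)
        refine ⟨v + shiftMatrix F r ^ k *ᵥ v', Submodule.add_mem _ hv (hUE _ hv' k), w'', ?_⟩
        rw [mulVec_add, toLin'_apply, mulVec_mulVec, ← pow_succ, add_assoc]
    rw [eq_top_iff]
    intro w _
    obtain ⟨v, hv, w', rfl⟩ := h1 (∑ j, r j) w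
    suffices shiftMatrix F r ^ (∑ j, r j) *ᵥ w' = 0 by rwa [this, add_zero]
    ext ⟨j, s⟩
    rw [shiftMatrix_pow_mulVec_apply, dif_neg]
    · rfl
    · have := Finset.single_le_sum (f := r) (fun _ _ => Nat.zero_le _) (Finset.mem_univ j)
      omega
  refine ⟨G, f, ?_, ?_, ?_, ?_⟩
  · rw [← mulVec_surjective_iff_isUnit]
    have : LinearMap.range (toLin' G) = ⊤ := by
      rw [eq_top_iff, ← hU]
      refine Submodule.span_le.2 ?_
      rintro _ ⟨⟨j, k⟩, rfl⟩
      by_cases hk : k < r j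
      · refine ⟨Pi.single ⟨j, ⟨k, hk⟩⟩ 1, ?_⟩
        rw [toLin'_apply, mulVec_single_one]
        rfl
      · simp only [hzero j k (by omega)]
        exact Submodule.zero_mem _
    exact LinearMap.range_eq_top.1 this
  · rintro s ⟨j, i⟩ hst
    obtain ⟨b, s⟩ := s
    rw [hG, shiftMatrix_pow_mulVec_apply]
    split_ifs
    · exact (hu j).2 _ hst
    · rfl
  · ext s ⟨j, i⟩
    rw [hmulG, mul_shiftMatrix_apply, mulVec_mulVec, ← pow_succ']
    split_ifs with h
    · rfl
    · simp only
      rw [hzero j (i + 1) (by omega), Pi.zero_apply]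
  · ext s ⟨j, i⟩
    have h1 := congrFun (congrArg (· *ᵥ u j) (mul_shiftMatrix_pow hH i)) s
    simp only [← mulVec_mulVec, add_mulVec, smul_mulVec, hf, mulVec_smul] at h1
    rw [hmulG, h1, rowDiag, mul_diagonal, hG]
    simp only [Pi.add_apply, Pi.smul_apply, smul_eq_mul]
    push_cast
    ring

end JordanBasis

/-! ### Pyramids and good gradings of `gl(m|n)` -/

namespace Pyramid

open Matrix

section Rows

variable {m n : ℕ} (p : Nat.Partition m) (q : Nat.Partition n)

/-- The length of a row of a pyramid in `Pyr p q`. -/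
abbrev rowLen (j : Fin (rows p q).length) : ℕ := ((rows p q).get j).1

/-- The parity of a row of a pyramid in `Pyr p q`. -/
abbrev rowParity (j : Fin (rows p q).length) : ZMod 2 := ((rows p q).get j).2

theorem rowLen_pos (j : Fin (rows p q).length) : 0 < rowLen p q j := by
  have key : ∀ x ∈ rows p q, 0 < x.1 := by
    intro x hx
    rw [rows, Multiset.mem_sort, Multiset.mem_add, Multiset.mem_map, Multiset.mem_map] at hx
    rcases hx with ⟨a, ha, rfl⟩ | ⟨a, ha, rfl⟩
    · exact p.parts_pos ha
    · exact q.parts_pos ha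
  exact key _ (List.get_mem _ _)

theorem rowLen_le {i j : Fin (rows p q).length} (h : i < j) : rowLen p q j ≤ rowLen p q i := by
  have hs : (rows p q).Pairwise RowLE := Multiset.pairwise_sort _ _
  have := List.pairwise_iff_get.1 hs i j h
  unfold RowLE at this
  unfold rowLen
  omega

variable {p q}

/-- The right end of a row is `l = f + 2 (r - 1)`; working with `f + 2 r = l + 2` leaves comparisons
of right ends unchanged and avoids subtraction in `ℕ`. -/
theorem first_le_and_le {P : Pyramid (rows p q).length} (hP : P ∈ Pyr p q)
    {i j : Fin (rows p q).length} (h : i ≤ j) :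
    P.first i ≤ P.first j ∧
      P.first j + 2 * rowLen p q j ≤ P.first i + 2 * rowLen p q i := by
  have key : ∀ k : ℕ, ∀ i j : Fin (rows p q).length, (j : ℕ) = i + k →
      P.first i ≤ P.first j ∧
        P.first j + 2 * rowLen p q j ≤ P.first i + 2 * rowLen p q i := by
    intro k
    induction k with
    | zero =>
      intro i j hij
      obtain rfl : j = i := Fin.ext (by omega)
      exact ⟨le_rfl, le_rfl⟩
    | succ k ih =>
      intro i j hij
      have := j.2
      obtain ⟨h1, h2⟩ := ih i ⟨i + k, by omega⟩ rfl
      obtain ⟨h3, -, h4⟩ := P.nested ⟨i + k, by omega⟩ j (by simp; omega)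
      rw [hP.1, hP.1] at h4
      constructor <;> [skip; unfold rowLen at *] <;> omega
  exact key (j - i) i j (by have : (i : ℕ) ≤ j := h; omega)

theorem first_le_or_le {P : Pyramid (rows p q).length} (hP : P ∈ Pyr p q)
    (a b : Fin (rows p q).length) :
    P.first a ≤ P.first b ∨
      P.first a + 2 * rowLen p q a ≤ P.first b + 2 * rowLen p q b := by
  rcases le_total a b with h | h
  · exact Or.inl (first_le_and_le hP h).1
  · exact Or.inr (first_le_and_le hP h).2

/-- Rows which are nested up to the position of the bottom row form a pyramid. -/
theorem exists_pyramid {f : Fin (rows p q).length → ℤ}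
    (hf : ∀ a b, f a ≤ f b ∨ f a + 2 * rowLen p q a ≤ f b + 2 * rowLen p q b) :
    ∃ P ∈ Pyr p q, ∃ c : ℤ, ∀ j, P.first j = f j - c := by
  -- The translation `c` is the centre of the bottom row; without rows any value does.
  obtain ⟨c, hc⟩ : ∃ c : ℤ, ∀ j : Fin (rows p q).length, (j : ℕ) = 0 →
      c = f j + rowLen p q j - 1 := by
    by_cases h : 0 < (rows p q).length
    · refine ⟨f ⟨0, h⟩ + rowLen p q ⟨0, h⟩ - 1, fun j hj => ?_⟩
      obtain rfl : j = ⟨0, h⟩ := Fin.ext hj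
      rfl
    · exact ⟨0, fun j _ => absurd j.2 (by omega)⟩
  refine ⟨⟨fun j => f j - c, rowLen p q, rowLen_pos p q, fun b => rowParity p q b.1, ?_, ?_⟩,
    ⟨fun _ => rfl, fun _ => rfl⟩, c, fun _ => rfl⟩
  · intro j hj
    have := hc j hj
    omega
  · intro i j hij
    have h1 := rowLen_le p q (show i < j from Fin.lt_def.2 (by omega))
    have h2 := rowLen_pos p q j
    -- Row `j` is not longer than row `i`, so comparing right ends in the first alternative already
    -- gives `f i ≤ f j`, and comparing left ends in the second already gives the inequality of
    -- right ends.
    rcases hf i j with h3 | h3 <;> rcases hf j i with h4 | h4 <;>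
      refine ⟨?_, ?_, ?_⟩ <;> omega

end Rows

/-! ### From boxes to `gl(m|n)`: classification of the good gradings -/

section Transport

variable {F : Type*} [Field F] {m n : ℕ} {p : Nat.Partition m} {q : Nat.Partition n}

/-- Matrices indexed by boxes as elements of `gl(m|n)`. -/
def boxEquiv (F : Type*) [Field F] (σ : Labelling p q) :
    Matrix (Box p q) (Box p q) F ≃ₐ[F] Mat F m n :=
  Matrix.reindexAlgEquiv F F σ.toEquiv

theorem boxEquiv_shiftMatrix (σ : Labelling p q) :
    boxEquiv F σ (shiftMatrix F (rowLen p q)) = ePQ F σ := rfl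

theorem boxEquiv_rowDiag (σ : Labelling p q) (P : Pyramid (rows p q).length) :
    boxEquiv F σ (rowDiag F (rowLen p q) P.first) = hP F σ P :=
  Matrix.submatrix_diagonal_equiv
    (fun b : Box p q => ((P.first b.1 + 2 * (b.2 : ℕ) : ℤ) : F)) σ.toEquiv.symm

theorem boxEquiv_mem_even (σ : Labelling p q) {X : Matrix (Box p q) (Box p q) F} :
    boxEquiv F σ X ∈ matParity F m n 0 ↔
      ∀ s t, rowParity p q s.1 ≠ rowParity p q t.1 → X s t = 0 := by
  have hne : ∀ a b : ZMod 2, a + b ≠ 0 ↔ a ≠ b := by decide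
  constructor
  · intro h s t hst
    have := h (σ.toEquiv s) (σ.toEquiv t) (by rwa [σ.parity_eq, σ.parity_eq, hne])
    simpa [boxEquiv] using this
  · intro h s t hst
    refine h _ _ ?_
    rw [hne, ← σ.toEquiv.apply_symm_apply s, ← σ.toEquiv.apply_symm_apply t, σ.parity_eq,
      σ.parity_eq] at hst
    exact hst

theorem ePQ_mem_even (σ : Labelling p q) : ePQ F σ ∈ matParity F m n 0 := by
  rw [← boxEquiv_shiftMatrix, boxEquiv_mem_even]
  intro s t hst
  simp only [shiftMatrix, of_apply]
  rw [if_neg]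
  rintro ⟨h, -⟩
  exact hst (by rw [h])

theorem hP_mem_even (σ : Labelling p q) (P : Pyramid (rows p q).length) :
    hP F σ P ∈ matParity F m n 0 := diagonal_mem_matParity _

theorem adGrading_add_smul_one (H : Mat F m n) (c : F) :
    (gl F m n).adGrading (H + c • 1) = (gl F m n).adGrading H := by
  have : (gl F m n).bracket (H + c • 1) = (gl F m n).bracket H := by
    ext1 x
    rw [map_add, LinearMap.add_apply, gl_bracket_smul_one_left, add_zero]
  funext j
  rw [adGrading, this, adGrading]

theorem iSup_adGrading_diagonal (d : Fin m ⊕ Fin n → ℤ) :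
    ⨆ j : ℤ, (gl F m n).adGrading (diagonal fun s => (d s : F)) j = ⊤ := by
  rw [eq_top_iff]
  intro x _
  rw [matrix_eq_sum_single x]
  refine Submodule.sum_mem _ fun s _ => Submodule.sum_mem _ fun t _ =>
    Submodule.mem_iSup_of_mem (d s - d t) ?_
  rw [mem_adGrading_iff (diagonal_mem_matParity _)]
  ext i j
  by_cases h : s = i ∧ t = j
  · obtain ⟨rfl, rfl⟩ := h
    simp
    ring
  · simp [h]

variable [CharZero F]

/-- The grading given by a pyramid is good. -/
theorem isGoodGrading_hP (σ : Labelling p q) {P : Pyramid (rows p q).length} (hPyr : P ∈ Pyr p q) :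
    (gl F m n).IsGoodGrading (ePQ F σ) ((gl F m n).adGrading (hP F σ P)) := by
  refine isGoodGrading_adGrading (hP_mem_even σ P) (ePQ_mem_even σ) (iSup_adGrading_diagonal _)
    ?_ ?_
  · rw [← boxEquiv_rowDiag, ← boxEquiv_shiftMatrix, ← map_mul, ← map_mul, ← map_sub,
      rowDiag_shiftMatrix, map_smul]
  · intro j hj x hx hcomm
    obtain ⟨X, rfl⟩ := (boxEquiv F σ).surjective x
    rw [← boxEquiv_rowDiag, ← map_mul, ← map_mul, ← map_sub, ← map_smul] at hx
    rw [← boxEquiv_shiftMatrix, ← map_mul, ← map_mul] at hcomm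
    rw [eq_zero_of_commute_shiftMatrix (first_le_or_le hPyr) hj ((boxEquiv F σ).injective hx)
      ((boxEquiv F σ).injective hcomm), map_zero]

/-- A good grading given by a conjugate of a matrix which increases in steps of two along the rows
comes from a pyramid. -/
theorem exists_pyramid_of_conj (σ : Labelling p q) {H : Mat F m n} (hH : H ∈ matParity F m n 0)
    (hgood : (gl F m n).IsGoodGrading (ePQ F σ) ((gl F m n).adGrading H)) (g : (Mat F m n)ˣ)
    (hge : (g : Mat F m n) * ePQ F σ = ePQ F σ * g) {f : Fin (rows p q).length → ℤ} {c : F}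
    (hg : H * g = g * (boxEquiv F σ (rowDiag F (rowLen p q) f) + c • 1)) :
    ∃ P ∈ Pyr p q, (gl F m n).adGrading H =
      (gl F m n).adGrading ((g : Mat F m n) * hP F σ P * (↑g⁻¹ : Mat F m n)) := by
  have hg' : H * g - g * boxEquiv F σ (rowDiag F (rowLen p q) f) = c • g := by
    rw [hg, mul_add, add_sub_cancel_left, mul_smul_comm, mul_one]
  obtain ⟨P, hP, a, ha⟩ := exists_pyramid (f := f)
    (le_or_le_of_centralizer (F := F) (rowLen_pos p q) (by
      intro d hd X hX hcomm
      have h1 := congrArg (boxEquiv F σ) hX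
      have h2 := congrArg (boxEquiv F σ) hcomm
      rw [map_sub, map_mul, map_mul, map_smul] at h1
      rw [map_mul, map_mul, boxEquiv_shiftMatrix] at h2
      set h := boxEquiv F σ (rowDiag F (rowLen p q) f)
      set x := boxEquiv F σ X with hx
      have hgH : (↑g⁻¹ : Mat F m n) * H = (h + c • 1) * ↑g⁻¹ := by
        rw [Units.inv_mul_eq_iff_eq_mul, ← mul_assoc, ← hg, Units.mul_inv_cancel_right]
      have hge' : ePQ F σ * (↑g⁻¹ : Mat F m n) = (↑g⁻¹ : Mat F m n) * ePQ F σ := by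
        rw [Units.mul_inv_eq_iff_eq_mul, mul_assoc, ← hge, Units.inv_mul_cancel_left]
      -- Conjugation by `g` fixes `e` and carries the grading of the row-diagonal matrix to that of
      -- `H`, the scalar `c` being invisible to `ad`. So injectivity in negative degrees passes to
      -- the row form.
      have h3 : (g : Mat F m n) * x * (↑g⁻¹ : Mat F m n) ∈ (gl F m n).adGrading H d := by
        rw [mem_adGrading_iff hH]
        calc H * ((g : Mat F m n) * x * (↑g⁻¹ : Mat F m n)) - g * x * (↑g⁻¹ : Mat F m n) * H
            = (H * g) * x * (↑g⁻¹ : Mat F m n) - g * x * ((↑g⁻¹ : Mat F m n) * H) := by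
              noncomm_ring
          _ = g * (h * x - x * h) * (↑g⁻¹ : Mat F m n) := by
              rw [hg, hgH]
              simp only [mul_add, add_mul, mul_smul_comm, smul_mul_assoc, mul_one, one_mul,
                mul_sub, sub_mul, mul_assoc]
              abel
          _ = _ := by rw [h1, mul_smul_comm, smul_mul_assoc]
      have h4 : (g : Mat F m n) * x * (↑g⁻¹ : Mat F m n) = 0 := by
        refine hgood.injOn d hd h3 (Submodule.zero_mem _) ?_
        rw [map_zero, gl_bracket_even_left (ePQ_mem_even σ), mul_assoc _ _ (ePQ F σ), ← hge',
          ← mul_assoc, ← mul_assoc, ← mul_assoc, ← hge, mul_assoc _ (ePQ F σ) x, h2,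
          mul_assoc, mul_assoc, mul_assoc, mul_assoc, sub_self]
      rw [Units.mul_inv_eq_iff_eq_mul, zero_mul, Units.mul_right_eq_zero] at h4
      exact (boxEquiv F σ).injective (h4.trans (map_zero _).symm)))
  refine ⟨P, hP, ?_⟩
  have h1 : Pyramid.hP F σ P = boxEquiv F σ (rowDiag F (rowLen p q) f) - (a : F) • 1 := by
    rw [← boxEquiv_rowDiag, ← map_one (boxEquiv F σ), ← map_smul, ← map_sub]
    congr 1
    rw [rowDiag, rowDiag, smul_one_eq_diagonal, diagonal_sub]
    congr 1
    ext b
    rw [ha]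
    push_cast
    ring
  have h2 : (g : Mat F m n) * Pyramid.hP F σ P * (↑g⁻¹ : Mat F m n) = H + (-(a + c)) • 1 := by
    rw [Units.mul_inv_eq_iff_eq_mul, h1, add_mul, hg]
    simp only [mul_add, mul_sub, mul_smul_comm, smul_mul_assoc, mul_one, one_mul]
    module
  rw [h2, adGrading_add_smul_one]

/-- If all diagonal matrices have degree zero, a good grading is given by a pyramid. -/
theorem exists_pyramid_of_diagonal (σ : Labelling p q) {𝒜 : ℤ → Submodule F (Mat F m n)}
    (h𝒜 : (gl F m n).IsGoodGrading (ePQ F σ) 𝒜)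
    (hdiag : ∀ d : Fin m ⊕ Fin n → F, diagonal d ∈ 𝒜 0) :
    ∃ P ∈ Pyr p q, 𝒜 = (gl F m n).adGrading (hP F σ P) := by
  obtain ⟨H, hH, rfl⟩ := h𝒜.exists_eq_adGrading
  have htop := h𝒜.isGrading.isInternal.submodule_iSup_eq_top
  -- Degree zero of the diagonal idempotents means that `H` commutes with them, hence is diagonal.
  -- Its entries differ by integers, as eigenvalues of `ad H` on matrix units, and the degree of `e`
  -- makes them grow by two along rows.
  obtain ⟨D, rfl⟩ : ∃ D : Fin m ⊕ Fin n → F, H = diagonal D := by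
    refine ⟨fun i => H i i, ?_⟩
    ext i j
    by_cases hij : i = j
    · subst hij; simp
    · have h1 := hdiag (Pi.single i 1)
      rw [mem_adGrading_iff hH, Int.cast_zero, zero_smul] at h1
      have h2 := congrFun (congrFun h1 i) j
      rw [Matrix.sub_apply, mul_diagonal, diagonal_mul] at h2
      simpa [hij, Ne.symm hij] using h2
  have h_int : ∀ s t, ∃ k : ℤ, D s - D t = k := by
    intro s t
    refine exists_int_of_apply_eq_smul htop (x := single s t 1) ?_ ?_
    · intro h
      simpa using congrFun (congrFun h s) t
    · rw [gl_bracket_even_left hH]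
      ext i j
      by_cases h : s = i ∧ t = j
      · obtain ⟨rfl, rfl⟩ := h
        simp
      · simp [h]
  have hstep : ∀ j (i : ℕ) (hi : i < rowLen p q j), D (σ.toEquiv ⟨j, ⟨i, hi⟩⟩) =
      D (σ.toEquiv ⟨j, ⟨0, rowLen_pos p q j⟩⟩) + 2 * i := by
    intro j i
    induction i with
    | zero => intro hi; simp
    | succ i ih =>
      intro hi
      have h1 := (mem_adGrading_iff hH).1 h𝒜.mem_two
      have hi' : i < rowLen p q j := by omega
      have h2 := congrFun (congrFun h1 (σ.toEquiv ⟨j, ⟨i + 1, hi⟩⟩)) (σ.toEquiv ⟨j, ⟨i, hi'⟩⟩)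
      have h3 : ePQ F σ (σ.toEquiv ⟨j, ⟨i + 1, hi⟩⟩) (σ.toEquiv ⟨j, ⟨i, hi'⟩⟩) = 1 := by
        change shiftMatrix F (rowLen p q) (σ.toEquiv.symm _) (σ.toEquiv.symm _) = 1
        rw [Equiv.symm_apply_apply, Equiv.symm_apply_apply]
        simp [shiftMatrix]
      rw [Matrix.sub_apply, mul_diagonal, diagonal_mul, Matrix.smul_apply, h3, ih hi', smul_eq_mul]
        at h2
      push_cast at h2 ⊢
      linear_combination h2
  obtain ⟨c, f, hf⟩ : ∃ (c : F) (f : Fin (rows p q).length → ℤ), ∀ j,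
      D (σ.toEquiv ⟨j, ⟨0, rowLen_pos p q j⟩⟩) = f j + c := by
    rcases isEmpty_or_nonempty (Fin m ⊕ Fin n) with hι | ⟨⟨s⟩⟩
    · exact ⟨0, fun _ => 0, fun j => hι.elim (σ.toEquiv ⟨j, ⟨0, rowLen_pos p q j⟩⟩)⟩
    · choose f hf using fun j => h_int (σ.toEquiv ⟨j, ⟨0, rowLen_pos p q j⟩⟩) s
      exact ⟨D s, f, fun j => by rw [← hf]; ring⟩
  obtain ⟨P, hP, h⟩ := exists_pyramid_of_conj σ hH h𝒜 1 (by simp) (f := f) (c := c) (by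
    simp only [Units.val_one, mul_one, one_mul]
    rw [← map_one (boxEquiv F σ), ← map_smul, ← map_add, ← (boxEquiv F σ).symm_apply_eq, rowDiag,
      smul_one_eq_diagonal, diagonal_add]
    refine (Matrix.submatrix_diagonal_equiv _ _).trans ?_
    congr 1
    ext ⟨j, i⟩
    change D (σ.toEquiv ⟨j, i⟩) = _
    rw [show i = ⟨i, i.2⟩ from rfl, hstep j i i.2, hf]
    push_cast
    ring)
  exact ⟨P, hP, by simpa using h⟩

/-- If `ad H` is diagonalizable with integer eigenvalues, then so is `H` up to a scalar. -/
theorem exists_iSup_eigenspace_eq_top [IsAlgClosed F] {H : Mat F m n}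
    (hH : H ∈ matParity F m n 0) (htop : ⨆ j : ℤ, (gl F m n).adGrading H j = ⊤) :
    ∃ c : F, ⨆ j : ℤ, Module.End.eigenspace (toLin' (H - c • 1)) (j : F) = ⊤ := by
  rcases isEmpty_or_nonempty (Fin m ⊕ Fin n) with hι | hι
  · refine ⟨0, eq_top_iff.2 fun w _ => ?_⟩
    rw [Subsingleton.elim w 0]
    exact Submodule.zero_mem _
  obtain ⟨c, hc⟩ := Module.End.exists_eigenvalue (toLin' H)
  obtain ⟨v, hv, hv0⟩ := hc.exists_hasEigenvector
  rw [Module.End.mem_eigenspace_iff, toLin'_apply] at hv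
  refine ⟨c, ?_⟩
  rw [eq_top_iff]
  intro w _
  obtain ⟨k, hk⟩ := Function.ne_iff.1 hv0
  -- Every vector is the image of the eigenvector `v` under some matrix, and a matrix of degree `j`
  -- maps `v` into the `j`-eigenspace of `H - c`.
  have hw : (vecMulVec w (Pi.single k (v k)⁻¹) : Mat F m n) *ᵥ v = w := by
    rw [vecMulVec_mulVec]
    ext i
    simp [inv_mul_cancel₀ hk]
  have key : ∀ x ∈ ⨆ j : ℤ, (gl F m n).adGrading H j,
      x *ᵥ v ∈ ⨆ j : ℤ, Module.End.eigenspace (toLin' (H - c • 1)) (j : F) := by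
    intro x hx
    induction hx using Submodule.iSup_induction' with
    | mem j x hx =>
      refine Submodule.mem_iSup_of_mem j ?_
      rw [mem_adGrading_iff hH, sub_eq_iff_eq_add] at hx
      rw [Module.End.mem_eigenspace_iff, toLin'_apply, mulVec_mulVec, sub_mul, hx, sub_mulVec,
        add_mulVec, ← mulVec_mulVec, hv, mulVec_smul, smul_mul_assoc, one_mul, smul_mulVec,
        smul_mulVec, add_sub_cancel_right]
    | zero => rw [zero_mulVec]; exact Submodule.zero_mem _
    | add x y _ _ h1 h2 => rw [add_mulVec]; exact Submodule.add_mem _ h1 h2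
  rw [← hw]
  exact key _ (htop ▸ Submodule.mem_top)

/-- Every good grading comes from a pyramid, up to conjugation by an even matrix which fixes the
nilpotent element. -/
theorem exists_pyramid_conj [IsAlgClosed F] (σ : Labelling p q)
    {𝒜 : ℤ → Submodule F (Mat F m n)} (h𝒜 : (gl F m n).IsGoodGrading (ePQ F σ) 𝒜) :
    ∃ P ∈ Pyr p q, ∃ g : (Mat F m n)ˣ, (g : Mat F m n) ∈ (gl F m n).parity 0 ∧
      (g : Mat F m n) * ePQ F σ * (↑g⁻¹ : Mat F m n) = ePQ F σ ∧
      𝒜 = (gl F m n).adGrading ((g : Mat F m n) * hP F σ P * (↑g⁻¹ : Mat F m n)) := by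
  obtain ⟨H, hH, rfl⟩ := h𝒜.exists_eq_adGrading
  have htop := h𝒜.isGrading.isInternal.submodule_iSup_eq_top
  obtain ⟨c, hc⟩ := exists_iSup_eigenspace_eq_top hH htop
  obtain ⟨B, hB⟩ := (boxEquiv F σ).surjective (H - c • 1)
  have h_two := (mem_adGrading_iff hH).1 h𝒜.mem_two
  obtain ⟨G, f, hGu, hGe, hGc, hGf⟩ := exists_conj_rowDiag (F := F) (rowLen_pos p q)
    (rowParity p q) (H := B)
    (by
      apply (boxEquiv F σ).injective
      rw [map_sub, map_mul, map_mul, map_smul, hB, boxEquiv_shiftMatrix]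
      simp only [sub_mul, mul_sub, smul_mul_assoc, mul_smul_comm, one_mul, mul_one]
      rw [sub_sub_sub_cancel_right, h_two]
      norm_num)
    (by
      rw [← boxEquiv_mem_even σ, hB]
      exact Submodule.sub_mem _ hH (smul_one_mem_matParity c))
    (by
      rw [eq_top_iff]
      intro u _
      have hu : (u ∘ σ.toEquiv.symm) ∈
        ⨆ j : ℤ, Module.End.eigenspace (toLin' (H - c • 1)) (j : F) := hc ▸ Submodule.mem_top
      have : u = (u ∘ σ.toEquiv.symm) ∘ σ.toEquiv := by ext; simp
      rw [this]
      generalize u ∘ σ.toEquiv.symm = w at hu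
      refine Submodule.iSup_induction _ (motive := fun w : Fin m ⊕ Fin n → F =>
        w ∘ σ.toEquiv ∈ ⨆ j : ℤ, Module.End.eigenspace (toLin' B) (j : F)) hu (fun j w hw => ?_)
        (Submodule.zero_mem _) (fun x y h1 h2 => Submodule.add_mem _ h1 h2)
      refine Submodule.mem_iSup_of_mem j ?_
      rw [Module.End.mem_eigenspace_iff, toLin'_apply, ← hB] at hw
      rw [Module.End.mem_eigenspace_iff, toLin'_apply]
      have h1 : boxEquiv F σ B *ᵥ w = (B *ᵥ (w ∘ σ.toEquiv)) ∘ σ.toEquiv.symm :=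
        submatrix_mulVec_equiv B w σ.toEquiv.symm σ.toEquiv.symm
      rw [h1] at hw
      ext b
      have h2 := congrFun hw (σ.toEquiv b)
      simpa using h2)
  have hu := hGu.map (boxEquiv F σ)
  have hge : boxEquiv F σ G * ePQ F σ = ePQ F σ * boxEquiv F σ G := by
    rw [← boxEquiv_shiftMatrix, ← map_mul, ← map_mul, hGc]
  obtain ⟨P, hP, hPe⟩ := exists_pyramid_of_conj σ hH h𝒜 hu.unit hge (f := f) (c := c) (by
    have h1 := congrArg (boxEquiv F σ) hGf
    rw [map_mul, map_mul, hB, sub_mul, sub_eq_iff_eq_add] at h1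
    change H * boxEquiv F σ G = boxEquiv F σ G * _
    rw [h1, mul_add, mul_smul_comm, mul_one, smul_mul_assoc, one_mul])
  refine ⟨P, hP, hu.unit, (boxEquiv_mem_even σ).2 hGe, ?_, hPe⟩
  rw [Units.mul_inv_eq_iff_eq_mul]
  exact hge

end Transport

end Pyramid

/-! ### Good gradings of `sl(m|n)` and `psl(n|n)` -/

section Restriction

variable {F W : Type*} [Field F] [CharZero F] [AddCommGroup W] [Module F W]

theorem iSup_intEigenspace_restrict [FiniteDimensional F W] {f : Module.End F W}
    (ht : ⨆ j : ℤ, f.eigenspace (j : F) = ⊤) {S : Submodule F W} (hS : ∀ x ∈ S, f x ∈ S) :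
    ⨆ j : ℤ, Module.End.eigenspace (LinearMap.restrict f hS) (j : F) = ⊤ := by
  have h1 : ⨆ j : ℤ, S ⊓ f.eigenspace (j : F) ≤
      (⨆ j : ℤ, Module.End.eigenspace (LinearMap.restrict f hS) (j : F)).map S.subtype := by
    rw [Submodule.map_iSup]
    refine iSup_mono fun j x hx => ⟨⟨x, hx.1⟩, ?_, rfl⟩
    exact Module.End.mem_eigenspace_iff.2 (Subtype.ext (Module.End.mem_eigenspace_iff.1 hx.2))
  rw [eq_top_iff]
  intro x _
  obtain ⟨y, hy, hyx⟩ := h1 (le_iSup_inf_intEigenspace ht hS x.2)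
  rwa [← Subtype.ext hyx]

theorem map_mkQ_intEigenspace {f : Module.End F W}
    (ht : ⨆ j : ℤ, f.eigenspace (j : F) = ⊤) {I : Submodule F W} (hI : I ≤ I.comap f) (j : ℤ) :
    (f.eigenspace (j : F)).map I.mkQ = Module.End.eigenspace (I.mapQ I f hI) (j : F) := by
  refine eq_intEigenspace_of_le (ℬ := fun j : ℤ => (f.eigenspace (j : F)).map I.mkQ) ?_ ?_ j
  · rintro j _ ⟨x, hx, rfl⟩
    rw [Module.End.mem_eigenspace_iff]
    have := congrArg I.mkQ (Module.End.mem_eigenspace_iff.1 hx)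
    rw [map_smul] at this
    exact this
  · rw [← Submodule.map_iSup, ht, Submodule.map_top, Submodule.range_mkQ]

end Restriction

/-! ### Restriction to `sl(m|n)` -/

namespace LieSuperalgebra

open Matrix

variable {F : Type*} [Field F] {m n : ℕ}

theorem supertrace_gl_bracket (x y : Mat F m n) :
    supertrace F m n ((gl F m n).bracket x y) = 0 := supertrace_bracket x y

theorem coe_sl_bracket (x y : slSub F m n) :
    ((sl F m n).bracket x y : Mat F m n) = (gl F m n).bracket x y := rfl

theorem psl_bracket_mkQ (x y : slSub F m n) :
    (psl F m n).bracket ((slScalars F m n).mkQ x) ((slScalars F m n).mkQ y) =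
      (slScalars F m n).mkQ ((sl F m n).bracket x y) := rfl

theorem mkQ_eq_mkQ_iff {x y : slSub F m n} :
    (slScalars F m n).mkQ x = (slScalars F m n).mkQ y ↔
      (x : Mat F m n) - y ∈ Submodule.span F {(1 : Mat F m n)} :=
  Submodule.Quotient.eq _

theorem supertrace_blockScalar (a b : F) :
    supertrace F m n (blockScalar F m n a b) = a * m - b * n := by
  rw [blockScalar_eq]
  simp [supertrace]

theorem blockScalar_one_one : blockScalar F m n 1 1 = 1 := by
  rw [blockScalar_eq]; simp

theorem blockScalar_mem_adGrading {H : Mat F m n} (hH : H ∈ matParity F m n 0) (a b : F) :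
    blockScalar F m n a b ∈ (gl F m n).adGrading H 0 := by
  rw [mem_adGrading_iff hH, blockScalar_comm hH]
  simp

theorem smul_one_mem_adGrading {H : Mat F m n} (hH : H ∈ matParity F m n 0) (c : F) :
    c • (1 : Mat F m n) ∈ (gl F m n).adGrading H 0 := by
  rw [← blockScalar_one_one]
  exact Submodule.smul_mem _ _ (blockScalar_mem_adGrading hH 1 1)

theorem trace_odd {x : Mat F m n} (hx : x ∈ matParity F m n 1) : x.trace = 0 := by
  refine Finset.sum_eq_zero fun i _ => hx i i ?_
  rw [CharTwo.add_self_eq_zero]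
  decide

theorem bracket_mem_slSub (H : Mat F m n) :
    ∀ x ∈ slSub F m n, (gl F m n).bracket H x ∈ slSub F m n := fun x _ =>
  supertrace_gl_bracket H x

theorem inducedSl_adGrading (H : Mat F m n) (j : ℤ) :
    inducedSl ((gl F m n).adGrading H) j =
      Module.End.eigenspace (LinearMap.restrict ((gl F m n).bracket H) (bracket_mem_slSub H))
        (j : F) := by
  ext x
  rw [Module.End.mem_eigenspace_iff, Subtype.ext_iff]
  exact Module.End.mem_eigenspace_iff

variable [CharZero F]

theorem mem_slSub_of_mem_adGrading {H x : Mat F m n} {j : ℤ} (hj : j ≠ 0)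
    (hx : x ∈ (gl F m n).adGrading H j) : x ∈ slSub F m n := by
  have h := congrArg (supertrace F m n) (Module.End.mem_eigenspace_iff.1 hx)
  rw [supertrace_gl_bracket, map_smul, eq_comm, smul_eq_mul, mul_eq_zero] at h
  exact h.resolve_left (Int.cast_ne_zero.2 hj)

theorem trace_eq_zero_of_mem_adGrading {H x : Mat F m n} (hH : H ∈ matParity F m n 0) {j : ℤ}
    (hj : j ≠ 0) (hx : x ∈ (gl F m n).adGrading H j) : x.trace = 0 := by
  have h := congrArg Matrix.trace ((mem_adGrading_iff hH).1 hx)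
  rw [trace_sub, trace_mul_comm, sub_self, trace_smul, eq_comm, smul_eq_mul, mul_eq_zero] at h
  exact h.resolve_left (Int.cast_ne_zero.2 hj)

/-- Outside degree zero the supertrace vanishes automatically; in degree zero a block scalar
corrects it. The identity would not do, as its supertrace is zero for `m = n`. Block scalars commute
with `e` and have degree zero for every even `H'`, so restricting to `sl(m|n)` loses no information.
-/
theorem exists_slSub_add_blockScalar {H x : Mat F m n} (hH : H ∈ matParity F m n 0) {j : ℤ}
    (hx : x ∈ (gl F m n).adGrading H j) :
    ∃ y ∈ slSub F m n, y ∈ (gl F m n).adGrading H j ∧ ∃ a b : F, x = y + blockScalar F m n a b ∧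
      ∀ H' ∈ matParity F m n 0, blockScalar F m n a b ∈ (gl F m n).adGrading H' j := by
  by_cases hj : j = 0
  · subst hj
    suffices ∃ a b : F, x - blockScalar F m n a b ∈ slSub F m n by
      obtain ⟨a, b, hab⟩ := this
      exact ⟨_, hab, Submodule.sub_mem _ hx (blockScalar_mem_adGrading hH a b), a, b, by abel,
        fun H' hH' => blockScalar_mem_adGrading hH' a b⟩
    simp only [LinearMap.mem_ker, map_sub, supertrace_blockScalar]
    rcases Nat.eq_zero_or_pos m with rfl | hm
    · rcases Nat.eq_zero_or_pos n with rfl | hn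
      · exact ⟨0, 0, by rw [Subsingleton.elim x 0]; simp⟩
      · have : (n : F) ≠ 0 := Nat.cast_ne_zero.2 hn.ne'
        exact ⟨0, -(supertrace F 0 n x / n), by field_simp; ring⟩
    · have : (m : F) ≠ 0 := Nat.cast_ne_zero.2 hm.ne'
      exact ⟨supertrace F m n x / m, 0, by field_simp; ring⟩
  · have h0 : blockScalar F m n 0 0 = 0 := by rw [blockScalar_eq]; simp
    refine ⟨x, mem_slSub_of_mem_adGrading hj hx, hx, 0, 0, by rw [h0, add_zero], fun _ _ => ?_⟩
    rw [h0]
    exact Submodule.zero_mem _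

theorem isGrading_inducedSl {H : Mat F m n} (hH : H ∈ matParity F m n 0)
    (htop : ⨆ j : ℤ, (gl F m n).adGrading H j = ⊤) :
    (sl F m n).IsGrading (inducedSl ((gl F m n).adGrading H)) := by
  rw [funext (inducedSl_adGrading H)]
  refine isGrading_of_derivation (iSup_intEigenspace_restrict htop (bracket_mem_slSub H))
    (fun x y => ?_) (fun a x hx => ?_)
  · exact Subtype.ext ((gl F m n).bracket_bracket_of_even hH x y)
  · exact (gl F m n).bracket_mem_of_even hH a x hx

section Induced

variable {e : slSub F m n}

theorem isGoodGrading_inducedSl {𝒜 : ℤ → Submodule F (Mat F m n)}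
    (h𝒜 : (gl F m n).IsGoodGrading (e : Mat F m n) 𝒜) :
    (sl F m n).IsGoodGrading e (inducedSl 𝒜) := by
  obtain ⟨H, hH, rfl⟩ := h𝒜.exists_eq_adGrading
  have htop := h𝒜.isGrading.isInternal.submodule_iSup_eq_top
  have he : (e : Mat F m n) ∈ matParity F m n 0 := h𝒜.even
  refine ⟨isGrading_inducedSl hH htop, h𝒜.even, h𝒜.mem_two, ?_, ?_⟩
  · intro j hj x hx y hy hxy
    exact Subtype.ext (h𝒜.injOn j hj hx hy (congrArg Subtype.val hxy))
  · intro j hj y hy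
    obtain ⟨x, hx, hxy⟩ := h𝒜.surjOn j hj hy
    obtain ⟨x', hx', hx'', a, b, rfl, -⟩ := exists_slSub_add_blockScalar hH hx
    refine ⟨⟨x', hx'⟩, hx'', Subtype.ext ?_⟩
    change _ = (y : Mat F m n) at hxy
    rw [← hxy, map_add, coe_sl_bracket, gl_bracket_even_left he (blockScalar F m n a b),
      blockScalar_comm he, sub_self, add_zero]

theorem inducedSl_injOn : Set.InjOn inducedSl {𝒜 | (gl F m n).IsGoodGrading (e : Mat F m n) 𝒜} := by
  have key : ∀ 𝒜 𝒜', (gl F m n).IsGoodGrading (e : Mat F m n) 𝒜 →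
      (gl F m n).IsGoodGrading (e : Mat F m n) 𝒜' → inducedSl 𝒜 = inducedSl 𝒜' →
      ∀ j, 𝒜 j ≤ 𝒜' j := by
    intro 𝒜 𝒜' h h' heq j x hx
    obtain ⟨H, hH, rfl⟩ := h.exists_eq_adGrading
    obtain ⟨H', hH', rfl⟩ := h'.exists_eq_adGrading
    obtain ⟨y, hy, hy', a, b, rfl, hab⟩ := exists_slSub_add_blockScalar hH hx
    have h1 : (⟨y, hy⟩ : slSub F m n) ∈ inducedSl ((gl F m n).adGrading H) j := hy'
    rw [heq] at h1
    exact Submodule.add_mem _ h1 (hab H' hH')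
  intro 𝒜 h 𝒜' h' heq
  funext j
  exact le_antisymm (key 𝒜 𝒜' h h' heq j) (key 𝒜' 𝒜 h' h heq.symm j)

/-- Every good grading of `sl(m|n)`, `m ≠ n`, is induced by one of `gl(m|n)`. -/
theorem exists_good_of_good_sl (hmn : m ≠ n) {ℬ : ℤ → Submodule F (slSub F m n)}
    (hℬ : (sl F m n).IsGoodGrading e ℬ) :
    ∃ 𝒜, (gl F m n).IsGoodGrading (e : Mat F m n) 𝒜 ∧ inducedSl 𝒜 = ℬ := by
  obtain ⟨D, hD, htop, hder, hpar⟩ := hℬ.isGrading.exists_derivation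
  have he : (e : Mat F m n) ∈ matParity F m n 0 := hℬ.even
  have hne : (m - n : F) ≠ 0 := sub_ne_zero.2 (Nat.cast_injective.ne hmn)
  have hstr : supertrace F m n 1 = m - n := by
    rw [← blockScalar_one_one, supertrace_blockScalar, one_mul, one_mul]
  -- Since the identity has supertrace `m - n ≠ 0`, this is the projection to `sl` along the centre.
  -- The operator `E` extends `D` by zero on scalars.
  let P : Mat F m n →ₗ[F] slSub F m n := LinearMap.codRestrict _
    (LinearMap.id - (LinearMap.toSpanSingleton F (Mat F m n) 1) ∘ₗ
      ((m - n : F)⁻¹ • supertrace F m n)) (fun x => by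
        simp only [LinearMap.sub_apply, LinearMap.id_apply, LinearMap.comp_apply,
          LinearMap.smul_apply, LinearMap.toSpanSingleton_apply, LinearMap.mem_ker, map_sub,
          map_smul, hstr, smul_eq_mul]
        field_simp
        ring)
  have hP : ∀ x, (P x : Mat F m n) = x - ((m - n : F)⁻¹ * supertrace F m n x) • 1 := fun _ => rfl
  have hPsl : ∀ x : slSub F m n, P x = x := fun x => Subtype.ext (by
    rw [hP, LinearMap.mem_ker.1 x.2, mul_zero, zero_smul, sub_zero])
  have hPone : P 1 = 0 := Subtype.ext (by
    rw [hP, hstr, inv_mul_cancel₀ hne, one_smul, sub_self]; rfl)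
  let E : Module.End F (Mat F m n) := (slSub F m n).subtype ∘ₗ D ∘ₗ P
  have hE : ∀ x, E x = D (P x) := fun _ => rfl
  have hbr : ∀ x y : Mat F m n, (gl F m n).bracket x y = (sl F m n).bracket (P x) (P y) := by
    intro x y
    rw [coe_sl_bracket, hP, hP]
    simp only [map_sub, LinearMap.sub_apply, gl_bracket_smul_one_left, gl_bracket_smul_one_right,
      sub_zero]
  have hbr_left : ∀ (x : Mat F m n) (y : slSub F m n),
      (gl F m n).bracket x y = (sl F m n).bracket (P x) y := fun x y => by rw [hbr, hPsl]
  have hbr_right : ∀ (x : slSub F m n) (y : Mat F m n),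
      (gl F m n).bracket x y = (sl F m n).bracket x (P y) := fun x y => by rw [hbr, hPsl]
  have hEtop : ⨆ j : ℤ, E.eigenspace (j : F) = ⊤ := by
    rw [eq_top_iff]
    intro x _
    have h1 : ∀ y ∈ ⨆ j : ℤ, D.eigenspace (j : F), (y : Mat F m n) ∈
        ⨆ j : ℤ, E.eigenspace (j : F) := by
      intro y hy
      induction hy using Submodule.iSup_induction' with
      | mem j y hy =>
        refine Submodule.mem_iSup_of_mem j ?_
        rw [Module.End.mem_eigenspace_iff] at hy ⊢
        rw [hE, hPsl, hy]; rfl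
      | zero => exact Submodule.zero_mem _
      | add y z _ _ h1 h2 => exact Submodule.add_mem _ h1 h2
    have h2 : (1 : Mat F m n) ∈ ⨆ j : ℤ, E.eigenspace (j : F) := by
      refine Submodule.mem_iSup_of_mem 0 ?_
      rw [Module.End.mem_eigenspace_iff, hE, hPone]
      simp
    have h3 : x = P x + ((m - n : F)⁻¹ * supertrace F m n x) • 1 := by rw [hP]; abel
    rw [h3]
    exact Submodule.add_mem _ (h1 _ (htop ▸ Submodule.mem_top)) (Submodule.smul_mem _ _ h2)
  obtain ⟨H, hH, hEH⟩ := exists_eq_bracket_of_derivation hEtop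
    (by
      intro a x hx
      refine hpar a (P x) ?_
      change (P x : Mat F m n) ∈ matParity F m n a
      rw [hP]
      rcases zmod_two_cases a with rfl | rfl
      · exact Submodule.sub_mem _ hx (smul_one_mem_matParity _)
      · rw [supertrace_odd hx, mul_zero, zero_smul, sub_zero]; exact hx)
    (by
      intro x y
      rw [hbr, hE, hPsl, hder, hE, hE, hbr_left, hbr_right]
      rfl)
    (by rw [hE, hPone, map_zero]; rfl)
  have hHD : ∀ x : slSub F m n, (gl F m n).bracket H x = D x := fun x => by
    rw [← hEH, hE, hPsl]
  have hind : inducedSl ((gl F m n).adGrading H) = ℬ := by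
    funext j
    ext x
    rw [hD, Module.End.mem_eigenspace_iff, Subtype.ext_iff, ← hHD]
    exact Module.End.mem_eigenspace_iff
  refine ⟨_, isGoodGrading_adGrading hH he (by rw [← hEtop, hEH]; rfl) ?_ ?_, hind⟩
  · have h1 := hℬ.mem_two
    rw [← hind] at h1
    simpa using (mem_adGrading_iff hH).1 h1
  -- Only negative degrees have to be tested, and these lie entirely in `sl`.
  · intro j hj x hx hcomm
    have hx' := (mem_adGrading_iff hH).2 hx
    have hxs := mem_slSub_of_mem_adGrading (by omega) hx'
    have h1 : (⟨x, hxs⟩ : slSub F m n) ∈ ℬ j := by rw [← hind]; exact hx'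
    have h2 := hℬ.injOn j hj h1 (Submodule.zero_mem _) (by
      rw [map_zero]
      refine Subtype.ext ?_
      rw [coe_sl_bracket, gl_bracket_even_left he, hcomm, sub_self]; rfl)
    exact congrArg Subtype.val h2

end Induced

end LieSuperalgebra

/-! ### Passage to `psl(n|n)` -/

namespace LieSuperalgebra

open Matrix

variable {F : Type*} [Field F] {m n : ℕ}

theorem slScalars_le_comap (H : Mat F m n) : slScalars F m n ≤ (slScalars F m n).comap
    (LinearMap.restrict ((gl F m n).bracket H) (bracket_mem_slSub H)) := by
  intro x hx
  obtain ⟨c, hc⟩ := Submodule.mem_span_singleton.1 hx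
  change (gl F m n).bracket H x ∈ Submodule.span F {(1 : Mat F m n)}
  rw [show (x : Mat F m n) = c • 1 from hc.symm, gl_bracket_smul_one_right]
  exact Submodule.zero_mem _

/-- The operator induced on `psl(m|n)` by the adjoint action of an element of `gl(m|n)`. -/
def pslAd (H : Mat F m n) : Module.End F (slSub F m n ⧸ slScalars F m n) :=
  (slScalars F m n).mapQ (slScalars F m n) _ (slScalars_le_comap H)

theorem pslAd_mkQ (H : Mat F m n) (x : slSub F m n) : pslAd H ((slScalars F m n).mkQ x) =
    (slScalars F m n).mkQ ⟨(gl F m n).bracket H x, bracket_mem_slSub H x x.2⟩ := rfl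

variable [CharZero F]

theorem inducedPsl_adGrading {H : Mat F m n} (htop : ⨆ j : ℤ, (gl F m n).adGrading H j = ⊤)
    (j : ℤ) : inducedPsl ((gl F m n).adGrading H) j = (pslAd H).eigenspace (j : F) := by
  rw [inducedPsl, inducedSl_adGrading]
  exact map_mkQ_intEigenspace (iSup_intEigenspace_restrict htop (bracket_mem_slSub H))
    (slScalars_le_comap H) j

theorem iSup_inducedPsl {H : Mat F m n} (htop : ⨆ j : ℤ, (gl F m n).adGrading H j = ⊤) :
    ⨆ j : ℤ, inducedPsl ((gl F m n).adGrading H) j = ⊤ := by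
  simp only [inducedPsl, inducedSl_adGrading]
  rw [← Submodule.map_iSup, iSup_intEigenspace_restrict htop (bracket_mem_slSub H),
    Submodule.map_top, Submodule.range_mkQ]

theorem isGrading_inducedPsl {H : Mat F m n} (hH : H ∈ matParity F m n 0)
    (htop : ⨆ j : ℤ, (gl F m n).adGrading H j = ⊤) :
    (psl F m n).IsGrading (inducedPsl ((gl F m n).adGrading H)) := by
  have htop' := iSup_inducedPsl htop
  rw [funext (inducedPsl_adGrading htop)] at htop' ⊢
  refine isGrading_of_derivation htop' (fun x y => ?_) (fun a x hx => ?_)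
  · obtain ⟨x, rfl⟩ := (slScalars F m n).mkQ_surjective x
    obtain ⟨y, rfl⟩ := (slScalars F m n).mkQ_surjective y
    rw [psl_bracket_mkQ, pslAd_mkQ, pslAd_mkQ, pslAd_mkQ, psl_bracket_mkQ, psl_bracket_mkQ,
      ← map_add]
    exact congrArg _ (Subtype.ext ((gl F m n).bracket_bracket_of_even hH x y))
  · obtain ⟨x, hx, rfl⟩ := hx
    exact ⟨_, (gl F m n).bracket_mem_of_even hH a x hx, rfl⟩

section Induced

variable {e : slSub F m n}

theorem isGoodGrading_inducedPsl {𝒜 : ℤ → Submodule F (Mat F m n)}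
    (h𝒜 : (gl F m n).IsGoodGrading (e : Mat F m n) 𝒜) :
    (psl F m n).IsGoodGrading ((slScalars F m n).mkQ e) (inducedPsl 𝒜) := by
  obtain ⟨H, hH, rfl⟩ := h𝒜.exists_eq_adGrading
  have htop := h𝒜.isGrading.isInternal.submodule_iSup_eq_top
  have he : (e : Mat F m n) ∈ matParity F m n 0 := h𝒜.even
  have hsl := isGoodGrading_inducedSl h𝒜
  refine ⟨isGrading_inducedPsl hH htop, ⟨e, he, rfl⟩, ⟨e, hsl.mem_two, rfl⟩, ?_, ?_⟩
  · rintro j hj _ ⟨x, hx, rfl⟩ _ ⟨y, hy, rfl⟩ hxy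
    rw [psl_bracket_mkQ, psl_bracket_mkQ, mkQ_eq_mkQ_iff, coe_sl_bracket, coe_sl_bracket,
      ← map_sub] at hxy
    obtain ⟨c, hc⟩ := Submodule.mem_span_singleton.1 hxy
    rw [gl_bracket_even_left he] at hc
    -- Two commutators with `e` that agree modulo scalars agree, because their difference is a
    -- scalar commutator.
    have h1 : (gl F m n).bracket (e : Mat F m n) x = (gl F m n).bracket (e : Mat F m n) y := by
      rw [← sub_eq_zero, ← map_sub, gl_bracket_even_left he, ← hc]
      exact smul_one_eq_zero_of_commutator hc.symm
    exact congrArg _ (hsl.injOn j hj hx hy (Subtype.ext h1))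
  · rintro j hj _ ⟨y, hy, rfl⟩
    obtain ⟨x, hx, rfl⟩ := hsl.surjOn j hj hy
    exact ⟨_, ⟨x, hx, rfl⟩, rfl⟩

theorem inducedPsl_injOn :
    Set.InjOn inducedPsl {𝒜 | (gl F m n).IsGoodGrading (e : Mat F m n) 𝒜} := by
  have key : ∀ 𝒜 𝒜', (gl F m n).IsGoodGrading (e : Mat F m n) 𝒜 →
      (gl F m n).IsGoodGrading (e : Mat F m n) 𝒜' → inducedPsl 𝒜 = inducedPsl 𝒜' →
      ∀ j, 𝒜 j ≤ 𝒜' j := by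
    intro 𝒜 𝒜' h h' heq j x hx
    obtain ⟨H, hH, rfl⟩ := h.exists_eq_adGrading
    obtain ⟨H', hH', rfl⟩ := h'.exists_eq_adGrading
    obtain ⟨y, hy, hy', a, b, rfl, hab⟩ := exists_slSub_add_blockScalar hH hx
    have h1 : (slScalars F m n).mkQ ⟨y, hy⟩ ∈ inducedPsl ((gl F m n).adGrading H) j :=
      ⟨⟨y, hy⟩, hy', rfl⟩
    rw [heq] at h1
    obtain ⟨z, hz, hzy⟩ := h1
    obtain ⟨c, hc⟩ := Submodule.mem_span_singleton.1 (mkQ_eq_mkQ_iff.1 hzy.symm)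
    have hz' : (z : Mat F m n) ∈ (gl F m n).adGrading H' j := hz
    -- In nonzero degree both representatives are traceless, so the scalar between them is zero; in
    -- degree zero scalars are harmless.
    have hc' : c • (1 : Mat F m n) ∈ (gl F m n).adGrading H' j := by
      by_cases hj : j = 0
      · rw [hj]; exact smul_one_mem_adGrading hH' c
      · rw [smul_one_eq_zero_of_trace]
        · exact Submodule.zero_mem _
        · rw [hc, trace_sub, trace_eq_zero_of_mem_adGrading hH' hj hz', sub_zero]
          exact trace_eq_zero_of_mem_adGrading hH hj hy'
    refine Submodule.add_mem _ ?_ (hab H' hH')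
    have : y = c • 1 + z := by rw [hc]; simp
    rw [this]
    exact Submodule.add_mem _ hc' hz'
  intro 𝒜 h 𝒜' h' heq
  funext j
  exact le_antisymm (key 𝒜 𝒜' h h' heq j) (key 𝒜' 𝒜 h' h heq.symm j)

end Induced

section Surjectivity

/-- An even derivation of `psl(n|n)`, `n ≥ 3`, is induced by an even element of `gl(n|n)`. -/
theorem exists_eq_pslAd (hn : 3 ≤ n) {D : Module.End F (slSub F n n ⧸ slScalars F n n)}
    (hder : ∀ x y, D ((psl F n n).bracket x y) =
      (psl F n n).bracket (D x) y + (psl F n n).bracket x (D y))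
    (hpar : ∀ a, ∀ x ∈ (psl F n n).parity a, D x ∈ (psl F n n).parity a) :
    ∃ H ∈ matParity F n n 0, D = pslAd H := by
  have hn0 : (n : F) ≠ 0 := Nat.cast_ne_zero.2 (by omega)
  have hstr : supertrace F n n 1 = 0 := by
    rw [← blockScalar_one_one, supertrace_blockScalar, sub_self]
  -- The identity now lies in `sl`, so the projection is taken along a block scalar instead. Block
  -- scalars commute with the even part, hence `P` does not affect brackets of even matrices.
  let P : Mat F n n →ₗ[F] slSub F n n := LinearMap.codRestrict _
    (LinearMap.id - (LinearMap.toSpanSingleton F (Mat F n n) (blockScalar F n n 1 0)) ∘ₗ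
      ((n : F)⁻¹ • supertrace F n n)) (fun x => by
        simp only [LinearMap.sub_apply, LinearMap.id_apply, LinearMap.comp_apply,
          LinearMap.smul_apply, LinearMap.toSpanSingleton_apply, LinearMap.mem_ker, map_sub,
          map_smul, supertrace_blockScalar, smul_eq_mul]
        field_simp
        ring)
  have hP : ∀ x, (P x : Mat F n n) =
    x - ((n : F)⁻¹ * supertrace F n n x) • blockScalar F n n 1 0 := fun _ => rfl
  have hPsl : ∀ x : slSub F n n, P x = x := fun x => Subtype.ext (by
    rw [hP, LinearMap.mem_ker.1 x.2, mul_zero, zero_smul, sub_zero])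
  have hP_par : ∀ a, ∀ x ∈ matParity F n n a, P x ∈ (sl F n n).parity a := by
    intro a x hx
    change (P x : Mat F n n) ∈ matParity F n n a
    rw [hP]
    rcases zmod_two_cases a with rfl | rfl
    · exact Submodule.sub_mem _ hx (Submodule.smul_mem _ _ (blockScalar_mem _ _))
    · rw [supertrace_odd hx, mul_zero, zero_smul, sub_zero]; exact hx
  -- The traceless representative gives a linear section of the quotient map; it respects parity
  -- because odd matrices are traceless.
  let s₀ : slSub F n n →ₗ[F] slSub F n n := LinearMap.codRestrict _
    ((LinearMap.id - (LinearMap.toSpanSingleton F (Mat F n n) 1) ∘ₗ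
      ((2 * n : F)⁻¹ • traceLinearMap (Fin n ⊕ Fin n) F F)) ∘ₗ (slSub F n n).subtype) (fun x => by
        simp only [LinearMap.sub_apply, LinearMap.id_apply, LinearMap.comp_apply,
          LinearMap.smul_apply, LinearMap.toSpanSingleton_apply, LinearMap.mem_ker, map_sub,
          map_smul, hstr, smul_zero, sub_zero]
        exact x.2)
  have hs₀ : ∀ x : slSub F n n, (s₀ x : Mat F n n) =
    x - ((2 * n : F)⁻¹ * (x : Mat F n n).trace) • 1 := fun _ => rfl
  let s : (slSub F n n ⧸ slScalars F n n) →ₗ[F] slSub F n n := (slScalars F n n).liftQ s₀ (by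
    intro x hx
    obtain ⟨c, hc⟩ := Submodule.mem_span_singleton.1 hx
    refine Subtype.ext ?_
    rw [hs₀, show (x : Mat F n n) = c • 1 from hc.symm, trace_smul, trace_one]
    simp only [Fintype.card_sum, Fintype.card_fin, smul_eq_mul, Nat.cast_add]
    rw [show (2 * n : F)⁻¹ * (c * (n + n)) = c by field_simp; ring, sub_self]
    rfl)
  have hs : ∀ x, s ((slScalars F n n).mkQ x) = s₀ x := fun _ => rfl
  have hs_mkQ : ∀ y, (slScalars F n n).mkQ (s y) = y := by
    intro y
    obtain ⟨x, rfl⟩ := (slScalars F n n).mkQ_surjective y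
    rw [hs, mkQ_eq_mkQ_iff, hs₀, sub_sub_cancel_left]
    exact Submodule.neg_mem _ (Submodule.smul_mem _ _ (Submodule.mem_span_singleton_self _))
  have hs_par : ∀ a, ∀ y ∈ (psl F n n).parity a, (s y : Mat F n n) ∈ matParity F n n a := by
    rintro a _ ⟨x, hx, rfl⟩
    have hx' : (x : Mat F n n) ∈ matParity F n n a := hx
    rw [hs, hs₀]
    rcases zmod_two_cases a with rfl | rfl
    · exact Submodule.sub_mem _ hx' (smul_one_mem_matParity _)
    · rw [trace_odd hx', mul_zero, zero_smul, sub_zero]; exact hx'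
  let d : Mat F n n →ₗ[F] Mat F n n :=
    (slSub F n n).subtype ∘ₗ s ∘ₗ D ∘ₗ (slScalars F n n).mkQ ∘ₗ P
  have hd : ∀ x, d x = s (D ((slScalars F n n).mkQ (P x))) := fun _ => rfl
  have hd_par : ∀ a, ∀ x ∈ matParity F n n a, d x ∈ matParity F n n a := fun a x hx =>
    hs_par a _ (hpar a _ ⟨_, hP_par a x hx, rfl⟩)
  have hd_sl : ∀ x ∈ slSub F n n, ∀ y ∈ slSub F n n,
      d ((gl F n n).bracket x y) - ((gl F n n).bracket (d x) y + (gl F n n).bracket x (d y)) ∈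
        Submodule.span F {(1 : Mat F n n)} := by
    intro x hx y hy
    lift x to slSub F n n using hx
    lift y to slSub F n n using hy
    rw [← coe_sl_bracket, hd, hd, hd, hPsl, hPsl, hPsl, ← coe_sl_bracket, ← coe_sl_bracket,
      ← Submodule.coe_add, ← mkQ_eq_mkQ_iff, hs_mkQ, map_add, ← psl_bracket_mkQ,
      ← psl_bracket_mkQ, ← psl_bracket_mkQ, hs_mkQ, hs_mkQ, hder]
  have hP_even : ∀ x ∈ matParity F n n 0, (P x : Mat F n n) ∈ matParity F n n 0 :=
    fun x hx => hP_par 0 x hx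
  have hbr_left : ∀ x ∈ matParity F n n 0, ∀ y ∈ matParity F n n 0,
      (gl F n n).bracket (P x) y = (gl F n n).bracket x y := by
    intro x hx y hy
    rw [gl_bracket_even_left (hP_even x hx), gl_bracket_even_left hx, hP, sub_mul, mul_sub,
      smul_mul_assoc, mul_smul_comm, blockScalar_comm hy]
    abel
  have hbr_right : ∀ x ∈ matParity F n n 0, ∀ y ∈ matParity F n n 0,
      (gl F n n).bracket x (P y) = (gl F n n).bracket x y := by
    intro x hx y hy
    rw [gl_bracket_even_left hx, gl_bracket_even_left hx, hP, sub_mul, mul_sub,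
      smul_mul_assoc, mul_smul_comm, blockScalar_comm hx]
    abel
  have hdP : ∀ x, d (P x) = d x := fun x => by rw [hd, hPsl, ← hd]
  obtain ⟨H, hH, hHd⟩ := exists_inner_of_derivation_mod_scalars hn hn d hd_par
    (by
      intro x hx y hy
      have h1 := hd_sl _ (P x).2 _ (P y).2
      rwa [hdP, hdP, hbr_right _ (hP_even x hx) y hy, hbr_left x hx y hy,
        hbr_right _ (hd_par 0 x hx) y hy, hbr_left x hx _ (hd_par 0 y hy)] at h1)
    hd_sl
    (by
      have h1 : P (blockScalar F n n 1 0) = 0 := Subtype.ext (by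
        rw [hP, supertrace_blockScalar]
        simp [hn0])
      rw [hd, h1, map_zero, map_zero, map_zero]; rfl)
    (by
      -- The supertrace here is `-n`, so `P` completes this block scalar to the identity, which is
      -- zero in the quotient.
      have h1 : (slScalars F n n).mkQ (P (blockScalar F n n 0 1)) = 0 := by
        rw [← map_zero (slScalars F n n).mkQ, mkQ_eq_mkQ_iff, hP, supertrace_blockScalar]
        refine Submodule.mem_span_singleton.2 ⟨1, ?_⟩
        rw [← blockScalar_one_one, blockScalar_eq, blockScalar_eq, blockScalar_eq]
        simp [hn0, fromBlocks_add]
      rw [hd, h1, map_zero, map_zero]; rfl)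
  refine ⟨H, hH, LinearMap.ext fun x => ?_⟩
  obtain ⟨x, rfl⟩ := (slScalars F n n).mkQ_surjective x
  rw [pslAd_mkQ, ← hs_mkQ (D _), mkQ_eq_mkQ_iff]
  have := hHd x
  rwa [hd, hPsl] at this

/-- Every good grading of `psl(n|n)`, `n ≠ 2`, is induced by one of `gl(n|n)`. -/
theorem exists_good_of_good_psl (hn : n ≠ 2) {e : slSub F n n}
    (he : (e : Mat F n n) ∈ matParity F n n 0) (he_diag : ∀ i, (e : Mat F n n) i i = 0)
    {ℬ : ℤ → Submodule F (slSub F n n ⧸ slScalars F n n)}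
    (hℬ : (psl F n n).IsGoodGrading ((slScalars F n n).mkQ e) ℬ) :
    ∃ 𝒜, (gl F n n).IsGoodGrading (e : Mat F n n) 𝒜 ∧ inducedPsl 𝒜 = ℬ := by
  obtain ⟨D, hD, htop, hder, hpar⟩ := hℬ.isGrading.exists_derivation
  obtain ⟨H, hH, rfl⟩ : ∃ H ∈ matParity F n n 0, D = pslAd H := by
    rcases le_or_gt 3 n with h3 | h3
    · exact exists_eq_pslAd h3 hder hpar
    -- For `n ≤ 1` the blocks are too small for a nonzero nilpotent, so `e = 0`. Goodness then puts
    -- everything in degree zero, and `D = 0` is induced by `H = 0`.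
    have hsub : Subsingleton (Fin n) := Fin.subsingleton_iff_le_one.2 (by omega)
    have he0 : e = 0 := by
      refine Subtype.ext ?_
      ext i j
      rcases i with i | i <;> rcases j with j | j
      · rw [Subsingleton.elim j i]; exact he_diag _
      · exact he _ _ (by simp [idxParity])
      · exact he _ _ (by simp [idxParity])
      · rw [Subsingleton.elim j i]; exact he_diag _
    rw [he0, map_zero] at hℬ
    refine ⟨0, Submodule.zero_mem _, LinearMap.ext fun x => ?_⟩
    have hx : x ∈ ⨆ j : ℤ, D.eigenspace (j : F) := htop ▸ Submodule.mem_top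
    have h1 : D x = 0 := by
      induction hx using Submodule.iSup_induction' with
      | mem j x hx =>
        by_cases hj : j = 0
        · rw [Module.End.mem_eigenspace_iff.1 hx, hj, Int.cast_zero, zero_smul]
        · rw [← hD, hℬ.eq_bot_of_zero hj, Submodule.mem_bot] at hx
          rw [hx, map_zero]
      | zero => exact map_zero _
      | add x y _ _ h1 h2 => rw [map_add, h1, h2, add_zero]
    obtain ⟨x, rfl⟩ := (slScalars F n n).mkQ_surjective x
    rw [h1, pslAd_mkQ, ← map_zero (slScalars F n n).mkQ]
    congr 1
    refine Subtype.ext ?_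
    simp
  have hlift : ∀ y ∈ ⨆ j : ℤ, (pslAd H).eigenspace (j : F), ∀ x : slSub F n n,
      (slScalars F n n).mkQ x = y → (x : Mat F n n) ∈ ⨆ j : ℤ, (gl F n n).adGrading H j := by
    intro y hy
    induction hy using Submodule.iSup_induction' with
    | mem j y hy =>
      rintro x rfl
      rw [Module.End.mem_eigenspace_iff, pslAd_mkQ, ← map_smul, mkQ_eq_mkQ_iff] at hy
      obtain ⟨c, hc⟩ := Submodule.mem_span_singleton.1 hy
      have hc' : H * x - x * H = (j : F) • (x : Mat F n n) + c • 1 := by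
        rw [hc, ← gl_bracket_even_left hH]; simp
      -- Here `[H, x] = j x + c · 1`. For `j = 0` the error is a scalar commutator and vanishes; for
      -- `j ≠ 0` it is absorbed by adding `(c / j) · 1` to `x`.
      by_cases hj : j = 0
      · subst hj
        refine Submodule.mem_iSup_of_mem 0 ((mem_adGrading_iff hH).2 ?_)
        rw [Int.cast_zero, zero_smul, zero_add] at hc'
        rw [hc', smul_one_eq_zero_of_commutator hc', Int.cast_zero, zero_smul]
      · have hj' : (j : F) ≠ 0 := Int.cast_ne_zero.2 hj
        have h1 : (x : Mat F n n) + (c / j) • 1 ∈ (gl F n n).adGrading H j := by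
          rw [mem_adGrading_iff hH, mul_add, add_mul, mul_smul_comm, smul_mul_assoc, mul_one,
            one_mul, add_sub_add_right_eq_sub, hc', smul_add, smul_smul, mul_div_cancel₀ _ hj']
        rw [← add_sub_cancel_right (x : Mat F n n) ((c / j) • 1)]
        exact Submodule.sub_mem _ (Submodule.mem_iSup_of_mem j h1)
          (Submodule.mem_iSup_of_mem 0 (smul_one_mem_adGrading hH _))
    | zero =>
      intro x hx
      rw [← map_zero (slScalars F n n).mkQ, mkQ_eq_mkQ_iff] at hx
      obtain ⟨c, hc⟩ := Submodule.mem_span_singleton.1 hx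
      refine Submodule.mem_iSup_of_mem 0 ?_
      have h1 : (x : Mat F n n) = c • 1 := by rw [hc]; simp
      rw [h1]
      exact smul_one_mem_adGrading hH c
    | add y z _ _ h1 h2 =>
      intro x hx
      obtain ⟨y', rfl⟩ := (slScalars F n n).mkQ_surjective y
      have h3 := h2 (x - y') (by rw [map_sub, hx]; abel)
      have h4 := Submodule.add_mem _ (h1 y' rfl) h3
      simpa using h4
  have hgltop : ⨆ j : ℤ, (gl F n n).adGrading H j = ⊤ := by
    rw [eq_top_iff]
    intro x _
    rcases Nat.eq_zero_or_pos n with rfl | hn0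
    · rw [Subsingleton.elim x 0]; exact Submodule.zero_mem _
    have hn0' : (n : F) ≠ 0 := Nat.cast_ne_zero.2 hn0.ne'
    have h1 : x - blockScalar F n n (supertrace F n n x / n) 0 ∈ slSub F n n := by
      rw [LinearMap.mem_ker, map_sub, supertrace_blockScalar]
      field_simp
      ring
    have h2 := hlift _ (htop ▸ Submodule.mem_top) ⟨_, h1⟩ rfl
    rw [← sub_add_cancel x (blockScalar F n n (supertrace F n n x / n) 0)]
    exact Submodule.add_mem _ h2
      (Submodule.mem_iSup_of_mem 0 (blockScalar_mem_adGrading hH _ _))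
  have hind : inducedPsl ((gl F n n).adGrading H) = ℬ := by
    funext j
    rw [hD, inducedPsl_adGrading hgltop]
  refine ⟨_, isGoodGrading_adGrading hH he hgltop ?_ ?_, hind⟩
  · have h1 := hℬ.mem_two
    rw [hD, Module.End.mem_eigenspace_iff, pslAd_mkQ, ← map_smul, mkQ_eq_mkQ_iff] at h1
    obtain ⟨c, hc⟩ := Submodule.mem_span_singleton.1 h1
    -- Both `[H, e]` and `e` are traceless, so the relation `[H, e] = 2 e`, known modulo scalars,
    -- holds exactly.
    have h2 : c • (1 : Mat F n n) = 0 := by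
      refine smul_one_eq_zero_of_trace ?_
      rw [hc]
      simp only [gl_bracket_even_left hH, Submodule.coe_smul]
      rw [trace_sub, trace_sub, trace_mul_comm, sub_self, trace_smul,
        show (e : Mat F n n).trace = 0 from Finset.sum_eq_zero fun i _ => he_diag i]
      simp
    rw [h2] at hc
    have h3 := sub_eq_zero.1 hc.symm
    simp only [gl_bracket_even_left hH, Submodule.coe_smul] at h3
    simpa using h3
  · intro j hj x hx hcomm
    have hx' := (mem_adGrading_iff hH).2 hx
    have hxs := mem_slSub_of_mem_adGrading (by omega) hx'
    have h1 : (slScalars F n n).mkQ ⟨x, hxs⟩ ∈ ℬ j := by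
      rw [← hind]; exact ⟨⟨x, hxs⟩, hx', rfl⟩
    have h2 := hℬ.injOn j hj h1 (Submodule.zero_mem _) (by
      rw [map_zero, psl_bracket_mkQ, ← map_zero (slScalars F n n).mkQ]
      congr 1
      refine Subtype.ext ?_
      rw [coe_sl_bracket, gl_bracket_even_left he, hcomm, sub_self]; rfl)
    rw [← map_zero (slScalars F n n).mkQ, mkQ_eq_mkQ_iff] at h2
    obtain ⟨c, hc⟩ := Submodule.mem_span_singleton.1 h2
    have hxc : x = c • 1 := by rw [hc]; simp
    rw [hxc]
    refine smul_one_eq_zero_of_trace ?_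
    rw [← hxc]
    exact trace_eq_zero_of_mem_adGrading hH (by omega) hx'

end Surjectivity

end LieSuperalgebra

/-! ### The main theorem -/

theorem mainTheorem1 (F : Type*) [Field F] [IsAlgClosed F] [CharZero F] (m n : ℕ)
    (p : Nat.Partition m) (q : Nat.Partition n) (σ : Labelling p q) :
    -- every pyramid gives a good grading
    (∀ P ∈ Pyr p q, (gl F m n).IsGoodGrading (ePQ F σ) ((gl F m n).adGrading (hP F σ P))) ∧
    -- every good grading comes from a pyramid, up to an even automorphism fixing `e_{p,q}`
    (∀ 𝒜, (gl F m n).IsGoodGrading (ePQ F σ) 𝒜 →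
      ∃ P ∈ Pyr p q, ∃ g : (Mat F m n)ˣ, (g : Mat F m n) ∈ (gl F m n).parity 0 ∧
        (g : Mat F m n) * ePQ F σ * (↑g⁻¹ : Mat F m n) = ePQ F σ ∧
        𝒜 = (gl F m n).adGrading ((g : Mat F m n) * hP F σ P * (↑g⁻¹ : Mat F m n))) ∧
    -- no automorphism is needed if the diagonal matrices have degree zero
    (∀ 𝒜, (gl F m n).IsGoodGrading (ePQ F σ) 𝒜 →
      (∀ d : Fin m ⊕ Fin n → F, Matrix.diagonal d ∈ 𝒜 0) →
      ∃ P ∈ Pyr p q, 𝒜 = (gl F m n).adGrading (hP F σ P)) ∧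
    -- good gradings of `sl(m|n)`, `m ≠ n`
    (m ≠ n → Set.BijOn inducedSl {𝒜 | (gl F m n).IsGoodGrading (ePQ F σ) 𝒜}
      {ℬ | (sl F m n).IsGoodGrading (ePQsl F σ) ℬ}) ∧
    -- good gradings of `psl(n|n)`, `n ≠ 2`
    (m = n → n ≠ 2 → Set.BijOn inducedPsl {𝒜 | (gl F m n).IsGoodGrading (ePQ F σ) 𝒜}
      {ℬ | (psl F m n).IsGoodGrading ((slScalars F m n).mkQ (ePQsl F σ)) ℬ}) := by
  refine ⟨fun P hPyr => isGoodGrading_hP σ hPyr, fun 𝒜 h𝒜 => exists_pyramid_conj σ h𝒜,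
    fun 𝒜 h𝒜 hdiag => exists_pyramid_of_diagonal σ h𝒜 hdiag, fun hmn => ?_, fun hmn hn => ?_⟩
  · exact ⟨fun 𝒜 h𝒜 => isGoodGrading_inducedSl (e := ePQsl F σ) h𝒜,
      inducedSl_injOn (e := ePQsl F σ), fun ℬ hℬ => exists_good_of_good_sl hmn hℬ⟩
  · subst hmn
    refine ⟨fun 𝒜 h𝒜 => isGoodGrading_inducedPsl (e := ePQsl F σ) h𝒜,
      inducedPsl_injOn (e := ePQsl F σ), fun ℬ hℬ => exists_good_of_good_psl hn (ePQ_mem_even σ)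
        (fun i => ?_) hℬ⟩
    change ePQ F σ i i = 0
    simp [ePQ]
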